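/- **Setting.** For $L>0$ let $$f_L(z)=\sum_{n=0}^\infty a_n\binom{L+n-1}{n}^{1/2}z^n,\qquad |z|<1,\qquad \binom{L+n-1}{n}=\frac{\Gamma(L+n)}{\Gamma(n+1)\Gamma(L)},$$ where $(a_n)_{n\ge 0}$ are independent standard complex normal random variables (independent real and imaginary parts, each a centred real Gaussian of variance $1/2$); this is the hyperbolic Gaussian analytic function. For $0<r<1$ let $n_L(r)$ be the number of zeros of $f_L$, counted with multiplicity, in the disc $\{|z|<r\}$. **Theorem 1.2.** For all $L>0$ and $0<r<1$ the random variable $n_L(r)$ is square integrable, and its variance has the following asymptotics. In each part $o(1)$ denotes a quantity that tends to $0$ in the stated joint limit, that is, uniformly in both parameters $L$ and $r$, independently of the manner in which they approach their limits. (a) As $L\to\infty$ and $r\to1^-$, $$\operatorname{Var}[n_L(r)]=\frac{\zeta(3/2)}{8\sqrt{\pi}}\,\frac{\sqrt{L}}{1-r}\,(1+o(1)),$$ where $\zeta$ is the Riemann zeta function. In other words, $$\lim_{L\to\infty,\ r\to1^-}\frac{1-r}{\sqrt L}\operatorname{Var}[n_L(r)]=\frac{\zeta(3/2)}{8\sqrt{\pi}}.$$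 (b) As $L\to1/2^+$ and $r\to1^-$, $$\operatorname{Var}[n_L(r)]=\frac{1-(1-r)^{2L-1}}{8\pi(2L-1)(1-r)}\,(1+o(1)).$$ (c) As $L\to1/2^-$ and $r\to1^-$, $$\operatorname{Var}[n_L(r)]=\frac{1-(1-r)^{1-2L}}{8\pi(1-2L)(1-r)^{2-2L}}\,(1+o(1)).$$ (d) As $L\to0^+$, $r\to1^-$ and $\frac{L}{1-r}\to\infty$, $$\operatorname{Var}[n_L(r)]=\frac{L^2}{4}\,\frac{(1-r)^{2L-2}}{1-(1-r)^{2L}}\,(1+o(1)).$$ -/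

import Mathlib

open MeasureTheory ProbabilityTheory Filter Topology Asymptotics

noncomputable section

namespace HyperbolicGAF

/-- The standard complex normal law `N_ℂ(0, 1)`: the real and imaginary parts are independent
real Gaussians of mean `0` and variance `1/2`, so that `𝔼 |a|² = 1`. -/
def stdComplexNormal : Measure ℂ :=
  ((gaussianReal 0 (1 / 2)).prod (gaussianReal 0 (1 / 2))).map
    (fun p : ℝ × ℝ => (p.1 : ℂ) + (p.2 : ℂ) * Complex.I)

/-- The generalized binomial coefficient `(L + n - 1 choose n) = Γ(L + n) / (Γ(n + 1) Γ(L))`. -/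
def coeff (L : ℝ) (n : ℕ) : ℝ :=
  Real.Gamma (L + n) / (Real.Gamma (n + 1) * Real.Gamma L)

/-- The hyperbolic Gaussian analytic function of intensity `L` with random coefficients `a`:
`f_L(z) = ∑ aₙ (L + n - 1 choose n)^{1/2} zⁿ`, to be considered for `|z| < 1`. -/
def gaf {Ω : Type*} (a : ℕ → Ω → ℂ) (L : ℝ) (ω : Ω) (z : ℂ) : ℂ :=
  ∑' n : ℕ, a n ω * (Real.sqrt (coeff L n) : ℂ) * z ^ n

/-- The number of zeros of `f` in `D`, counted with multiplicity. For a holomorphic function on the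
unit disc that is not identically zero and `D = D(0, r)` with `r < 1`, this is a finite sum. -/
def zeroCount (f : ℂ → ℂ) (D : Set ℂ) : ℕ :=
  ∑ᶠ z ∈ D, analyticOrderNatAt f z

/-- The random variable `n_L(r)`: the number of zeros of `f_L` in the open disc `D(0, r)`. -/
def numZeros {Ω : Type*} (a : ℕ → Ω → ℂ) (L r : ℝ) (ω : Ω) : ℝ :=
  (zeroCount (gaf a L ω) (Metric.ball 0 r) : ℝ)

end HyperbolicGAF

end

noncomputable section

namespace HyperbolicGAF

/-! ### The coefficients and their generating function -/

/-! The proof finds an exact one-dimensional integral for the variance and then does real analysis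
on it.

By Jensen's formula the mean of `log |f|` over the circle of radius `s` is, as a function of `log
s`, a primitive of the zero count, so `n_L(r)` is a limit of difference quotients of `logMean`. For
jointly Gaussian values the covariance of `log |f(z)|` and `log |f(w)|` is one quarter of the
dilogarithm of the squared correlation `sqCorr` (`covariance_log_of_laplace`,
`IsRegular.covariance_log`). Expanding each power of `sqCorr` in a binomial series and averaging
over two circles gives `∑ c_p(s) c_p(t)`, an inner product in `ℓ²`
(`IsRegular.hasSum_covariance_logMean`). Since the difference quotients converge in `L²`, the
derivative may be taken coordinate by coordinate (`hasSum_variance_of_tendsto`), and the singularity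
of the dilogarithm on the diagonal never has to be differentiated. Resumming the squares by Parseval
in one index and a geometric series in the other yields `varianceIntegral`: with `b = 2r / (1 -
r²)`, the variance is `L² b² / (2π)` times the integral over `0 < ψ < π/2` of `x / ((1 + x) ((1 +
x)^L - 1))` at `x = b² sin² ψ`.

Put `R = 1 / (1 - r)`, which is asymptotic to `b`. For large `L` only `ψ` of order `1 / (b √L)`
matters, and the rescaled integrand tends to `s² / (exp (s²) - 1)`, whose integral produces `ζ(3/2)`
(`tendsto_pairIntegral_atTop`). Near `L = 1/2` the integrand is `(1 + x)^(-L)` up to a summable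
error, and `b` times the integral is comparable to `∫ t in 1..R, t^(-2L) = (R^δ - 1) / δ` with `δ =
1 - 2L`, on either side of `1/2` (`tendsto_pairIntegral_half`). For small `L` the factor `(1 + x)^L
- 1` may be replaced by `R^(2L) - 1`, whatever the relative speed of `L` and `r`
(`tendsto_pairIntegral_zero`). -/

lemma coeff_zero {L : ℝ} (hL : 0 < L) : coeff L 0 = 1 := by
  simp [coeff, (Real.Gamma_pos_of_pos hL).ne']

lemma coeff_pos {L : ℝ} (hL : 0 < L) (n : ℕ) : 0 < coeff L n := by
  unfold coeff
  have h1 := Real.Gamma_pos_of_pos (show 0 < L + n by positivity)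
  have h2 := Real.Gamma_pos_of_pos (show 0 < (n : ℝ) + 1 by positivity)
  have h3 := Real.Gamma_pos_of_pos hL
  positivity

lemma coeff_succ {L : ℝ} (hL : 0 < L) (n : ℕ) :
    coeff L (n + 1) = coeff L n * ((L + n) / (n + 1)) := by
  unfold coeff
  have h2 := Real.Gamma_pos_of_pos (show 0 < (n : ℝ) + 1 by positivity)
  have h3 := Real.Gamma_pos_of_pos hL
  have e1 : L + ((n + 1 : ℕ) : ℝ) = (L + n) + 1 := by push_cast; ring
  have e2 : (((n + 1 : ℕ) : ℝ) + 1) = ((n : ℝ) + 1) + 1 := by push_cast; ring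
  have h4 : (n : ℝ) + 1 ≠ 0 := by positivity
  rw [e1, e2, Real.Gamma_add_one (show L + n ≠ 0 by positivity), Real.Gamma_add_one h4]
  field_simp

lemma coeff_add_one {L : ℝ} (hL : 0 < L) (n : ℕ) :
    coeff (L + 1) n = coeff L n * ((L + n) / L) := by
  unfold coeff
  have h2 := Real.Gamma_pos_of_pos (show 0 < (n : ℝ) + 1 by positivity)
  have h3 := Real.Gamma_pos_of_pos hL
  have e1 : L + 1 + (n : ℝ) = (L + n) + 1 := by ring
  rw [e1, Real.Gamma_add_one (show L + n ≠ 0 by positivity), Real.Gamma_add_one hL.ne']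
  field_simp

lemma succ_mul_coeff_succ {L : ℝ} (hL : 0 < L) (n : ℕ) :
    ((n : ℝ) + 1) * coeff L (n + 1) = L * coeff (L + 1) n := by
  rw [coeff_succ hL, coeff_add_one hL]
  have h4 : (n : ℝ) + 1 ≠ 0 := by positivity
  field_simp

/-- Multiplied by `n!`, both sides become the rising factorial of `L`. This connects `coeff` with
the binomial series of `(1 - u)^(-L)`, which is phrased with `Ring.choose`. -/
lemma choose_eq_coeff {L : ℝ} (hL : 0 < L) (n : ℕ) :
    Ring.choose ((L : ℂ) + n - 1) n = (coeff L n : ℂ) := by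
  have key : ∀ n : ℕ, Ring.multichoose L n = coeff L n := by
    intro n
    have h := Ring.factorial_nsmul_multichoose_eq_ascPochhammer L n
    rw [Polynomial.ascPochhammer_smeval_eq_eval] at h
    have h' : (n.factorial : ℝ) * Ring.multichoose L n = (ascPochhammer ℝ n).eval L := by
      simpa [nsmul_eq_mul] using h
    have h'' : (n.factorial : ℝ) * coeff L n = (ascPochhammer ℝ n).eval L := by
      clear h h'
      induction n with
      | zero => simp [coeff_zero hL]
      | succ n ih =>
        rw [ascPochhammer_succ_eval, ← ih, coeff_succ hL, Nat.factorial_succ]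
        have h4 : (n : ℝ) + 1 ≠ 0 := by positivity
        push_cast
        field_simp
    have : (n.factorial : ℝ) ≠ 0 := by positivity
    exact mul_left_cancel₀ this (h'.trans h''.symm)
  have e : ((L : ℂ) + n - 1) = ((L + n - 1 : ℝ) : ℂ) := by push_cast; ring
  rw [e, ← Complex.ofReal_choose, ← key, Ring.choose]
  congr 2
  ring

lemma hasSum_coeff {L : ℝ} (hL : 0 < L) {u : ℂ} (hu : ‖u‖ < 1) :
    HasSum (fun n : ℕ => (coeff L n : ℂ) * u ^ n) (1 / (1 - u) ^ (L : ℂ)) := by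
  have h := Complex.one_div_one_sub_cpow_hasFPowerSeriesOnBall_zero (L : ℂ)
  have hu' : u ∈ Metric.eball (0 : ℂ) 1 := by
    rw [Metric.mem_eball, edist_zero_right, ← ofReal_norm, ← ENNReal.ofReal_one]
    exact (ENNReal.ofReal_lt_ofReal_iff one_pos).2 hu
  have h2 := h.hasSum hu'
  simp only [zero_add, FormalMultilinearSeries.ofScalars_apply_eq, smul_eq_mul,
    choose_eq_coeff hL] at h2
  exact h2

lemma norm_one_sub_pos {u : ℂ} (hu : ‖u‖ < 1) : 0 < ‖1 - u‖ := by
  rw [norm_pos_iff, sub_ne_zero]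
  rintro rfl
  simp at hu

lemma norm_one_div_cpow {L : ℝ} {u : ℂ} (hu : ‖u‖ < 1) :
    ‖1 / (1 - u) ^ (L : ℂ)‖ = ‖1 - u‖ ^ (-L) := by
  have h := norm_one_sub_pos hu
  rw [norm_div, norm_one, Complex.norm_cpow_of_ne_zero (norm_pos_iff.1 h), Real.rpow_neg h.le]
  simp

lemma hasSum_coeff_real {L : ℝ} (hL : 0 < L) {x : ℝ} (h0 : 0 ≤ x) (h1 : x < 1) :
    HasSum (fun n : ℕ => coeff L n * x ^ n) ((1 - x) ^ (-L)) := by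
  have h := hasSum_coeff hL (u := (x : ℂ)) (by simpa [abs_of_nonneg h0] using h1)
  have e : 1 / (1 - (x : ℂ)) ^ (L : ℂ) = (((1 - x) ^ (-L) : ℝ) : ℂ) := by
    rw [Real.rpow_neg (by linarith), Complex.ofReal_inv, Complex.ofReal_cpow (by linarith)]
    simp
  rw [e] at h
  rw [← Complex.hasSum_ofReal]
  simpa using h

/-- This is `u d/du` of the generating function. No differentiation is needed: `succ_mul_coeff_succ`
turns the shifted series into the one for `L + 1`. -/
lemma hasSum_mul_coeff {L : ℝ} (hL : 0 < L) {u : ℂ} (hu : ‖u‖ < 1) :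
    HasSum (fun n : ℕ => (n : ℂ) * coeff L n * u ^ n)
      (L * u / (1 - u) * (1 / (1 - u) ^ (L : ℂ))) := by
  have h := (hasSum_coeff (L := L + 1) (by linarith) hu).mul_left ((L : ℂ) * u)
  have h1 : 1 - u ≠ 0 := norm_pos_iff.1 (norm_one_sub_pos hu)
  rw [← hasSum_nat_add_iff' 1]
  simp only [Finset.range_one, Finset.sum_singleton, Nat.cast_zero, zero_mul, sub_zero]
  have e1 : (fun n : ℕ => ((n + 1 : ℕ) : ℂ) * coeff L (n + 1) * u ^ (n + 1))
      = fun n => (L : ℂ) * u * (coeff (L + 1) n * u ^ n) := by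
    funext n
    have h2 : ((n : ℂ) + 1) * (coeff L (n + 1) : ℂ) = L * (coeff (L + 1) n : ℂ) := by
      exact_mod_cast succ_mul_coeff_succ hL n
    push_cast
    rw [h2, pow_succ]; ring
  have e2 : (L : ℂ) * u / (1 - u) * (1 / (1 - u) ^ (L : ℂ))
      = L * u * (1 / (1 - u) ^ ((L + 1 : ℝ) : ℂ)) := by
    push_cast
    rw [Complex.cpow_add _ _ h1, Complex.cpow_one]
    field_simp
  rw [e1, e2]
  exact h

lemma sqrt_coeff_le (L : ℝ) (n : ℕ) (h : 0 ≤ coeff L n) : √(coeff L n) ≤ 1 + coeff L n := by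
  rw [Real.sqrt_le_left (by positivity)]
  nlinarith

lemma summable_sqrt_coeff {L : ℝ} (hL : 0 < L) {x : ℝ} (h0 : 0 ≤ x) (h1 : x < 1) :
    Summable (fun n : ℕ => √(coeff L n) * x ^ n) := by
  have h2 := (summable_geometric_of_lt_one h0 h1).add (hasSum_coeff_real hL h0 h1).summable
  refine Summable.of_nonneg_of_le (fun n => by positivity) (fun n => ?_) h2
  have := sqrt_coeff_le L n (coeff_pos hL n).le
  nlinarith [pow_nonneg h0 n]

/-! ### Averages over angles -/

/-- The uniform probability measure on `(0, 2π]`. -/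
def angle : Measure ℝ := ENNReal.ofReal (2 * Real.pi)⁻¹ • volume.restrict (Set.Ioc 0 (2 * Real.pi))

instance : IsProbabilityMeasure angle := by
  constructor
  have hp := Real.pi_pos
  simp only [angle, Measure.smul_apply, Measure.restrict_apply MeasurableSet.univ, Set.univ_inter,
    Real.volume_Ioc, sub_zero, smul_eq_mul]
  rw [← ENNReal.ofReal_mul (by positivity), inv_mul_cancel₀ (by positivity), ENNReal.ofReal_one]

lemma integral_angle {E : Type*} [NormedAddCommGroup E] [NormedSpace ℝ E] (g : ℝ → E) :
    ∫ θ, g θ ∂angle = (2 * Real.pi)⁻¹ • ∫ θ in (0 : ℝ)..2 * Real.pi, g θ := by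
  have hp := Real.pi_pos
  rw [angle, integral_smul_measure, intervalIntegral.integral_of_le (by positivity),
    ENNReal.toReal_ofReal (by positivity)]

lemma circleAverage_eq_integral_angle (f : ℂ → ℝ) (R : ℝ) :
    Real.circleAverage f 0 R = ∫ θ, f (circleMap 0 R θ) ∂angle := by
  rw [integral_angle, Real.circleAverage_def]

lemma integral_angle_exp (m n : ℕ) :
    ∫ θ : ℝ, Complex.exp (θ * Complex.I) ^ m * starRingEnd ℂ (Complex.exp (θ * Complex.I) ^ n) ∂angle
      = if m = n then 1 else 0 := by
  have e : ∀ θ : ℝ, Complex.exp (θ * Complex.I) ^ m *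
      starRingEnd ℂ (Complex.exp (θ * Complex.I) ^ n)
      = Complex.exp ((((m : ℂ) - n) * Complex.I) * θ) := by
    intro θ
    rw [← Complex.exp_nat_mul, ← Complex.exp_nat_mul, ← Complex.exp_conj, ← Complex.exp_add]
    congr 1
    simp
    ring
  simp_rw [e]
  split_ifs with h
  · subst h; simp
  · have hc : ((m : ℂ) - n) * Complex.I ≠ 0 := by
      simp [sub_eq_zero, h]
    rw [integral_angle, integral_exp_mul_complex hc]
    have : Complex.exp (((m : ℂ) - n) * Complex.I * ((2 * Real.pi : ℝ) : ℂ)) = 1 := by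
      rw [Complex.exp_eq_one_iff]
      exact ⟨(m : ℤ) - n, by push_cast; ring⟩
    rw [this]; simp

lemma norm_exp_mul_I (θ : ℝ) : ‖Complex.exp (θ * Complex.I)‖ = 1 :=
  Complex.norm_exp_ofReal_mul_I θ

/-- Parseval's identity for absolutely summable power series on the unit circle. -/
lemma integral_angle_norm_sq_tsum {d : ℕ → ℂ} (hd : Summable fun m => ‖d m‖) :
    ∫ θ : ℝ, ‖∑' m, d m * Complex.exp (θ * Complex.I) ^ m‖ ^ 2 ∂angle = ∑' m, ‖d m‖ ^ 2 := by
  set e : ℝ → ℂ := fun θ => Complex.exp (θ * Complex.I) with he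
  have hce : Continuous e := by fun_prop
  -- The squared modulus is a double series, absolutely summable uniformly in the angle. Integrating
  -- termwise, orthogonality of characters leaves the diagonal.
  let F : ℕ × ℕ → ℝ → ℂ := fun p θ => (d p.1 * e θ ^ p.1) * starRingEnd ℂ (d p.2 * e θ ^ p.2)
  have hFn : ∀ p θ, ‖F p θ‖ = ‖d p.1‖ * ‖d p.2‖ := by
    intro p θ
    simp [F, he]
  have hint : ∀ p, Integrable (F p) angle := by
    intro p
    refine Integrable.mono' (integrable_const (‖d p.1‖ * ‖d p.2‖)) ?_
      (ae_of_all _ fun θ => (hFn p θ).le)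
    exact (by fun_prop : Continuous (F p)).aestronglyMeasurable
  have hs : Summable fun p : ℕ × ℕ => ‖d p.1‖ * ‖d p.2‖ := hd.mul_of_nonneg hd (fun _ => norm_nonneg _) (fun _ => norm_nonneg _)
  have h1 := hasSum_integral_of_summable_integral_norm hint (by simpa [hFn] using hs)
  have hF : ∀ θ, ∑' p, F p θ = ((‖∑' m, d m * e θ ^ m‖ ^ 2 : ℝ) : ℂ) := by
    intro θ
    have hs1 : Summable fun m => ‖d m * e θ ^ m‖ := by
      simpa [he, norm_exp_mul_I] using hd
    have hs2 : Summable fun m => ‖starRingEnd ℂ (d m * e θ ^ m)‖ := by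
      simpa only [RCLike.norm_conj] using hs1
    rw [← tsum_mul_tsum_of_summable_norm hs1 hs2, ← Complex.conj_tsum, Complex.mul_conj,
      Complex.normSq_eq_norm_sq]
  have hI : ∀ p : ℕ × ℕ, ∫ θ, F p θ ∂angle
      = if p.1 = p.2 then ((‖d p.1‖ ^ 2 : ℝ) : ℂ) else 0 := by
    intro p
    have : ∀ θ, F p θ = (d p.1 * starRingEnd ℂ (d p.2)) * (e θ ^ p.1 * starRingEnd ℂ (e θ ^ p.2)) := by
      intro θ; simp only [F, map_mul]; ring
    simp_rw [this]
    rw [integral_const_mul, he, integral_angle_exp]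
    split_ifs with h
    · rw [h, Complex.mul_conj, Complex.normSq_eq_norm_sq]; simp
    · simp
  simp_rw [hF, hI] at h1
  rw [integral_complex_ofReal] at h1
  have h2 : HasSum (fun m : ℕ => ((‖d m‖ ^ 2 : ℝ) : ℂ))
      ((∫ θ : ℝ, ‖∑' m, d m * e θ ^ m‖ ^ 2 ∂angle : ℝ) : ℂ) := by
    have hinj : Function.Injective (fun m : ℕ => (m, m)) := fun a b h => (Prod.ext_iff.1 h).1
    rw [← hinj.hasSum_iff] at h1
    · simpa [Function.comp_def] using h1
    · rintro ⟨m, n⟩ hmn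
      rw [if_neg]
      intro h
      exact hmn ⟨m, Prod.ext rfl h⟩
  rw [Complex.hasSum_ofReal] at h2
  exact h2.tsum_eq.symm

/-! ### Frullani's integral and the covariance of logarithms -/

/-- The integrand of Frullani's integral for `log A`. -/
def frullani (A x : ℝ) : ℝ := (Real.exp (-x) - Real.exp (-(x * A))) / x

lemma measurable_frullani : Measurable (fun p : ℝ × ℝ => frullani p.1 p.2) := by
  unfold frullani
  fun_prop

lemma abs_exp_neg_sub_exp_neg_le (a b : ℝ) :
    |Real.exp (-a) - Real.exp (-b)| ≤ |a - b| * Real.exp (-(min a b)) := by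
  have key : ∀ a b : ℝ, a ≤ b → |Real.exp (-a) - Real.exp (-b)| ≤ |a - b| * Real.exp (-(min a b)) := by
    intro a b h
    rw [min_eq_left h, abs_of_nonneg (sub_nonneg.2 (Real.exp_le_exp.2 (by linarith))),
      abs_of_nonpos (by linarith)]
    have h1 : Real.exp (-b) = Real.exp (-a) * Real.exp (-(b - a)) := by
      rw [← Real.exp_add]; ring_nf
    have h2 := Real.add_one_le_exp (-(b - a))
    have h3 := Real.exp_pos (-a)
    rw [h1]
    nlinarith
  rcases le_total a b with h | h
  · exact key a b h
  · have := key b a h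
    rwa [abs_sub_comm, abs_sub_comm b a, min_comm] at this

lemma abs_frullani_le {A x : ℝ} (hx : 0 < x) :
    |frullani A x| ≤ |A - 1| * Real.exp (-(min 1 A) * x) := by
  have h := abs_exp_neg_sub_exp_neg_le x (x * A)
  have e1 : |x - x * A| = x * |A - 1| := by
    rw [show x - x * A = x * (1 - A) by ring, abs_mul, abs_of_pos hx, abs_sub_comm]
  have e2 : min x (x * A) = x * min 1 A := by
    rw [mul_min_of_nonneg _ _ hx.le, mul_one]
  rw [e1, e2] at h
  rw [frullani, abs_div, abs_of_pos hx, div_le_iff₀ hx]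
  calc _ ≤ _ := h
    _ = _ := by rw [show -(x * min 1 A) = -(min 1 A) * x by ring]; ring

lemma integrable_frullani {A : ℝ} (hA : 0 < A) :
    Integrable (frullani A) (volume.restrict (Set.Ioi 0)) := by
  have h1 : IntegrableOn (fun x : ℝ => |A - 1| * Real.exp (-(min 1 A) * x)) (Set.Ioi 0) :=
    (integrableOn_exp_mul_Ioi (by simp [hA]) 0).const_mul _
  refine Integrable.mono' h1
    (measurable_frullani.comp measurable_prodMk_left).aestronglyMeasurable ?_
  exact (ae_restrict_iff' measurableSet_Ioi).2 (ae_of_all _ fun x hx => abs_frullani_le hx)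

lemma integral_frullani {A : ℝ} (hA : 0 < A) :
    ∫ x in Set.Ioi 0, frullani A x = Real.log A := by
  have hc : Continuous (fun x : ℝ => Real.exp (-x)) := by fun_prop
  have h := Frullani.integral_Ioi_eq (f := fun x : ℝ => Real.exp (-x)) (a := 1) (b := A)
    (L := 1) (R := 0) (hc.locallyIntegrable.locallyIntegrableOn _) one_pos hA
    (by simpa using (hc.tendsto 0).mono_left nhdsWithin_le_nhds)
    (Real.tendsto_exp_neg_atTop_nhds_zero)
    (by
      refine (integrable_frullani hA).congr (ae_of_all _ fun x => ?_)
      simp only [frullani, smul_eq_mul, one_mul, mul_comm A]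
      ring)
  rw [div_one, sub_zero, smul_eq_mul, mul_one] at h
  rw [← h]
  refine integral_congr_ae (ae_of_all _ fun x => ?_)
  simp only [frullani, smul_eq_mul, one_mul, mul_comm A]
  ring

/-- The integrand has the sign of `A - 1` for all `x > 0`, so its `L¹` norm is exactly `|log A|`.
Hence square integrability of the logarithms is all that Fubini will require. -/
lemma integral_abs_frullani {A : ℝ} (hA : 0 < A) :
    ∫ x in Set.Ioi 0, ‖frullani A x‖ = |Real.log A| := by
  rcases le_total 1 A with h | h
  · rw [abs_of_nonneg (Real.log_nonneg h), ← integral_frullani hA]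
    refine setIntegral_congr_fun measurableSet_Ioi fun x (hx : 0 < x) => ?_
    refine Real.norm_of_nonneg (div_nonneg (sub_nonneg.2 (Real.exp_le_exp.2 ?_)) hx.le)
    nlinarith
  · rw [abs_of_nonpos (Real.log_nonpos hA.le h), ← integral_frullani hA, ← integral_neg]
    refine setIntegral_congr_fun measurableSet_Ioi fun x (hx : 0 < x) => ?_
    refine Real.norm_of_nonpos (div_nonpos_of_nonpos_of_nonneg
      (sub_nonpos.2 (Real.exp_le_exp.2 ?_)) hx.le)
    nlinarith

/-- The primitive is `(x / (1 + x))^(k + 1) / (k + 1)`. These integrals supply the two factors `1 /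
(k + 1)` of the dilogarithm series. -/
lemma integrable_pow_div_one_add_pow (k : ℕ) :
    IntegrableOn (fun x : ℝ => x ^ k / (1 + x) ^ (k + 2)) (Set.Ioi 0) ∧
      ∫ x in Set.Ioi (0 : ℝ), x ^ k / (1 + x) ^ (k + 2) = 1 / (k + 1) := by
  have hk : (k : ℝ) + 1 ≠ 0 := by positivity
  have hd : ∀ x ∈ Set.Ici (0 : ℝ), HasDerivAt (fun x : ℝ => (x / (1 + x)) ^ (k + 1) / (k + 1))
      (x ^ k / (1 + x) ^ (k + 2)) x := by
    intro x hx
    have hx' : 0 ≤ x := hx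
    have h1 : (1 + x) ≠ 0 := by positivity
    have h2 : HasDerivAt (fun x : ℝ => (x / (1 + x)) ^ (k + 1) / (k + 1)) _ x :=
      (((hasDerivAt_id x).div ((hasDerivAt_id x).const_add 1) h1).pow (k + 1)).div_const
        ((k : ℝ) + 1)
    refine h2.congr_deriv ?_
    simp only [id, Nat.add_sub_cancel, Pi.div_apply, div_pow]
    push_cast
    field_simp
    ring
  have hlim : Tendsto (fun x : ℝ => (x / (1 + x)) ^ (k + 1) / (k + 1)) atTop
      (𝓝 (1 / (k + 1))) := by
    have h0 : Tendsto (fun x : ℝ => x / (1 + x)) atTop (𝓝 1) := by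
      have h1 : Tendsto (fun x : ℝ => 1 - (1 + x)⁻¹) atTop (𝓝 (1 - 0)) :=
        tendsto_const_nhds.sub (tendsto_inv_atTop_zero.comp (tendsto_atTop_add_const_left _ _ tendsto_id))
      rw [sub_zero] at h1
      refine h1.congr' ?_
      filter_upwards [eventually_gt_atTop 0] with x hx
      have : 1 + x ≠ 0 := by positivity
      field_simp
      ring
    simpa using (h0.pow (k + 1)).div_const ((k : ℝ) + 1)
  have hnn : ∀ x ∈ Set.Ioi (0 : ℝ), 0 ≤ x ^ k / (1 + x) ^ (k + 2) := by
    intro x hx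
    have : 0 < x := hx
    positivity
  refine ⟨integrableOn_Ioi_deriv_of_nonneg' hd hnn hlim, ?_⟩
  rw [integral_Ioi_of_hasDerivAt_of_nonneg' hd hnn hlim]
  simp

/-- The covariance of the logarithms of two positive random variables whose joint Laplace transform
is that of the squared moduli of two standard complex Gaussians with squared correlation `ρ`. -/
theorem covariance_log_of_laplace {Ω : Type*} [MeasurableSpace Ω] {P : Measure Ω}
    [IsProbabilityMeasure P] {A B : Ω → ℝ} (hA : Measurable A) (hB : Measurable B)
    (hA0 : ∀ᵐ ω ∂P, 0 < A ω) (hB0 : ∀ᵐ ω ∂P, 0 < B ω)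
    (hA2 : MemLp (fun ω => Real.log (A ω)) 2 P) (hB2 : MemLp (fun ω => Real.log (B ω)) 2 P)
    {ρ : ℝ} (hρ0 : 0 ≤ ρ) (hρ1 : ρ ≤ 1)
    (hlap : ∀ x y : ℝ, 0 ≤ x → 0 ≤ y → ∫ ω, Real.exp (-(x * A ω)) * Real.exp (-(y * B ω)) ∂P
      = 1 / ((1 + x) * (1 + y) - x * y * ρ)) :
    cov[fun ω => Real.log (A ω), fun ω => Real.log (B ω); P]
      = ∑' k : ℕ, ρ ^ (k + 1) / ((k : ℝ) + 1) ^ 2 := by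
  -- With Frullani's integral for both logarithms, the covariance becomes a double integral over `x,
  -- y > 0` of the covariance of `exp (-xA)` and `exp (-yB)` divided by `xy`, which the joint
  -- Laplace transform makes explicit.
  set μ : Measure ℝ := volume.restrict (Set.Ioi 0) with hμ
  have hpos : ∀ᵐ p ∂(μ.prod μ), 0 < p.1 ∧ 0 < p.2 := by
    rw [hμ, Measure.prod_restrict]
    exact (ae_restrict_iff' (measurableSet_Ioi.prod measurableSet_Ioi)).2
      (ae_of_all _ fun p hp => hp)
  -- the one-variable expectations
  have hone : ∀ {C : Ω → ℝ}, Measurable C → (∀ᵐ ω ∂P, 0 < C ω) →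
      MemLp (fun ω => Real.log (C ω)) 2 P →
      Integrable (fun p : Ω × ℝ => frullani (C p.1) p.2) (P.prod μ) := by
    intro C hC hC0 hC2
    have hm : Measurable (fun p : Ω × ℝ => frullani (C p.1) p.2) :=
      measurable_frullani.comp ((hC.comp measurable_fst).prodMk measurable_snd)
    rw [integrable_prod_iff hm.aestronglyMeasurable]
    refine ⟨hC0.mono fun ω h => integrable_frullani h, ?_⟩
    refine (hC2.integrable one_le_two).norm.congr ?_
    filter_upwards [hC0] with ω h
    exact (integral_abs_frullani h).symm
  have hEone : ∀ {C : Ω → ℝ}, Measurable C → (∀ᵐ ω ∂P, 0 < C ω) →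
      MemLp (fun ω => Real.log (C ω)) 2 P →
      ∫ ω, Real.log (C ω) ∂P = ∫ x, ∫ ω, frullani (C ω) x ∂P ∂μ := by
    intro C hC hC0 hC2
    rw [← integral_integral_swap (hone hC hC0 hC2)]
    refine integral_congr_ae ?_
    filter_upwards [hC0] with ω h
    exact (integral_frullani h).symm
  have htwo : Integrable (fun p : Ω × (ℝ × ℝ) => frullani (A p.1) p.2.1 * frullani (B p.1) p.2.2)
      (P.prod (μ.prod μ)) := by
    have hm : Measurable (fun p : Ω × (ℝ × ℝ) =>
        frullani (A p.1) p.2.1 * frullani (B p.1) p.2.2) :=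
      (measurable_frullani.comp ((hA.comp measurable_fst).prodMk
        (measurable_fst.comp measurable_snd))).mul
      (measurable_frullani.comp ((hB.comp measurable_fst).prodMk
        (measurable_snd.comp measurable_snd)))
    rw [integrable_prod_iff hm.aestronglyMeasurable]
    constructor
    · filter_upwards [hA0, hB0] with ω h1 h2
      exact (integrable_frullani h1).mul_prod (integrable_frullani h2)
    · refine (hA2.integrable_mul hB2).norm.congr ?_
      filter_upwards [hA0, hB0] with ω h1 h2
      simp only [norm_mul]
      rw [integral_prod_mul (fun x => ‖frullani (A ω) x‖) (fun y => ‖frullani (B ω) y‖),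
        integral_abs_frullani h1, integral_abs_frullani h2]
      simp
  have hEtwo : ∫ ω, Real.log (A ω) * Real.log (B ω) ∂P
      = ∫ p, ∫ ω, frullani (A ω) p.1 * frullani (B ω) p.2 ∂P ∂(μ.prod μ) := by
    rw [← integral_integral_swap htwo]
    refine integral_congr_ae ?_
    filter_upwards [hA0, hB0] with ω h1 h2
    rw [integral_prod_mul (fun x => frullani (A ω) x) (fun y => frullani (B ω) y),
      integral_frullani h1, integral_frullani h2]
  have hEA := (hone hA hA0 hA2).integral_prod_right
  have hEB := (hone hB hB0 hB2).integral_prod_right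
  have hcov : cov[fun ω => Real.log (A ω), fun ω => Real.log (B ω); P]
      = ∫ p, ((∫ ω, frullani (A ω) p.1 * frullani (B ω) p.2 ∂P)
        - (∫ ω, frullani (A ω) p.1 ∂P) * (∫ ω, frullani (B ω) p.2 ∂P)) ∂(μ.prod μ) := by
    rw [covariance_eq_sub hA2 hB2, integral_sub htwo.integral_prod_right (hEA.mul_prod hEB),
      integral_prod_mul (fun x => ∫ ω, frullani (A ω) x ∂P) (fun y => ∫ ω, frullani (B ω) y ∂P),
      ← hEone hA hA0 hA2, ← hEone hB hB0 hB2, ← hEtwo]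
    rfl
  -- boundedness of the exponentials
  have hint : ∀ {C : Ω → ℝ}, Measurable C → (∀ᵐ ω ∂P, 0 < C ω) → ∀ x : ℝ, 0 ≤ x →
      MemLp (fun ω => Real.exp (-(x * C ω))) 2 P := by
    intro C hC hC0 x hx
    refine MemLp.of_bound (by fun_prop) 1 ?_
    filter_upwards [hC0] with ω h
    rw [Real.norm_eq_abs, Real.abs_exp, Real.exp_le_one_iff]
    nlinarith
  let F : ℕ → ℝ × ℝ → ℝ := fun k p =>
    ρ ^ (k + 1) * ((p.1 ^ k / (1 + p.1) ^ (k + 2)) * (p.2 ^ k / (1 + p.2) ^ (k + 2)))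
  have hker : ∀ p : ℝ × ℝ, 0 < p.1 ∧ 0 < p.2 →
      ((∫ ω, frullani (A ω) p.1 * frullani (B ω) p.2 ∂P)
        - (∫ ω, frullani (A ω) p.1 ∂P) * (∫ ω, frullani (B ω) p.2 ∂P)) = ∑' k, F k p := by
    rintro ⟨x, y⟩ ⟨hx, hy⟩
    simp only at hx hy ⊢
    have iA := hint hA hA0 x hx.le
    have iB := hint hB hB0 y hy.le
    have cA : MemLp (fun _ : Ω => Real.exp (-x)) 2 P := memLp_const _
    have cB : MemLp (fun _ : Ω => Real.exp (-y)) 2 P := memLp_const _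
    have hEx : ∫ ω, Real.exp (-(x * A ω)) ∂P = 1 / (1 + x) := by
      have := hlap x 0 hx.le le_rfl
      simpa using this
    have hEy : ∫ ω, Real.exp (-(y * B ω)) ∂P = 1 / (1 + y) := by
      have := hlap 0 y le_rfl hy.le
      simpa using this
    have e1 : (∫ ω, frullani (A ω) x * frullani (B ω) y ∂P)
        - (∫ ω, frullani (A ω) x ∂P) * (∫ ω, frullani (B ω) y ∂P)
        = cov[fun ω => frullani (A ω) x, fun ω => frullani (B ω) y; P] := by
      rw [covariance_eq_sub]
      · rfl
      · simpa [frullani, div_eq_mul_inv] using (cA.sub iA).mul_const x⁻¹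
      · simpa [frullani, div_eq_mul_inv] using (cB.sub iB).mul_const y⁻¹
    have e2 : cov[fun ω => frullani (A ω) x, fun ω => frullani (B ω) y; P]
        = cov[fun ω => Real.exp (-(x * A ω)), fun ω => Real.exp (-(y * B ω)); P] / (x * y) := by
      unfold frullani
      rw [covariance_fun_div_left, covariance_fun_div_right,
        covariance_const_sub_left (iA.integrable one_le_two),
        covariance_const_sub_right (iB.integrable one_le_two)]
      field_simp
    have e3 : cov[fun ω => Real.exp (-(x * A ω)), fun ω => Real.exp (-(y * B ω)); P]
        = 1 / ((1 + x) * (1 + y) - x * y * ρ) - 1 / (1 + x) * (1 / (1 + y)) := by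
      rw [covariance_eq_sub iA iB, ← hlap x y hx.le hy.le, ← hEx, ← hEy]
      rfl
    rw [e1, e2, e3]
    -- Since `(1 + x)(1 + y) - xyρ = (1 + x)(1 + y)(1 - q)`, the kernel is a geometric series in `q`
    -- whose terms separate the variables.
    set q : ℝ := ρ * (x / (1 + x)) * (y / (1 + y)) with hq
    have hx1 : x / (1 + x) < 1 := by rw [div_lt_one (by positivity)]; linarith
    have hy1 : y / (1 + y) < 1 := by rw [div_lt_one (by positivity)]; linarith
    have hx2 : 0 < x / (1 + x) := by positivity
    have hy2 : 0 < y / (1 + y) := by positivity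
    have hq0 : 0 ≤ q := by positivity
    have hq1 : q < 1 := by
      have : q ≤ 1 * (x / (1 + x)) * (y / (1 + y)) := by rw [hq]; gcongr
      nlinarith
    have hF : ∀ k, F k (x, y) = ρ / ((1 + x) ^ 2 * (1 + y) ^ 2) * q ^ k := by
      intro k
      simp only [F, hq, mul_pow, div_pow]
      field_simp
      ring
    simp_rw [hF]
    rw [tsum_mul_left, tsum_geometric_of_lt_one hq0 hq1]
    have h1 : 1 - q = ((1 + x) * (1 + y) - x * y * ρ) / ((1 + x) * (1 + y)) := by
      rw [hq]; field_simp
    have h2 : 0 < (1 + x) * (1 + y) - x * y * ρ := by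
      nlinarith [mul_pos hx hy, mul_nonneg (mul_pos hx hy).le (sub_nonneg.2 hρ1)]
    rw [h1]
    field_simp
    ring
  have hFint : ∀ k, Integrable (F k) (μ.prod μ) := fun k =>
    ((integrable_pow_div_one_add_pow k).1.mul_prod (integrable_pow_div_one_add_pow k).1).const_mul _
  have hFval : ∀ k, ∫ p, F k p ∂(μ.prod μ) = ρ ^ (k + 1) / ((k : ℝ) + 1) ^ 2 := by
    intro k
    simp only [F]
    rw [integral_const_mul, integral_prod_mul (fun x : ℝ => x ^ k / (1 + x) ^ (k + 2))
      (fun y : ℝ => y ^ k / (1 + y) ^ (k + 2)), (integrable_pow_div_one_add_pow k).2]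
    field_simp
  have hFnorm : ∀ k, ∫ p, ‖F k p‖ ∂(μ.prod μ) = ρ ^ (k + 1) / ((k : ℝ) + 1) ^ 2 := by
    intro k
    rw [← hFval k]
    refine integral_congr_ae ?_
    filter_upwards [hpos] with p hp
    have h1 := hp.1
    have h2 := hp.2
    exact Real.norm_of_nonneg (by positivity)
  have hsum : Summable fun k : ℕ => ρ ^ (k + 1) / ((k : ℝ) + 1) ^ 2 := by
    have h0 : Summable fun k : ℕ => 1 / ((k : ℝ) + 1) ^ 2 := by
      have := (summable_nat_add_iff 1).2 (Real.summable_one_div_nat_pow.2 one_lt_two)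
      simpa using this
    refine Summable.of_nonneg_of_le (fun k => by positivity) (fun k => ?_) h0
    gcongr
    exact pow_le_one₀ hρ0 hρ1
  have hS := hasSum_integral_of_summable_integral_norm hFint (by simpa only [hFnorm] using hsum)
  simp_rw [hFval] at hS
  rw [hcov, hS.tsum_eq]
  refine integral_congr_ae ?_
  filter_upwards [hpos] with p hp
  exact hker p hp

section

/-! ### The standard complex normal law -/

lemma measurable_re_add_im_mul_I :
    Measurable (fun p : ℝ × ℝ => (p.1 : ℂ) + (p.2 : ℂ) * Complex.I) := by fun_prop

instance : IsProbabilityMeasure stdComplexNormal :=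
  Measure.isProbabilityMeasure_map measurable_re_add_im_mul_I.aemeasurable

lemma integral_stdComplexNormal {E : Type*} [NormedAddCommGroup E] [NormedSpace ℝ E] {g : ℂ → E}
    (hg : StronglyMeasurable g) :
    ∫ ζ, g ζ ∂stdComplexNormal
      = ∫ p : ℝ × ℝ, g ((p.1 : ℂ) + (p.2 : ℂ) * Complex.I)
          ∂((gaussianReal 0 (1 / 2)).prod (gaussianReal 0 (1 / 2))) := by
  rw [stdComplexNormal, integral_map measurable_re_add_im_mul_I.aemeasurable
    hg.aestronglyMeasurable]

lemma integral_exp_mul_I_gaussianReal_half (t : ℝ) :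
    ∫ x : ℝ, Complex.exp ((x * t : ℝ) * Complex.I) ∂(gaussianReal 0 (1 / 2))
      = ((Real.exp (-(t ^ 2 / 4)) : ℝ) : ℂ) := by
  have h := charFun_gaussianReal (μ := 0) (v := 1 / 2) t
  rw [charFun_apply_real] at h
  have e : ∀ x : ℝ, Complex.exp ((x * t : ℝ) * Complex.I) = Complex.exp (t * x * Complex.I) := by
    intro x; push_cast; ring_nf
  simp_rw [e]
  rw [h]
  push_cast
  congr 1
  ring

/-- The characteristic function of the standard complex normal law. -/
lemma integral_exp_re_mul_I_stdComplexNormal (c : ℂ) :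
    ∫ ζ, Complex.exp (((ζ * c).re : ℝ) * Complex.I) ∂stdComplexNormal
      = ((Real.exp (-(‖c‖ ^ 2 / 4)) : ℝ) : ℂ) := by
  have hm : Measurable fun ζ : ℂ => Complex.exp (((ζ * c).re : ℝ) * Complex.I) := by fun_prop
  rw [integral_stdComplexNormal hm.stronglyMeasurable]
  have e : ∀ p : ℝ × ℝ, Complex.exp ((((((p.1 : ℂ) + (p.2 : ℂ) * Complex.I) * c).re : ℝ) : ℂ)
      * Complex.I) = Complex.exp ((p.1 * c.re : ℝ) * Complex.I)
        * Complex.exp ((p.2 * (-c.im) : ℝ) * Complex.I) := by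
    intro p
    rw [← Complex.exp_add, ← add_mul, ← Complex.ofReal_add]
    congr 3
    simp [Complex.mul_re]
    ring
  simp_rw [e]
  rw [integral_prod_mul (fun x : ℝ => Complex.exp ((x * c.re : ℝ) * Complex.I))
    (fun x : ℝ => Complex.exp ((x * (-c.im) : ℝ) * Complex.I)),
    integral_exp_mul_I_gaussianReal_half, integral_exp_mul_I_gaussianReal_half,
    ← Complex.ofReal_mul, ← Real.exp_add, ← Complex.normSq_eq_norm_sq, Complex.normSq_apply]
  congr 2
  ring

lemma integral_exp_quadratic_gaussianReal_half {α : ℝ} (hα : 0 < 1 + α) (t : ℝ) :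
    ∫ x : ℝ, Real.exp (-(α * x ^ 2) + x * t) ∂(gaussianReal 0 (1 / 2))
      = (√(1 + α))⁻¹ * Real.exp (t ^ 2 / (4 * (1 + α))) := by
  rw [integral_gaussianReal_eq_integral_smul (by norm_num)]
  have hp := Real.pi_pos
  -- Variance `1/2` makes the density `exp (-x²) / √π`; the rest is completing the square.
  have e : ∀ x : ℝ, gaussianPDFReal 0 (1 / 2) x • Real.exp (-(α * x ^ 2) + x * t)
      = (√Real.pi)⁻¹ * Real.exp (t ^ 2 / (4 * (1 + α))) *
        Real.exp (-(1 + α) * (x - t / (2 * (1 + α))) ^ 2) := by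
    intro x
    rw [gaussianPDFReal_def, smul_eq_mul]
    have h1 : 2 * Real.pi * ((1 / 2 : NNReal) : ℝ) = Real.pi := by push_cast; ring
    rw [h1, mul_assoc, mul_assoc, ← Real.exp_add, ← Real.exp_add]
    congr 2
    push_cast
    field_simp
    ring
  simp_rw [e]
  rw [integral_const_mul, integral_sub_right_eq_self (fun x : ℝ => Real.exp (-(1 + α) * x ^ 2)),
    integral_gaussian, Real.sqrt_div hp.le]
  have : √Real.pi ≠ 0 := by positivity
  field_simp

lemma integral_exp_quadratic_stdComplexNormal {α : ℝ} (hα : 0 < 1 + α) (c : ℂ) :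
    ∫ ζ, Real.exp (-(α * ‖ζ‖ ^ 2) + (ζ * c).re) ∂stdComplexNormal
      = (1 + α)⁻¹ * Real.exp (‖c‖ ^ 2 / (4 * (1 + α))) := by
  have hm : Measurable fun ζ : ℂ => Real.exp (-(α * ‖ζ‖ ^ 2) + (ζ * c).re) := by fun_prop
  rw [integral_stdComplexNormal hm.stronglyMeasurable]
  have e : ∀ p : ℝ × ℝ, Real.exp (-(α * ‖(p.1 : ℂ) + (p.2 : ℂ) * Complex.I‖ ^ 2)
      + (((p.1 : ℂ) + (p.2 : ℂ) * Complex.I) * c).re)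
      = Real.exp (-(α * p.1 ^ 2) + p.1 * c.re) * Real.exp (-(α * p.2 ^ 2) + p.2 * (-c.im)) := by
    intro p
    rw [← Real.exp_add, ← Complex.normSq_eq_norm_sq, Complex.normSq_add_mul_I]
    congr 1
    simp [Complex.mul_re]
    ring
  simp_rw [e]
  rw [integral_prod_mul (fun x : ℝ => Real.exp (-(α * x ^ 2) + x * c.re))
    (fun x : ℝ => Real.exp (-(α * x ^ 2) + x * (-c.im))),
    integral_exp_quadratic_gaussianReal_half hα, integral_exp_quadratic_gaussianReal_half hα,
    mul_mul_mul_comm, ← mul_inv, Real.mul_self_sqrt hα.le, ← Real.exp_add,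
    ← Complex.normSq_eq_norm_sq, Complex.normSq_apply]
  congr 2
  field_simp

lemma integrable_norm_stdComplexNormal : Integrable (fun ζ : ℂ => ‖ζ‖) stdComplexNormal := by
  rw [stdComplexNormal, integrable_map_measure (by fun_prop)
    measurable_re_add_im_mul_I.aemeasurable]
  have h1 : Integrable (fun x : ℝ => |x|) (gaussianReal 0 (1 / 2)) := by
    simpa using ((memLp_id_gaussianReal' (μ := 0) (v := 1 / 2) 1 (by simp)).integrable le_rfl).norm
  refine Integrable.mono' ((h1.comp_fst (gaussianReal 0 (1 / 2))).add
    (h1.comp_snd (gaussianReal 0 (1 / 2)))) (by fun_prop) (ae_of_all _ fun p => ?_)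
  simp only [Function.comp, norm_norm, Pi.add_apply]
  calc _ ≤ _ := norm_add_le _ _
    _ = _ := by simp

lemma stdComplexNormal_singleton_zero : stdComplexNormal {0} = 0 := by
  rw [stdComplexNormal, Measure.map_apply measurable_re_add_im_mul_I (by simp)]
  have : (fun p : ℝ × ℝ => (p.1 : ℂ) + (p.2 : ℂ) * Complex.I) ⁻¹' {0} ⊆ {0} ×ˢ Set.univ := by
    rintro ⟨x, y⟩ h
    have h' : (x : ℂ) + y * Complex.I = 0 := h
    have := congrArg Complex.re h'
    simpa using this
  refine measure_mono_null this ?_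
  have : NullSingletonClass (gaussianReal 0 (1 / 2)) :=
    nullSingletonClass_gaussianReal (by norm_num)
  rw [Measure.prod_prod, measure_singleton, zero_mul]

/-! ### Linear forms in independent standard complex normal variables -/

variable {Ω : Type*} [MeasurableSpace Ω] {P : Measure Ω} [IsProbabilityMeasure P]
  {a : ℕ → Ω → ℂ}

lemma measurable_tsum_of_summable {X : Type*} [MeasurableSpace X] {g : ℕ → X → ℂ}
    (hg : ∀ n, Measurable (g n)) (hs : ∀ x, Summable fun n => g n x) :
    Measurable fun x => ∑' n, g n x := by
  refine measurable_of_tendsto_metrizable (f := fun N x => ∑ n ∈ Finset.range N, g n x)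
    (fun N => Finset.measurable_sum _ fun n _ => hg n) ?_
  rw [tendsto_pi_nhds]
  exact fun x => (hs x).hasSum.tendsto_sum_nat

/-- Independence gives the characteristic function of each partial sum. The integrands have modulus
`1`, so dominated convergence carries the formula to the infinite sum. -/
lemma integral_exp_re_linear (ha : ∀ n, Measurable (a n))
    (hlaw : ∀ n, HasLaw (a n) stdComplexNormal P) (hindep : iIndepFun a P) {w : ℕ → ℂ}
    (hs : ∀ ω, Summable fun n => a n ω * w n) (hw : Summable fun n => ‖w n‖ ^ 2) :
    ∫ ω, Complex.exp (((∑' n, a n ω * w n).re : ℝ) * Complex.I) ∂P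
      = ((Real.exp (-((∑' n, ‖w n‖ ^ 2) / 4)) : ℝ) : ℂ) := by
  have hone : ∀ n, ∫ ω, Complex.exp (((a n ω * w n).re : ℝ) * Complex.I) ∂P
      = ((Real.exp (-(‖w n‖ ^ 2 / 4)) : ℝ) : ℂ) := by
    intro n
    rw [← integral_exp_re_mul_I_stdComplexNormal]
    exact (hlaw n).integral_comp (f := fun ζ => Complex.exp (((ζ * w n).re : ℝ) * Complex.I))
      (by fun_prop)
  have hfin : ∀ N, ∫ ω, Complex.exp (((∑ n ∈ Finset.range N, a n ω * w n).re : ℝ) * Complex.I) ∂P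
      = ((Real.exp (-((∑ n ∈ Finset.range N, ‖w n‖ ^ 2) / 4)) : ℝ) : ℂ) := by
    intro N
    have hm : ∀ n, Measurable fun ω => a n ω * w n := fun n => (ha n).mul_const _
    have hi : iIndepFun (fun n ω => a n ω * w n) P :=
      hindep.comp (fun n ζ => ζ * w n) (fun n => measurable_id.mul_const _)
    have h := congrFun (iIndepFun.charFun_map_fun_finsetSum_eq_prod (s := Finset.range N)
      (X := fun n ω => a n ω * w n) (fun n _ => (hm n).aemeasurable) (hi.restrict _)) 1
    have hc : ∀ X : Ω → ℂ, Measurable X → charFun (P.map X) 1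
        = ∫ ω, Complex.exp (((X ω).re : ℝ) * Complex.I) ∂P := by
      intro X hX
      rw [charFun_apply, integral_map hX.aemeasurable (by fun_prop)]
      simp [Complex.inner]
    rw [hc _ (Finset.measurable_sum _ fun n _ => hm n), Finset.prod_apply] at h
    rw [h, Finset.prod_congr rfl fun n _ => (hc _ (hm n)).trans (hone n), ← Complex.ofReal_prod,
      ← Real.exp_sum, Finset.sum_neg_distrib, Finset.sum_div]
  have hl1 : Tendsto (fun N => ∫ ω, Complex.exp (((∑ n ∈ Finset.range N, a n ω * w n).re : ℝ)
      * Complex.I) ∂P) atTop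
      (𝓝 (∫ ω, Complex.exp (((∑' n, a n ω * w n).re : ℝ) * Complex.I) ∂P)) := by
    refine tendsto_integral_of_dominated_convergence (fun _ => 1) (fun N => ?_)
      (integrable_const _) (fun N => ae_of_all _ fun ω => ?_) (ae_of_all _ fun ω => ?_)
    · have : Measurable fun ω => ∑ n ∈ Finset.range N, a n ω * w n :=
        Finset.measurable_sum _ fun n _ => (ha n).mul_const _
      have h2 : Measurable fun ζ : ℂ => Complex.exp ((ζ.re : ℝ) * Complex.I) := by fun_prop
      exact (h2.comp this).aestronglyMeasurable
    · rw [Complex.norm_exp_ofReal_mul_I]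
    · have h2 : Continuous fun ζ : ℂ => Complex.exp ((ζ.re : ℝ) * Complex.I) := by fun_prop
      exact (h2.tendsto _).comp (hs ω).hasSum.tendsto_sum_nat
  have hl2 : Tendsto (fun N => ((Real.exp (-((∑ n ∈ Finset.range N, ‖w n‖ ^ 2) / 4)) : ℝ) : ℂ))
      atTop (𝓝 ((Real.exp (-((∑' n, ‖w n‖ ^ 2) / 4)) : ℝ) : ℂ)) := by
    have h2 : Continuous fun t : ℝ => ((Real.exp (-(t / 4)) : ℝ) : ℂ) := by fun_prop
    exact (h2.tendsto _).comp hw.hasSum.tendsto_sum_nat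
  simp_rw [hfin] at hl1
  exact tendsto_nhds_unique hl1 hl2

/-- The joint Laplace transform of the squared moduli of two linear forms of unit variance. -/
theorem integral_exp_neg_normSq_linear (ha : ∀ n, Measurable (a n))
    (hlaw : ∀ n, HasLaw (a n) stdComplexNormal P) (hindep : iIndepFun a P) {v w : ℕ → ℂ}
    (hsv : ∀ ω, Summable fun n => a n ω * v n) (hsw : ∀ ω, Summable fun n => a n ω * w n)
    (hv : HasSum (fun n => ‖v n‖ ^ 2) 1) (hw : HasSum (fun n => ‖w n‖ ^ 2) 1) {κ : ℂ}
    (hκ : HasSum (fun n => v n * starRingEnd ℂ (w n)) κ) (hκ1 : ‖κ‖ ≤ 1)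
    {x y : ℝ} (hx : 0 ≤ x) (hy : 0 ≤ y) :
    ∫ ω, Real.exp (-(x * ‖∑' n, a n ω * v n‖ ^ 2)) * Real.exp (-(y * ‖∑' n, a n ω * w n‖ ^ 2)) ∂P
      = 1 / ((1 + x) * (1 + y) - x * y * ‖κ‖ ^ 2) := by
  set S : Ω → ℂ := fun ω => ∑' n, a n ω * v n with hS
  set T : Ω → ℂ := fun ω => ∑' n, a n ω * w n with hT
  have hSm : Measurable S := measurable_tsum_of_summable (fun n => (ha n).mul_const _) hsv
  have hTm : Measurable T := measurable_tsum_of_summable (fun n => (ha n).mul_const _) hsw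
  set γ := stdComplexNormal with hγ
  -- linearize the squares by auxiliary Gaussian variables
  have hlin : ∀ (x : ℝ), 0 ≤ x → ∀ ζ : ℂ, ((Real.exp (-(x * ‖ζ‖ ^ 2)) : ℝ) : ℂ)
      = ∫ η, Complex.exp (((η * (2 * √x * ζ)).re : ℝ) * Complex.I) ∂γ := by
    intro x hx ζ
    -- The characteristic function contains `‖c‖² / 4`, which the factor `2√x` turns into `x ‖ζ‖²`.
    rw [hγ, integral_exp_re_mul_I_stdComplexNormal]
    congr 3
    rw [norm_mul, norm_mul, Complex.norm_real, Real.norm_of_nonneg (Real.sqrt_nonneg x), mul_pow,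
      mul_pow, Real.sq_sqrt hx]
    norm_num
    ring
  let G : Ω → ℂ × ℂ → ℂ := fun ω η =>
    Complex.exp (((η.1 * (2 * √x * S ω)).re : ℝ) * Complex.I)
      * Complex.exp (((η.2 * (2 * √y * T ω)).re : ℝ) * Complex.I)
  have hG1 : ∀ ω, ((Real.exp (-(x * ‖S ω‖ ^ 2)) * Real.exp (-(y * ‖T ω‖ ^ 2)) : ℝ) : ℂ)
      = ∫ η, G ω η ∂(γ.prod γ) := by
    intro ω
    rw [Complex.ofReal_mul, hlin x hx, hlin y hy, ← integral_prod_mul]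
  have hGm : Measurable (fun p : Ω × (ℂ × ℂ) => G p.1 p.2) := by
    simp only [G]
    have h1 : Measurable fun p : Ω × (ℂ × ℂ) => S p.1 := hSm.comp measurable_fst
    have h2 : Measurable fun p : Ω × (ℂ × ℂ) => T p.1 := hTm.comp measurable_fst
    fun_prop
  have hGint : Integrable (fun p : Ω × (ℂ × ℂ) => G p.1 p.2) (P.prod (γ.prod γ)) := by
    refine Integrable.of_bound hGm.aestronglyMeasurable 1 (ae_of_all _ fun p => ?_)
    simp only [G, norm_mul, Complex.norm_exp_ofReal_mul_I, mul_one, le_refl]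
  have hG2 : ∀ η : ℂ × ℂ, ∫ ω, G ω η ∂P
      = ((Real.exp (-(x * ‖η.1‖ ^ 2)) * Real.exp (-(y * ‖η.2‖ ^ 2) +
          (η.2 * (-2 * √x * √y * starRingEnd ℂ (η.1 * κ))).re) : ℝ) : ℂ) := by
    rintro ⟨η, ξ⟩
    -- For fixed auxiliary values the exponent is the real part of a single linear form, with
    -- coefficients `u`; its variance involves `v` and `w` only through their norms and `κ`.
    set u : ℕ → ℂ := fun n => 2 * √x * η * v n + 2 * √y * ξ * w n with hu
    have e1 : ∀ ω, G ω (η, ξ) = Complex.exp (((∑' n, a n ω * u n).re : ℝ) * Complex.I) := by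
      intro ω
      have : ∑' n, a n ω * u n = η * (2 * √x * S ω) + ξ * (2 * √y * T ω) := by
        have h1 := ((hsv ω).hasSum.mul_left (η * (2 * √x))).add
          ((hsw ω).hasSum.mul_left (ξ * (2 * √y)))
        rw [show η * (2 * √x * S ω) + ξ * (2 * √y * T ω) = η * (2 * √x) * S ω + ξ * (2 * √y) * T ω
          by ring, ← h1.tsum_eq]
        refine tsum_congr fun n => ?_
        simp only [hu]; ring
      rw [this, Complex.add_re, Complex.ofReal_add, add_mul, Complex.exp_add]
    have hsu : ∀ ω, Summable fun n => a n ω * u n := by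
      intro ω
      refine (((hsv ω).mul_left (2 * √x * η)).add ((hsw ω).mul_left (2 * √y * ξ))).congr fun n => ?_
      simp only [hu]; ring
    have hnu : HasSum (fun n => ‖u n‖ ^ 2) (4 * (x * ‖η‖ ^ 2 * 1 + y * ‖ξ‖ ^ 2 * 1
        + 2 * (√x * √y * η * starRingEnd ℂ ξ * κ).re)) := by
      have hre := (Complex.hasSum_re (hκ.mul_left (√x * √y * η * starRingEnd ℂ ξ))).mul_left 2
      have h := (((hv.mul_left (x * ‖η‖ ^ 2)).add (hw.mul_left (y * ‖ξ‖ ^ 2))).add hre).mul_left 4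
      have e3 : ∀ n, ‖u n‖ ^ 2 = 4 * (x * ‖η‖ ^ 2 * ‖v n‖ ^ 2 + y * ‖ξ‖ ^ 2 * ‖w n‖ ^ 2
          + 2 * (√x * √y * η * starRingEnd ℂ ξ * (v n * starRingEnd ℂ (w n))).re) := ?_
      · simp_rw [e3]
        exact h
      intro n
      have e2 : 2 * (√x : ℂ) * η * v n * starRingEnd ℂ (2 * √y * ξ * w n)
          = ((4 : ℝ) : ℂ) * (√x * √y * η * starRingEnd ℂ ξ * (v n * starRingEnd ℂ (w n))) := by
        simp only [map_mul, Complex.conj_ofReal, map_ofNat]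
        push_cast
        ring
      simp only [hu]
      rw [← Complex.normSq_eq_norm_sq (_ + _), Complex.normSq_add, e2, Complex.re_ofReal_mul,
        Complex.normSq_eq_norm_sq, Complex.normSq_eq_norm_sq]
      simp only [norm_mul, Complex.norm_real, mul_pow, Complex.norm_ofNat,
        Real.norm_of_nonneg (Real.sqrt_nonneg _), Real.sq_sqrt hx, Real.sq_sqrt hy]
      ring
    simp_rw [e1]
    rw [integral_exp_re_linear ha hlaw hindep hsu hnu.summable, hnu.tsum_eq, ← Real.exp_add]
    congr 2
    have : (ξ * (-2 * √x * √y * starRingEnd ℂ (η * κ))).re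
        = -2 * (√x * √y * η * starRingEnd ℂ ξ * κ).re := by
      rw [← Complex.conj_re]
      simp only [map_mul, Complex.conj_conj, Complex.conj_ofReal, map_neg, map_ofNat]
      rw [show (starRingEnd ℂ ξ * (-2 * √x * √y * (η * κ)) : ℂ)
        = ((-2 : ℝ) : ℂ) * (√x * √y * η * starRingEnd ℂ ξ * κ) by push_cast; ring,
        Complex.re_ofReal_mul]
    rw [this]
    ring
  have hmain : ((∫ ω, Real.exp (-(x * ‖S ω‖ ^ 2)) * Real.exp (-(y * ‖T ω‖ ^ 2)) ∂P : ℝ) : ℂ)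
      = ((∫ η : ℂ × ℂ, Real.exp (-(x * ‖η.1‖ ^ 2)) * Real.exp (-(y * ‖η.2‖ ^ 2) +
          (η.2 * (-2 * √x * √y * starRingEnd ℂ (η.1 * κ))).re) ∂(γ.prod γ) : ℝ) : ℂ) := by
    rw [← integral_complex_ofReal, ← integral_complex_ofReal]
    simp_rw [hG1, ← hG2]
    exact integral_integral_swap hGint
  have hmain' := Complex.ofReal_injective hmain
  rw [hmain']
  have hint : Integrable (fun η : ℂ × ℂ => Real.exp (-(x * ‖η.1‖ ^ 2)) *
      Real.exp (-(y * ‖η.2‖ ^ 2) +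
          (η.2 * (-2 * √x * √y * starRingEnd ℂ (η.1 * κ))).re)) (γ.prod γ) := by
    have := hGint.integral_prod_right
    simp_rw [hG2] at this
    exact_mod_cast this.re
  rw [integral_prod _ hint]
  have h1y : 0 < 1 + y := by linarith
  -- This is the coefficient of `‖η‖²` left after integrating out the second auxiliary variable, a
  -- Schur complement. It is nonnegative because `‖κ‖ ≤ 1`.
  have hα : 0 ≤ x - x * y * ‖κ‖ ^ 2 / (1 + y) := by
    rw [sub_nonneg, div_le_iff₀ h1y]
    have h2 : ‖κ‖ ^ 2 ≤ 1 := pow_le_one₀ (norm_nonneg _) hκ1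
    nlinarith [mul_nonneg (mul_nonneg hx hy) (sub_nonneg.2 h2)]
  have e3 : ∀ η : ℂ, ∫ ξ, Real.exp (-(x * ‖η‖ ^ 2)) * Real.exp (-(y * ‖ξ‖ ^ 2) +
      (ξ * (-2 * √x * √y * starRingEnd ℂ (η * κ))).re) ∂γ
      = (1 + y)⁻¹ * Real.exp (-((x - x * y * ‖κ‖ ^ 2 / (1 + y)) * ‖η‖ ^ 2) + (η * 0).re) := by
    intro η
    rw [integral_const_mul, hγ, integral_exp_quadratic_stdComplexNormal h1y, mul_left_comm,
      ← Real.exp_add]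
    congr 2
    simp only [norm_mul, norm_neg, Complex.norm_real, RCLike.norm_conj, mul_pow, Complex.norm_ofNat,
      Real.norm_of_nonneg (Real.sqrt_nonneg _), Real.sq_sqrt hx, Real.sq_sqrt hy, mul_zero,
      Complex.zero_re, add_zero]
    field_simp
    ring
  simp_rw [e3]
  rw [integral_const_mul, hγ, integral_exp_quadratic_stdComplexNormal (by linarith), ← mul_assoc,
    ← mul_inv, norm_zero]
  have e4 : (1 + y) * (1 + (x - x * y * ‖κ‖ ^ 2 / (1 + y)))
      = (1 + x) * (1 + y) - x * y * ‖κ‖ ^ 2 := by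
    field_simp
    ring
  rw [e4]
  simp

end

section

/-! ### Square integrability of logarithms -/

/-- Here `1 / (1 + x)` is the Laplace transform of the exponential law, and integrating it against
`x^(-1/2)` gives the moment of order `-1/2` up to `Γ(1/2)`. -/
lemma integrable_rpow_div_one_add :
    IntegrableOn (fun x : ℝ => x ^ (-(1 / 2) : ℝ) / (1 + x)) (Set.Ioi 0) := by
  rw [← Set.Ioc_union_Ioi_eq_Ioi zero_le_one]
  have hm : Measurable (fun x : ℝ => x ^ (-(1 / 2) : ℝ) / (1 + x)) := by fun_prop
  refine IntegrableOn.union ?_ ?_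
  · have h : IntegrableOn (fun x : ℝ => x ^ (-(1 / 2) : ℝ)) (Set.Ioc 0 1) :=
      (intervalIntegrable_iff_integrableOn_Ioc_of_le zero_le_one).1
        (intervalIntegral.intervalIntegrable_rpow' (by norm_num))
    refine Integrable.mono' h hm.aestronglyMeasurable
      ((ae_restrict_iff' measurableSet_Ioc).2 (ae_of_all _ fun x hx => ?_))
    have hx0 : 0 < x := hx.1
    rw [Real.norm_of_nonneg (by positivity)]
    exact div_le_self (by positivity) (by linarith)
  · have h : IntegrableOn (fun x : ℝ => x ^ (-(3 / 2) : ℝ)) (Set.Ioi 1) :=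
      integrableOn_Ioi_rpow_of_lt (by norm_num) one_pos
    refine Integrable.mono' h hm.aestronglyMeasurable
      ((ae_restrict_iff' measurableSet_Ioi).2 (ae_of_all _ fun x hx => ?_))
    have hx1 : 1 < x := hx
    have hx0 : 0 < x := by linarith
    rw [Real.norm_of_nonneg (by positivity),
      show (-(3 / 2) : ℝ) = -(1 / 2) + -1 by norm_num, Real.rpow_add hx0, Real.rpow_neg_one,
      ← div_eq_mul_inv]
    gcongr
    linarith

/-- For `t ≥ 1` square `log t ≤ 4 t^(1/4)`, then use `t ↦ 1/t`. The exponents suit `t = |f|²`: the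
power `1/2` is a first absolute moment, and the power `-1/2` is read off the Laplace transform. -/
lemma log_sq_le {t : ℝ} (ht : 0 < t) :
    Real.log t ^ 2 ≤ 16 * (t ^ (1 / 2 : ℝ) + t ^ (-(1 / 2) : ℝ)) := by
  have key : ∀ t : ℝ, 1 ≤ t → Real.log t ^ 2 ≤ 16 * t ^ (1 / 2 : ℝ) := by
    intro t ht
    have h0 : 0 < t := by linarith
    have h1 := Real.log_le_rpow_div h0.le (show (0 : ℝ) < 1 / 4 by norm_num)
    have h2 := Real.log_nonneg ht
    have h3 : (t ^ (1 / 4 : ℝ)) ^ 2 = t ^ (1 / 2 : ℝ) := by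
      rw [← Real.rpow_natCast, ← Real.rpow_mul h0.le]; norm_num
    rw [← h3]
    calc Real.log t ^ 2 ≤ (t ^ (1 / 4 : ℝ) / (1 / 4)) ^ 2 := by gcongr
      _ = _ := by ring
  rcases le_total 1 t with h | h
  · have := key t h
    have := Real.rpow_nonneg ht.le (-(1 / 2) : ℝ)
    linarith
  · have h1 := key t⁻¹ ((one_le_inv₀ ht).2 h)
    rw [Real.log_inv, neg_sq, Real.inv_rpow ht.le, ← Real.rpow_neg ht.le] at h1
    have := Real.rpow_nonneg ht.le (1 / 2 : ℝ)
    linarith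

/-- The moment of order `-1/2` of a standard exponential variable. -/
def expMomentNegHalf : ℝ :=
  (Real.Gamma (1 / 2))⁻¹ * ∫ x in Set.Ioi (0 : ℝ), x ^ (-(1 / 2) : ℝ) / (1 + x)

/-- The first absolute moment of the standard complex normal law. -/
def normalAbsMoment : ℝ := ∫ ζ, ‖ζ‖ ∂stdComplexNormal

lemma integrable_norm_linear {Ω : Type*} [MeasurableSpace Ω] {P : Measure Ω} {a : ℕ → Ω → ℂ} (ha : ∀ n, Measurable (a n))
    (hlaw : ∀ n, HasLaw (a n) stdComplexNormal P) {w : ℕ → ℂ} (hw : Summable fun n => ‖w n‖)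
    (hs : ∀ ω, Summable fun n => ‖a n ω * w n‖) :
    Integrable (fun ω => ‖∑' n, a n ω * w n‖) P ∧
      ∫ ω, ‖∑' n, a n ω * w n‖ ∂P ≤ (∑' n, ‖w n‖) * normalAbsMoment := by
  have hm : Measurable fun ω => ∑' n, a n ω * w n :=
    measurable_tsum_of_summable (fun n => (ha n).mul_const _) fun ω => (hs ω).of_norm
  have hone : ∀ n, ∫⁻ ω, ‖a n ω * w n‖ₑ ∂P = ENNReal.ofReal (‖w n‖ * normalAbsMoment) := by
    intro n
    have h1 : ∫⁻ ω, ‖a n ω‖ₑ ∂P = ENNReal.ofReal normalAbsMoment := by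
      rw [(hlaw n).lintegral_comp (f := fun ζ : ℂ => ‖ζ‖ₑ) (by fun_prop), normalAbsMoment,
        ofReal_integral_eq_lintegral_ofReal integrable_norm_stdComplexNormal
          (ae_of_all _ fun _ => norm_nonneg _)]
      simp_rw [ofReal_norm]
    simp_rw [enorm_mul]
    rw [lintegral_mul_const _ (by fun_prop), h1, ← ofReal_norm, mul_comm, ENNReal.ofReal_mul (norm_nonneg _)]
  have hnn : 0 ≤ normalAbsMoment := integral_nonneg fun _ => norm_nonneg _
  have hle : ∫⁻ ω, ‖∑' n, a n ω * w n‖ₑ ∂P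
      ≤ ENNReal.ofReal ((∑' n, ‖w n‖) * normalAbsMoment) := by
    calc ∫⁻ ω, ‖∑' n, a n ω * w n‖ₑ ∂P
        ≤ ∫⁻ ω, ∑' n, ‖a n ω * w n‖ₑ ∂P := by
          refine lintegral_mono fun ω => ?_
          simp_rw [← ofReal_norm]
          rw [← ENNReal.ofReal_tsum_of_nonneg (fun _ => norm_nonneg _) (hs ω)]
          exact ENNReal.ofReal_le_ofReal (norm_tsum_le_tsum_norm (hs ω))
      _ = ∑' n, ∫⁻ ω, ‖a n ω * w n‖ₑ ∂P := lintegral_tsum fun n => by fun_prop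
      _ = ∑' n, ENNReal.ofReal (‖w n‖ * normalAbsMoment) := by simp_rw [hone]
      _ = _ := by
          rw [← ENNReal.ofReal_tsum_of_nonneg (fun _ => by positivity) (hw.mul_right _),
            tsum_mul_right]
  have hi : Integrable (fun ω => ∑' n, a n ω * w n) P :=
    ⟨hm.aestronglyMeasurable, lt_of_le_of_lt hle ENNReal.ofReal_lt_top⟩
  refine ⟨hi.norm, ?_⟩
  rw [integral_norm_eq_lintegral_enorm hm.aestronglyMeasurable]
  refine ENNReal.toReal_le_of_le_ofReal (mul_nonneg (tsum_nonneg fun _ => norm_nonneg _) hnn) hle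

section Moments

variable {Ω : Type*} [MeasurableSpace Ω] {P : Measure Ω} [IsProbabilityMeasure P]

/-- Fubini applied to `Γ(1/2) A^(-1/2) = ∫ x^(-1/2) exp (-xA) dx`. Almost sure positivity comes
along: where `A = 0` the integrand is `x^(-1/2)`, which is not integrable on the half-line. -/
lemma integrable_rpow_neg_half_of_laplace {A : Ω → ℝ} (hA : Measurable A) (hA0 : ∀ ω, 0 ≤ A ω)
    (hlap : ∀ x : ℝ, 0 ≤ x → ∫ ω, Real.exp (-(x * A ω)) ∂P = 1 / (1 + x)) :
    (∀ᵐ ω ∂P, 0 < A ω) ∧ Integrable (fun ω => A ω ^ (-(1 / 2) : ℝ)) P ∧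
      ∫ ω, A ω ^ (-(1 / 2) : ℝ) ∂P = expMomentNegHalf := by
  set μ : Measure ℝ := volume.restrict (Set.Ioi 0) with hμ
  have hm : Measurable (fun p : Ω × ℝ => p.2 ^ (-(1 / 2) : ℝ) * Real.exp (-(p.2 * A p.1))) := by
    have : Measurable fun p : Ω × ℝ => A p.1 := hA.comp measurable_fst
    fun_prop
  have hint : Integrable (fun p : Ω × ℝ => p.2 ^ (-(1 / 2) : ℝ) * Real.exp (-(p.2 * A p.1)))
      (P.prod μ) := by
    rw [integrable_prod_iff' hm.aestronglyMeasurable]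
    constructor
    · refine (ae_restrict_iff' measurableSet_Ioi).2 (ae_of_all _ fun x (hx : 0 < x) => ?_)
      have hmx : Measurable fun ω => Real.exp (-(x * A ω)) := by fun_prop
      have hb : Integrable (fun ω => Real.exp (-(x * A ω))) P := by
        refine Integrable.of_bound hmx.aestronglyMeasurable 1 (ae_of_all _ fun ω => ?_)
        rw [Real.norm_eq_abs, Real.abs_exp, Real.exp_le_one_iff]
        nlinarith [hA0 ω]
      exact hb.const_mul (x ^ (-(1 / 2) : ℝ))
    · refine Integrable.congr integrable_rpow_div_one_add
        ((ae_restrict_iff' measurableSet_Ioi).2 (ae_of_all _ fun x (hx : 0 < x) => ?_))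
      have : ∀ ω, ‖x ^ (-(1 / 2) : ℝ) * Real.exp (-(x * A ω))‖
          = x ^ (-(1 / 2) : ℝ) * Real.exp (-(x * A ω)) :=
        fun ω => Real.norm_of_nonneg (by positivity)
      simp_rw [this]
      rw [integral_const_mul, hlap x hx.le, mul_one_div]
  have hpos : ∀ᵐ ω ∂P, 0 < A ω := by
    filter_upwards [hint.prod_right_ae] with ω h
    rcases (hA0 ω).lt_or_eq with h1 | h1
    · exact h1
    · exfalso
      simp only [← h1, mul_zero, neg_zero, Real.exp_zero, mul_one] at h
      exact not_integrableOn_Ioi_rpow _ h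
  have hval : ∀ ω, 0 < A ω → ∫ x, x ^ (-(1 / 2) : ℝ) * Real.exp (-(x * A ω)) ∂μ
      = Real.Gamma (1 / 2) * A ω ^ (-(1 / 2) : ℝ) := by
    intro ω h
    have := Real.integral_rpow_mul_exp_neg_mul_Ioi (a := 1 / 2) (by norm_num) h
    rw [show (1 / 2 : ℝ) - 1 = -(1 / 2) by norm_num] at this
    simp_rw [mul_comm _ (A ω)]
    rw [hμ, this, one_div (A ω), Real.inv_rpow h.le, ← Real.rpow_neg h.le, mul_comm]
  have hG : Real.Gamma (1 / 2) ≠ 0 := (Real.Gamma_pos_of_pos (by norm_num)).ne'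
  have hae : (fun ω => (Real.Gamma (1 / 2))⁻¹ *
      ∫ x, x ^ (-(1 / 2) : ℝ) * Real.exp (-(x * A ω)) ∂μ) =ᵐ[P] fun ω => A ω ^ (-(1 / 2) : ℝ) := by
    filter_upwards [hpos] with ω h
    rw [hval ω h, inv_mul_cancel_left₀ hG]
  refine ⟨hpos, (hint.integral_prod_left.const_mul _).congr hae, ?_⟩
  rw [← integral_congr_ae hae, integral_const_mul, integral_integral_swap hint, expMomentNegHalf]
  congr 1
  refine setIntegral_congr_fun measurableSet_Ioi fun x (hx : 0 < x) => ?_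
  rw [integral_const_mul, hlap x hx.le, mul_one_div]

lemma memLp_log_of_laplace {A : Ω → ℝ} (hA : Measurable A) (hA0 : ∀ ω, 0 ≤ A ω)
    (hlap : ∀ x : ℝ, 0 ≤ x → ∫ ω, Real.exp (-(x * A ω)) ∂P = 1 / (1 + x))
    (hint : Integrable (fun ω => A ω ^ (1 / 2 : ℝ)) P) {C : ℝ}
    (hC : ∫ ω, A ω ^ (1 / 2 : ℝ) ∂P ≤ C) :
    MemLp (fun ω => Real.log (A ω)) 2 P ∧
      ∫ ω, Real.log (A ω) ^ 2 ∂P ≤ 16 * (C + expMomentNegHalf) := by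
  obtain ⟨hpos, hint', hval⟩ := integrable_rpow_neg_half_of_laplace hA hA0 hlap
  have hi := (hint.add hint').const_mul 16
  have hle : ∀ᵐ ω ∂P, ‖Real.log (A ω) ^ 2‖
      ≤ 16 * (A ω ^ (1 / 2 : ℝ) + A ω ^ (-(1 / 2) : ℝ)) := by
    filter_upwards [hpos] with ω h
    rw [Real.norm_of_nonneg (sq_nonneg _)]
    exact log_sq_le h
  have hsq : Integrable (fun ω => Real.log (A ω) ^ 2) P :=
    Integrable.mono' hi (hA.log.pow_const 2).aestronglyMeasurable hle
  refine ⟨(memLp_two_iff_integrable_sq hA.log.aestronglyMeasurable).2 hsq, ?_⟩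
  calc ∫ ω, Real.log (A ω) ^ 2 ∂P
      ≤ ∫ ω, 16 * (A ω ^ (1 / 2 : ℝ) + A ω ^ (-(1 / 2) : ℝ)) ∂P :=
        integral_mono_ae hsq hi (hle.mono fun ω h => (le_abs_self _).trans h)
    _ = 16 * ((∫ ω, A ω ^ (1 / 2 : ℝ) ∂P) + expMomentNegHalf) := by
        rw [integral_const_mul, integral_add hint hint', hval]
    _ ≤ _ := by gcongr

/-! ### Covariances of averages of random functions -/

lemma covariance_congr_ae {Ω : Type*} [MeasurableSpace Ω] {P : Measure Ω} {X Y X' Y' : Ω → ℝ}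
    (hX : X =ᵐ[P] X') (hY : Y =ᵐ[P] Y') : cov[X, Y; P] = cov[X', Y'; P] := by
  rw [covariance, covariance, integral_congr_ae hX, integral_congr_ae hY]
  refine integral_congr_ae ?_
  filter_upwards [hX, hY] with ω h1 h2
  rw [h1, h2]

/-- By the arithmetic-geometric inequality the `ω`-integral of the modulus is at most `C` for every
pair of parameters, and the parameters range over a probability space. -/
lemma integrable_prod_mul_of_sq_bound {X : Type*} [MeasurableSpace X] {ν : Measure X}
    [IsProbabilityMeasure ν] {U V : Ω × X → ℝ} (hU : Measurable U) (hV : Measurable V)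
    (hU2 : ∀ x, MemLp (fun ω => U (ω, x)) 2 P) (hV2 : ∀ x, MemLp (fun ω => V (ω, x)) 2 P) {C : ℝ}
    (hUC : ∀ x, ∫ ω, U (ω, x) ^ 2 ∂P ≤ C) (hVC : ∀ x, ∫ ω, V (ω, x) ^ 2 ∂P ≤ C) :
    Integrable (fun p : Ω × (X × X) => U (p.1, p.2.1) * V (p.1, p.2.2)) (P.prod (ν.prod ν)) := by
  have hm : Measurable (fun p : Ω × (X × X) => U (p.1, p.2.1) * V (p.1, p.2.2)) :=
    (hU.comp (by fun_prop)).mul (hV.comp (by fun_prop))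
  rw [integrable_prod_iff' hm.aestronglyMeasurable]
  refine ⟨ae_of_all _ fun q => (hU2 q.1).integrable_mul (hV2 q.2), ?_⟩
  refine Integrable.of_bound hm.norm.stronglyMeasurable.integral_prod_left'.aestronglyMeasurable C
    (ae_of_all _ fun q => ?_)
  rw [Real.norm_of_nonneg (integral_nonneg fun _ => norm_nonneg _)]
  have h1 := (hU2 q.1).integrable_sq
  have h2 := (hV2 q.2).integrable_sq
  calc ∫ ω, ‖U (ω, q.1) * V (ω, q.2)‖ ∂P
      ≤ ∫ ω, (U (ω, q.1) ^ 2 + V (ω, q.2) ^ 2) / 2 ∂P := by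
        refine integral_mono ((hU2 q.1).integrable_mul (hV2 q.2)).norm ((h1.add h2).div_const 2)
          fun ω => ?_
        simp only [norm_mul, Real.norm_eq_abs]
        nlinarith [sq_nonneg (|U (ω, q.1)| - |V (ω, q.2)|), sq_abs (U (ω, q.1)),
          sq_abs (V (ω, q.2))]
    _ ≤ (C + C) / 2 := by
        rw [integral_div, integral_add h1 h2]
        gcongr
        · exact hUC _
        · exact hVC _
    _ = C := by ring

/-- The square of an integral is a double integral over two copies of the parameter space. -/
lemma memLp_integral_of_sq_bound {X : Type*} [MeasurableSpace X] {ν : Measure X}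
    [IsProbabilityMeasure ν] {U : Ω × X → ℝ} (hU : Measurable U)
    (hU2 : ∀ x, MemLp (fun ω => U (ω, x)) 2 P) {C : ℝ}
    (hUC : ∀ x, ∫ ω, U (ω, x) ^ 2 ∂P ≤ C) :
    MemLp (fun ω => ∫ x, U (ω, x) ∂ν) 2 P := by
  have h := (integrable_prod_mul_of_sq_bound (ν := ν) hU hU hU2 hU2 hUC hUC).integral_prod_left
  rw [memLp_two_iff_integrable_sq hU.stronglyMeasurable.integral_prod_right'.aestronglyMeasurable]
  refine h.congr (ae_of_all _ fun ω => ?_)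
  simp only
  rw [integral_prod_mul (fun x => U (ω, x)) (fun x => U (ω, x)), sq]

lemma covariance_integral_integral {X : Type*} [MeasurableSpace X] {ν : Measure X}
    [IsProbabilityMeasure ν] {U V : Ω × X → ℝ} (hU : Measurable U) (hV : Measurable V)
    (hU2 : ∀ x, MemLp (fun ω => U (ω, x)) 2 P) (hV2 : ∀ x, MemLp (fun ω => V (ω, x)) 2 P) {C : ℝ}
    (hUC : ∀ x, ∫ ω, U (ω, x) ^ 2 ∂P ≤ C) (hVC : ∀ x, ∫ ω, V (ω, x) ^ 2 ∂P ≤ C) :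
    cov[fun ω => ∫ x, U (ω, x) ∂ν, fun ω => ∫ x, V (ω, x) ∂ν; P]
      = ∫ q : X × X, cov[fun ω => U (ω, q.1), fun ω => V (ω, q.2); P] ∂(ν.prod ν) := by
  have hone : ∀ {W : Ω × X → ℝ}, Measurable W → (∀ x, MemLp (fun ω => W (ω, x)) 2 P) →
      (∀ x, ∫ ω, W (ω, x) ^ 2 ∂P ≤ C) → Integrable W (P.prod ν) := by
    intro W hW hW2 hWC
    rw [integrable_prod_iff' hW.aestronglyMeasurable]
    refine ⟨ae_of_all _ fun x => (hW2 x).integrable one_le_two, ?_⟩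
    refine Integrable.of_bound hW.norm.stronglyMeasurable.integral_prod_left'.aestronglyMeasurable
      ((C + 1) / 2) (ae_of_all _ fun x => ?_)
    rw [Real.norm_of_nonneg (integral_nonneg fun _ => norm_nonneg _)]
    have h1 := (hW2 x).integrable_sq
    calc ∫ ω, ‖W (ω, x)‖ ∂P ≤ ∫ ω, (W (ω, x) ^ 2 + 1) / 2 ∂P := by
          refine integral_mono ((hW2 x).integrable one_le_two).norm
            ((h1.add (integrable_const 1)).div_const 2) fun ω => ?_
          simp only [Real.norm_eq_abs]
          nlinarith [sq_nonneg (|W (ω, x)| - 1), sq_abs (W (ω, x))]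
      _ ≤ (C + 1) / 2 := by
          rw [integral_div, integral_add h1 (integrable_const 1)]
          simp only [integral_const, probReal_univ, smul_eq_mul, mul_one]
          gcongr
          exact hWC x
  have iU := hone hU hU2 hUC
  have iV := hone hV hV2 hVC
  have iUV := integrable_prod_mul_of_sq_bound (ν := ν) hU hV hU2 hV2 hUC hVC
  rw [covariance_eq_sub (memLp_integral_of_sq_bound hU hU2 hUC)
    (memLp_integral_of_sq_bound hV hV2 hVC)]
  have e1 : ∫ ω, ((fun ω => ∫ x, U (ω, x) ∂ν) * (fun ω => ∫ x, V (ω, x) ∂ν)) ω ∂P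
      = ∫ q : X × X, ∫ ω, U (ω, q.1) * V (ω, q.2) ∂P ∂(ν.prod ν) := by
    rw [← integral_integral_swap iUV]
    refine integral_congr_ae (ae_of_all _ fun ω => ?_)
    simp only [Pi.mul_apply]
    rw [integral_prod_mul (fun x => U (ω, x)) (fun x => V (ω, x))]
  have e2 : ∀ q : X × X, cov[fun ω => U (ω, q.1), fun ω => V (ω, q.2); P]
      = ∫ ω, U (ω, q.1) * V (ω, q.2) ∂P - (∫ ω, U (ω, q.1) ∂P) * ∫ ω, V (ω, q.2) ∂P :=
    fun q => covariance_eq_sub (hU2 _) (hV2 _)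
  simp_rw [e2]
  rw [e1, integral_sub iUV.integral_prod_right
    (iU.integral_prod_right.mul_prod iV.integral_prod_right),
    integral_prod_mul (fun x => ∫ ω, U (ω, x) ∂P) (fun x => ∫ ω, V (ω, x) ∂P),
    integral_integral_swap (f := fun ω x => U (ω, x)) iU,
    integral_integral_swap (f := fun ω x => V (ω, x)) iV]

end Moments

end

section

/-! ### Regular versions of the hyperbolic Gaussian analytic function -/

/-- Coefficients of a hyperbolic Gaussian analytic function such that the power series converges
surely in the unit disc and does surely not vanish at the origin. -/
structure IsRegular {Ω : Type*} [MeasurableSpace Ω] (P : Measure Ω) (a : ℕ → Ω → ℂ) (L : ℝ) :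
    Prop where
  pos : 0 < L
  meas : ∀ n, Measurable (a n)
  law : ∀ n, HasLaw (a n) stdComplexNormal P
  indep : iIndepFun a P
  summable : ∀ ω, ∀ x : ℝ, 0 ≤ x → x < 1 → Summable fun n => ‖a n ω‖ * (√(coeff L n) * x ^ n)
  ne_zero : ∀ ω, a 0 ω ≠ 0

/-- The coefficients of the normalized value of the function at `z`, as a linear form. -/
def weight (L : ℝ) (z : ℂ) (n : ℕ) : ℂ :=
  (((1 - ‖z‖ ^ 2) ^ (L / 2) : ℝ) : ℂ) * ((√(coeff L n) : ℂ) * z ^ n)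

/-- The square of the modulus of the normalized covariance kernel. -/
def sqCorr (L : ℝ) (z w : ℂ) : ℝ :=
  ((1 - ‖z‖ ^ 2) * (1 - ‖w‖ ^ 2) / ‖1 - z * starRingEnd ℂ w‖ ^ 2) ^ L

lemma one_sub_norm_sq_pos {z : ℂ} (hz : ‖z‖ < 1) : 0 < 1 - ‖z‖ ^ 2 := by
  have := norm_nonneg z
  nlinarith

lemma norm_mul_conj_lt_one {z w : ℂ} (hz : ‖z‖ < 1) (hw : ‖w‖ < 1) :
    ‖z * starRingEnd ℂ w‖ < 1 := by
  rw [norm_mul, RCLike.norm_conj]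
  have := norm_nonneg w
  have := norm_nonneg z
  nlinarith

/-- This identity shows that the correlation is at most `1` and that its decay is governed by `‖z -
w‖² / ((1 - ‖z‖²)(1 - ‖w‖²))`, the hyperbolic separation. -/
lemma norm_one_sub_mul_conj_sq (z w : ℂ) :
    ‖1 - z * starRingEnd ℂ w‖ ^ 2 = (1 - ‖z‖ ^ 2) * (1 - ‖w‖ ^ 2) + ‖z - w‖ ^ 2 := by
  simp only [← Complex.normSq_eq_norm_sq, Complex.normSq_apply]
  simp
  ring

lemma sqCorr_nonneg (L : ℝ) {z w : ℂ} (hz : ‖z‖ < 1) (hw : ‖w‖ < 1) : 0 ≤ sqCorr L z w := by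
  have := one_sub_norm_sq_pos hz
  have := one_sub_norm_sq_pos hw
  unfold sqCorr
  positivity

lemma sqCorr_le_one {L : ℝ} (hL : 0 ≤ L) {z w : ℂ} (hz : ‖z‖ < 1) (hw : ‖w‖ < 1) :
    sqCorr L z w ≤ 1 := by
  have h1 := one_sub_norm_sq_pos hz
  have h2 := one_sub_norm_sq_pos hw
  refine Real.rpow_le_one (by positivity) ?_ hL
  rw [norm_one_sub_mul_conj_sq]
  exact div_le_one_of_le₀ (by linarith [sq_nonneg ‖z - w‖]) (by positivity)

/-- Beyond radial factors, a power of the squared correlation is the squared modulus of an analytic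
function of `z * conj w`, the form needed for Parseval. -/
lemma sqCorr_pow (L : ℝ) {z w : ℂ} (hz : ‖z‖ < 1) (hw : ‖w‖ < 1) (k : ℕ) :
    sqCorr L z w ^ k = ((1 - ‖z‖ ^ 2) ^ (L * k) * (1 - ‖w‖ ^ 2) ^ (L * k)) *
      (‖1 - z * starRingEnd ℂ w‖ ^ (-(L * k))) ^ 2 := by
  have h1 := one_sub_norm_sq_pos hz
  have h2 := one_sub_norm_sq_pos hw
  have h3 := norm_one_sub_pos (norm_mul_conj_lt_one hz hw)
  rw [sqCorr, ← Real.rpow_natCast, ← Real.rpow_mul (by positivity),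
    Real.div_rpow (by positivity) (by positivity), Real.mul_rpow h1.le h2.le, div_eq_mul_inv,
    ← Real.rpow_neg (by positivity), ← Real.rpow_natCast ‖1 - z * starRingEnd ℂ w‖ 2,
    ← Real.rpow_natCast (_ ^ (-(L * k))) 2, ← Real.rpow_mul h3.le, ← Real.rpow_mul h3.le]
  congr 2
  push_cast
  ring

lemma norm_weight (L : ℝ) {z : ℂ} (hz : ‖z‖ < 1) (n : ℕ) :
    ‖weight L z n‖ = (1 - ‖z‖ ^ 2) ^ (L / 2) * (√(coeff L n) * ‖z‖ ^ n) := by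
  have h1 := one_sub_norm_sq_pos hz
  rw [weight, norm_mul, norm_mul, norm_pow, Complex.norm_real, Complex.norm_real,
    Real.norm_of_nonneg (by positivity), Real.norm_of_nonneg (by positivity)]

lemma hasSum_norm_weight_sq {L : ℝ} (hL : 0 < L) {z : ℂ} (hz : ‖z‖ < 1) :
    HasSum (fun n => ‖weight L z n‖ ^ 2) 1 := by
  have h1 := one_sub_norm_sq_pos hz
  have h := (hasSum_coeff_real hL (sq_nonneg ‖z‖) (by linarith)).mul_left ((1 - ‖z‖ ^ 2) ^ L)
  rw [← Real.rpow_add h1, add_neg_cancel, Real.rpow_zero] at h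
  have e : ∀ n, ‖weight L z n‖ ^ 2 = (1 - ‖z‖ ^ 2) ^ L * (coeff L n * (‖z‖ ^ 2) ^ n) := by
    intro n
    rw [norm_weight L hz, mul_pow, mul_pow, Real.sq_sqrt (coeff_pos hL n).le, ← Real.rpow_natCast,
      ← Real.rpow_mul h1.le, ← pow_mul, ← pow_mul, mul_comm n 2]
    norm_num
  simp_rw [e]
  exact h

lemma hasSum_weight_mul_conj {L : ℝ} (hL : 0 < L) {z w : ℂ} (hz : ‖z‖ < 1) (hw : ‖w‖ < 1) :
    ∃ κ : ℂ, HasSum (fun n => weight L z n * starRingEnd ℂ (weight L w n)) κ ∧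
      ‖κ‖ ^ 2 = sqCorr L z w := by
  have h1 := one_sub_norm_sq_pos hz
  have h2 := one_sub_norm_sq_pos hw
  have hu := norm_mul_conj_lt_one hz hw
  have h3 := norm_one_sub_pos hu
  have h := (hasSum_coeff hL hu).mul_left
    ((((1 - ‖z‖ ^ 2) ^ (L / 2) * (1 - ‖w‖ ^ 2) ^ (L / 2) : ℝ)) : ℂ)
  refine ⟨(((1 - ‖z‖ ^ 2) ^ (L / 2) * (1 - ‖w‖ ^ 2) ^ (L / 2) : ℝ) : ℂ) *
    (1 / (1 - z * starRingEnd ℂ w) ^ (L : ℂ)), ?_, ?_⟩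
  · have e : ∀ n, weight L z n * starRingEnd ℂ (weight L w n)
        = (((1 - ‖z‖ ^ 2) ^ (L / 2) * (1 - ‖w‖ ^ 2) ^ (L / 2) : ℝ) : ℂ)
          * ((coeff L n : ℂ) * (z * starRingEnd ℂ w) ^ n) := by
      intro n
      have : (coeff L n : ℂ) = (√(coeff L n) : ℂ) * (√(coeff L n) : ℂ) := by
        rw [← Complex.ofReal_mul, Real.mul_self_sqrt (coeff_pos hL n).le]
      rw [this]
      simp only [weight, map_mul, map_pow, Complex.conj_ofReal, mul_pow, Complex.ofReal_mul]
      ring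
    simp_rw [e]
    exact h
  · have hsq : ∀ x : ℝ, 0 < x → (x ^ (L / 2)) ^ 2 = x ^ L := by
      intro x hx
      rw [← Real.rpow_natCast, ← Real.rpow_mul hx.le]
      congr 1
      push_cast
      ring
    have hsq' : ∀ x : ℝ, 0 < x → (x ^ (-L)) ^ 2 = ((x ^ 2) ^ L)⁻¹ := by
      intro x hx
      rw [Real.rpow_neg hx.le, inv_pow, Real.rpow_pow_comm hx.le]
    rw [norm_mul, norm_one_div_cpow hu, Complex.norm_real, Real.norm_of_nonneg (by positivity),
      mul_pow, mul_pow, sqCorr, Real.div_rpow (by positivity) (by positivity),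
      Real.mul_rpow h1.le h2.le, hsq _ h1, hsq _ h2, hsq' _ h3,
      div_eq_mul_inv]

section Regular

variable {Ω : Type*} [MeasurableSpace Ω] {P : Measure Ω} {a : ℕ → Ω → ℂ} {L : ℝ}

lemma IsRegular.summable_norm (h : IsRegular P a L) {z : ℂ} (hz : ‖z‖ < 1) (ω : Ω) :
    Summable fun n => ‖a n ω * weight L z n‖ := by
  refine ((h.summable ω ‖z‖ (norm_nonneg z) hz).mul_left ((1 - ‖z‖ ^ 2) ^ (L / 2))).congr
    fun n => ?_
  rw [norm_mul, norm_weight L hz]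
  ring

lemma norm_tsum_weight_sq {Ω : Type*} {a : ℕ → Ω → ℂ} {L : ℝ} {z : ℂ} (hz : ‖z‖ < 1) (ω : Ω) :
    ‖∑' n, a n ω * weight L z n‖ ^ 2 = (1 - ‖z‖ ^ 2) ^ L * ‖gaf a L ω z‖ ^ 2 := by
  have h1 := one_sub_norm_sq_pos hz
  have e : ∑' n, a n ω * weight L z n = (((1 - ‖z‖ ^ 2) ^ (L / 2) : ℝ) : ℂ) * gaf a L ω z := by
    rw [gaf, ← tsum_mul_left]
    refine tsum_congr fun n => ?_
    rw [weight]; ring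
  rw [e, norm_mul, Complex.norm_real, Real.norm_of_nonneg (by positivity), mul_pow,
    ← Real.rpow_natCast, ← Real.rpow_mul h1.le]
  norm_num

lemma IsRegular.gaf_zero (h : IsRegular P a L) (ω : Ω) : gaf a L ω 0 = a 0 ω := by
  rw [gaf, tsum_eq_single 0]
  · simp [coeff_zero h.pos]
  · intro n hn; simp [hn]

lemma IsRegular.summable_norm_weight (h : IsRegular P a L) {z : ℂ} (hz : ‖z‖ < 1) :
    Summable fun n => ‖weight L z n‖ := by
  simp_rw [norm_weight L hz]
  exact (summable_sqrt_coeff h.pos (norm_nonneg z) hz).mul_left _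

lemma IsRegular.measurable_tsum_weight (h : IsRegular P a L) {z : ℂ} (hz : ‖z‖ < 1) :
    Measurable fun ω => ∑' n, a n ω * weight L z n :=
  measurable_tsum_of_summable (fun n => (h.meas n).mul_const _)
    fun ω => (h.summable_norm hz ω).of_norm

variable [IsProbabilityMeasure P]

lemma IsRegular.laplace (h : IsRegular P a L) {z w : ℂ} (hz : ‖z‖ < 1) (hw : ‖w‖ < 1) {x y : ℝ}
    (hx : 0 ≤ x) (hy : 0 ≤ y) :
    ∫ ω, Real.exp (-(x * ‖∑' n, a n ω * weight L z n‖ ^ 2))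
        * Real.exp (-(y * ‖∑' n, a n ω * weight L w n‖ ^ 2)) ∂P
      = 1 / ((1 + x) * (1 + y) - x * y * sqCorr L z w) := by
  obtain ⟨κ, hκ, hκ2⟩ := hasSum_weight_mul_conj h.pos hz hw
  have hκ1 : ‖κ‖ ≤ 1 := by
    have := sqCorr_le_one h.pos.le hz hw
    rw [← hκ2] at this
    exact (sq_le_one_iff₀ (norm_nonneg κ)).1 this
  rw [← hκ2]
  exact integral_exp_neg_normSq_linear h.meas h.law h.indep
    (fun ω => (h.summable_norm hz ω).of_norm) (fun ω => (h.summable_norm hw ω).of_norm)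
    (hasSum_norm_weight_sq h.pos hz) (hasSum_norm_weight_sq h.pos hw) hκ hκ1 hx hy

lemma IsRegular.laplace_one (h : IsRegular P a L) {z : ℂ} (hz : ‖z‖ < 1) {x : ℝ} (hx : 0 ≤ x) :
    ∫ ω, Real.exp (-(x * ‖∑' n, a n ω * weight L z n‖ ^ 2)) ∂P = 1 / (1 + x) := by
  simpa using h.laplace hz hz hx le_rfl

/-- A bound for the second moment of the logarithm of the normalized function on a circle. -/
def logMomentBound (L s : ℝ) : ℝ :=
  16 * ((1 - s ^ 2) ^ (L / 2) * (∑' n, √(coeff L n) * s ^ n) * normalAbsMoment + expMomentNegHalf)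

lemma IsRegular.memLp_log_weight (h : IsRegular P a L) {z : ℂ} (hz : ‖z‖ < 1) :
    MemLp (fun ω => Real.log (‖∑' n, a n ω * weight L z n‖ ^ 2)) 2 P ∧
      ∫ ω, Real.log (‖∑' n, a n ω * weight L z n‖ ^ 2) ^ 2 ∂P ≤ logMomentBound L ‖z‖ := by
  have hm := h.measurable_tsum_weight hz
  have h2 := integrable_norm_linear h.meas h.law (h.summable_norm_weight hz) (h.summable_norm hz)
  have e : ∀ ω, (‖∑' n, a n ω * weight L z n‖ ^ 2) ^ (1 / 2 : ℝ)
      = ‖∑' n, a n ω * weight L z n‖ := by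
    intro ω
    rw [← Real.sqrt_eq_rpow, Real.sqrt_sq (norm_nonneg _)]
  refine memLp_log_of_laplace (by fun_prop) (fun ω => sq_nonneg _)
    (fun x hx => h.laplace_one hz hx) (by simpa only [e] using h2.1) ?_
  simp_rw [e]
  refine h2.2.trans_eq ?_
  simp_rw [norm_weight L hz]
  rw [tsum_mul_left]

/-- The logarithm of the product splits only where `f(z) ≠ 0`, since `Real.log 0 = 0`; the zero set
is null by the moment of order `-1/2`. -/
lemma IsRegular.log_norm_ae (h : IsRegular P a L) {z : ℂ} (hz : ‖z‖ < 1) :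
    (fun ω => Real.log ‖gaf a L ω z‖) =ᵐ[P] fun ω =>
      1 / 2 * Real.log (‖∑' n, a n ω * weight L z n‖ ^ 2) + -(L / 2 * Real.log (1 - ‖z‖ ^ 2)) := by
  have h1 := one_sub_norm_sq_pos hz
  have hm := h.measurable_tsum_weight hz
  filter_upwards [(integrable_rpow_neg_half_of_laplace (P := P) (by fun_prop)
    (fun ω => sq_nonneg ‖∑' n, a n ω * weight L z n‖) (fun x hx => h.laplace_one hz hx)).1]
    with ω hω
  rw [norm_tsum_weight_sq hz] at hω ⊢
  have h2 : ‖gaf a L ω z‖ ≠ 0 := by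
    intro h0; simp [h0] at hω
  rw [Real.log_mul (by positivity) (by positivity), Real.log_rpow h1, Real.log_pow]
  push_cast
  ring

lemma IsRegular.memLp_log (h : IsRegular P a L) {z : ℂ} (hz : ‖z‖ < 1) :
    MemLp (fun ω => Real.log ‖gaf a L ω z‖) 2 P :=
  (memLp_congr_ae (h.log_norm_ae hz)).2
    (((h.memLp_log_weight hz).1.const_mul (1 / 2)).add (memLp_const _))

/-- A bound for the second moment of the logarithm of the function on a circle. -/
def logMomentBound' (L s : ℝ) : ℝ :=
  1 / 2 * logMomentBound L s + 2 * (L / 2 * Real.log (1 - s ^ 2)) ^ 2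

lemma IsRegular.integral_log_sq_le (h : IsRegular P a L) {z : ℂ} (hz : ‖z‖ < 1) :
    ∫ ω, Real.log ‖gaf a L ω z‖ ^ 2 ∂P ≤ logMomentBound' L ‖z‖ := by
  obtain ⟨h1, h2⟩ := h.memLp_log_weight hz
  have hb : Integrable (fun ω => 1 / 2 * Real.log (‖∑' n, a n ω * weight L z n‖ ^ 2) ^ 2
      + 2 * (L / 2 * Real.log (1 - ‖z‖ ^ 2)) ^ 2) P :=
    (h1.integrable_sq.const_mul _).add (integrable_const _)
  calc ∫ ω, Real.log ‖gaf a L ω z‖ ^ 2 ∂P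
      ≤ ∫ ω, (1 / 2 * Real.log (‖∑' n, a n ω * weight L z n‖ ^ 2) ^ 2
      + 2 * (L / 2 * Real.log (1 - ‖z‖ ^ 2)) ^ 2) ∂P := by
        refine integral_mono_ae (h.memLp_log hz).integrable_sq hb ?_
        filter_upwards [h.log_norm_ae hz] with ω hω
        rw [hω]
        nlinarith [sq_nonneg (1 / 2 * Real.log (‖∑' n, a n ω * weight L z n‖ ^ 2)
          + (L / 2 * Real.log (1 - ‖z‖ ^ 2)))]
    _ ≤ _ := by
        rw [integral_add (h1.integrable_sq.const_mul _) (integrable_const _), integral_const_mul,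
          logMomentBound']
        simp only [integral_const, probReal_univ, smul_eq_mul, one_mul]
        gcongr

/-- The covariance of `log |f(z)|` and `log |f(w)|`. -/
theorem IsRegular.covariance_log (h : IsRegular P a L) {z w : ℂ} (hz : ‖z‖ < 1) (hw : ‖w‖ < 1) :
    cov[fun ω => Real.log ‖gaf a L ω z‖, fun ω => Real.log ‖gaf a L ω w‖; P]
      = 1 / 4 * ∑' k : ℕ, sqCorr L z w ^ (k + 1) / ((k : ℝ) + 1) ^ 2 := by
  obtain ⟨hz1, -⟩ := h.memLp_log_weight hz
  obtain ⟨hw1, -⟩ := h.memLp_log_weight hw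
  have hmz := h.measurable_tsum_weight hz
  have hmw := h.measurable_tsum_weight hw
  rw [covariance_congr_ae (h.log_norm_ae hz) (h.log_norm_ae hw),
    covariance_add_const_left ((hz1.integrable one_le_two).const_mul _),
    covariance_add_const_right ((hw1.integrable one_le_two).const_mul _),
    covariance_const_mul_left, covariance_const_mul_right,
    covariance_log_of_laplace (by fun_prop) (by fun_prop)
      (integrable_rpow_neg_half_of_laplace (P := P) (by fun_prop)
        (fun ω => sq_nonneg _) (fun x hx => h.laplace_one hz hx)).1
      (integrable_rpow_neg_half_of_laplace (P := P) (by fun_prop)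
        (fun ω => sq_nonneg _) (fun x hx => h.laplace_one hw hx)).1 hz1 hw1
      (sqCorr_nonneg L hz hw) (sqCorr_le_one h.pos.le hz hw)
      (fun x y hx hy => h.laplace hz hw hx hy)]
  ring

end Regular

end

section

/-! ### Covariances of logarithmic means over circles -/

/-- The mean of `log |f|` over the circle of radius `s`. -/
def logMean {Ω : Type*} (a : ℕ → Ω → ℂ) (L s : ℝ) (ω : Ω) : ℝ :=
  ∫ θ, Real.log ‖gaf a L ω (circleMap 0 s θ)‖ ∂angle

/-- The coordinates of the logarithmic mean in the chaos decomposition. -/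
def chaosCoeff (L : ℝ) (p : ℕ × ℕ) (s : ℝ) : ℝ :=
  1 / (2 * ((p.1 : ℝ) + 1)) * coeff (L * (p.1 + 1)) p.2
    * ((1 - s ^ 2) ^ (L * (p.1 + 1)) * s ^ (2 * p.2))

lemma norm_circleMap_of_nonneg {s : ℝ} (hs : 0 ≤ s) (θ : ℝ) : ‖circleMap 0 s θ‖ = s := by
  rw [norm_circleMap_zero, abs_of_nonneg hs]

lemma measurable_sqCorr (L : ℝ) : Measurable fun p : ℂ × ℂ => sqCorr L p.1 p.2 := by
  unfold sqCorr
  have h : Measurable fun p : ℂ × ℂ => starRingEnd ℂ p.2 :=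
    Complex.continuous_conj.measurable.comp measurable_snd
  fun_prop

lemma measurable_sqCorr_circleMap (L s t : ℝ) : Measurable fun q : ℝ × ℝ =>
    sqCorr L (circleMap 0 s q.1) (circleMap 0 t q.2) := by
  have h1 : Measurable fun q : ℝ × ℝ => (circleMap 0 s q.1, circleMap 0 t q.2) :=
    ((continuous_circleMap 0 s).measurable.comp measurable_fst).prodMk
      ((continuous_circleMap 0 t).measurable.comp measurable_snd)
  have h2 := (measurable_sqCorr L).comp h1
  exact h2

/-- For a fixed second angle, Parseval in the first one applies to the binomial series of exponent
`L (k + 1)`. The result does not depend on the second angle, whose average is therefore trivial. -/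
lemma hasSum_integral_sqCorr {L : ℝ} (hL : 0 < L) {s t : ℝ} (hs : 0 ≤ s) (hs1 : s < 1)
    (ht : 0 ≤ t) (ht1 : t < 1) (k : ℕ) :
    HasSum (fun m => 4 * ((k : ℝ) + 1) ^ 2 * (chaosCoeff L (k, m) s * chaosCoeff L (k, m) t))
      (∫ q : ℝ × ℝ, sqCorr L (circleMap 0 s q.1) (circleMap 0 t q.2) ^ (k + 1)
        ∂(angle.prod angle)) := by
  have hLk : 0 < L * ((k : ℝ) + 1) := by positivity
  have hst : s * t < 1 := by nlinarith
  have hst0 : 0 ≤ s * t := by positivity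
  have hns : ∀ θ, ‖circleMap 0 s θ‖ < 1 := fun θ => by rwa [norm_circleMap_of_nonneg hs]
  have hnt : ∀ θ, ‖circleMap 0 t θ‖ < 1 := fun θ => by rwa [norm_circleMap_of_nonneg ht]
  set c := coeff (L * (k + 1)) with hc
  have hcs : Summable fun m => c m * (s * t) ^ m := (hasSum_coeff_real hLk hst0 hst).summable
  have hm : Measurable fun q : ℝ × ℝ =>
      sqCorr L (circleMap 0 s q.1) (circleMap 0 t q.2) ^ (k + 1) :=
    (measurable_sqCorr_circleMap L s t).pow_const _
  have hint : Integrable (fun q : ℝ × ℝ =>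
      sqCorr L (circleMap 0 s q.1) (circleMap 0 t q.2) ^ (k + 1)) (angle.prod angle) := by
    refine Integrable.of_bound hm.aestronglyMeasurable 1 (ae_of_all _ fun q => ?_)
    rw [Real.norm_of_nonneg (pow_nonneg (sqCorr_nonneg L (hns _) (hnt _)) _)]
    exact pow_le_one₀ (sqCorr_nonneg L (hns _) (hnt _)) (sqCorr_le_one hL.le (hns _) (hnt _))
  have hinner : ∀ β, ∫ α, sqCorr L (circleMap 0 s α) (circleMap 0 t β) ^ (k + 1) ∂angle
      = (1 - s ^ 2) ^ (L * (k + 1)) * (1 - t ^ 2) ^ (L * (k + 1))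
        * ∑' m, (c m * (s * t) ^ m) ^ 2 := by
    intro β
    set d : ℕ → ℂ := fun m => (c m : ℂ) * ((s * t : ℝ) * starRingEnd ℂ (Complex.exp (β * Complex.I))) ^ m
      with hd
    have hnd : ∀ m, ‖d m‖ = c m * (s * t) ^ m := by
      intro m
      rw [hd, norm_mul, norm_pow, norm_mul, RCLike.norm_conj, norm_exp_mul_I, Complex.norm_real,
        Complex.norm_real, Real.norm_of_nonneg hst0, Real.norm_of_nonneg (coeff_pos hLk m).le,
        mul_one]
    have e : ∀ α, sqCorr L (circleMap 0 s α) (circleMap 0 t β) ^ (k + 1)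
        = (1 - s ^ 2) ^ (L * (k + 1)) * (1 - t ^ 2) ^ (L * (k + 1))
          * ‖∑' m, d m * Complex.exp (α * Complex.I) ^ m‖ ^ 2 := by
      intro α
      have hu := norm_mul_conj_lt_one (hns α) (hnt β)
      rw [sqCorr_pow L (hns α) (hnt β), norm_circleMap_of_nonneg hs, norm_circleMap_of_nonneg ht]
      push_cast
      congr 2
      rw [← norm_one_div_cpow hu, ← (hasSum_coeff hLk hu).tsum_eq]
      congr 1
      refine tsum_congr fun m => ?_
      simp only [hd, circleMap_zero, map_mul, Complex.conj_ofReal]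
      rw [mul_assoc ((c m : ℝ) : ℂ), ← mul_pow]
      congr 2
      push_cast
      ring
    simp_rw [e]
    rw [integral_const_mul, integral_angle_norm_sq_tsum (by simpa only [hnd] using hcs)]
    simp_rw [hnd]
  rw [integral_prod_symm _ hint]
  simp only [hinner, integral_const, probReal_univ, one_smul]
  have hc0 : ∀ m, 0 ≤ c m * (s * t) ^ m :=
    fun m => mul_nonneg (coeff_pos hLk m).le (by positivity)
  have hsq : Summable fun m => (c m * (s * t) ^ m) ^ 2 := by
    have hinj : Function.Injective fun m : ℕ => (m, m) := fun x y hxy => (Prod.ext_iff.1 hxy).1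
    simpa only [Function.comp_def, sq] using
      (hcs.mul_of_nonneg hcs hc0 hc0).comp_injective hinj
  have h := hsq.hasSum.mul_left ((1 - s ^ 2) ^ (L * (k + 1)) * (1 - t ^ 2) ^ (L * (k + 1)))
  have e : ∀ m, 4 * ((k : ℝ) + 1) ^ 2 * (chaosCoeff L (k, m) s * chaosCoeff L (k, m) t)
      = (1 - s ^ 2) ^ (L * (k + 1)) * (1 - t ^ 2) ^ (L * (k + 1)) * (c m * (s * t) ^ m) ^ 2 := by
    intro m
    simp only [chaosCoeff, hc]
    field_simp
    ring
  simp_rw [e]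
  exact h

section Regular

variable {Ω : Type*} [MeasurableSpace Ω] {P : Measure Ω} {a : ℕ → Ω → ℂ} {L : ℝ}

lemma IsRegular.summable_gaf (h : IsRegular P a L) {z : ℂ} (hz : ‖z‖ < 1) (ω : Ω) :
    Summable fun n => ‖a n ω * (√(coeff L n) : ℂ) * z ^ n‖ := by
  refine (h.summable ω ‖z‖ (norm_nonneg z) hz).congr fun n => ?_
  rw [norm_mul, norm_mul, norm_pow, Complex.norm_real, Real.norm_of_nonneg (Real.sqrt_nonneg _),
    mul_assoc]

lemma IsRegular.measurable_log_gaf (h : IsRegular P a L) {s : ℝ} (hs : 0 ≤ s) (hs1 : s < 1) :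
    Measurable fun p : Ω × ℝ => Real.log ‖gaf a L p.1 (circleMap 0 s p.2)‖ := by
  have hm : Measurable fun p : Ω × ℝ => gaf a L p.1 (circleMap 0 s p.2) := by
    refine measurable_tsum_of_summable (fun n => ?_) fun p => ?_
    · have h1 : Measurable fun p : Ω × ℝ => a n p.1 := (h.meas n).comp measurable_fst
      have h2 : Measurable fun p : Ω × ℝ => circleMap 0 s p.2 :=
        (continuous_circleMap 0 s).measurable.comp measurable_snd
      exact (h1.mul_const _).mul (h2.pow_const n)
    · exact (h.summable_gaf (by rwa [norm_circleMap_of_nonneg hs]) p.1).of_norm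
  exact hm.norm.log

variable [IsProbabilityMeasure P]

lemma IsRegular.memLp_logMean (h : IsRegular P a L) {s : ℝ} (hs : 0 ≤ s) (hs1 : s < 1) :
    MemLp (logMean a L s) 2 P := by
  have hn : ∀ θ, ‖circleMap 0 s θ‖ < 1 := fun θ => by rwa [norm_circleMap_of_nonneg hs]
  have hb : ∀ θ, ∫ ω, Real.log ‖gaf a L ω (circleMap 0 s θ)‖ ^ 2 ∂P ≤ logMomentBound' L s := by
    intro θ
    have := h.integral_log_sq_le (hn θ)
    rwa [norm_circleMap_of_nonneg hs] at this
  have hl : ∀ θ, MemLp (fun ω => Real.log ‖gaf a L ω (circleMap 0 s θ)‖) 2 P :=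
    fun θ => h.memLp_log (hn θ)
  have hm := h.measurable_log_gaf hs hs1
  have key := memLp_integral_of_sq_bound (P := P) (ν := angle) hm hl hb
  exact key

lemma IsRegular.covariance_logMean (h : IsRegular P a L) {s t : ℝ} (hs : 0 ≤ s)
    (hs1 : s < 1) (ht : 0 ≤ t) (ht1 : t < 1) :
    cov[logMean a L s, logMean a L t; P] = ∫ q : ℝ × ℝ, cov[fun ω => Real.log
      ‖gaf a L ω (circleMap 0 s q.1)‖, fun ω => Real.log ‖gaf a L ω (circleMap 0 t q.2)‖; P]
      ∂(angle.prod angle) := by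
  have hb : ∀ u, 0 ≤ u → u < 1 → ∀ θ, ∫ ω, Real.log ‖gaf a L ω (circleMap 0 u θ)‖ ^ 2 ∂P
      ≤ logMomentBound' L u := by
    intro u hu hu1 θ
    have := h.integral_log_sq_le (z := circleMap 0 u θ) (by rwa [norm_circleMap_of_nonneg hu])
    rwa [norm_circleMap_of_nonneg hu] at this
  have hl : ∀ u, 0 ≤ u → u < 1 → ∀ θ,
      MemLp (fun ω => Real.log ‖gaf a L ω (circleMap 0 u θ)‖) 2 P :=
    fun u hu hu1 θ => h.memLp_log (by rwa [norm_circleMap_of_nonneg hu])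
  have hms := h.measurable_log_gaf hs hs1
  have hmt := h.measurable_log_gaf ht ht1
  have key := covariance_integral_integral (P := P) (ν := angle) hms hmt (hl s hs hs1)
    (hl t ht ht1) (C := max (logMomentBound' L s) (logMomentBound' L t))
    (fun θ => (hb s hs hs1 θ).trans (le_max_left _ _))
    (fun θ => (hb t ht ht1 θ).trans (le_max_right _ _))
  exact key

/-- The dilogarithm series is integrated termwise under the bound `1 / (k + 1)²`, and each term is
expanded by `hasSum_integral_sqCorr`. All summands are nonnegative, so the iterated sum is a sum
over pairs. -/
theorem IsRegular.hasSum_covariance_logMean (h : IsRegular P a L) {s t : ℝ} (hs : 0 ≤ s)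
    (hs1 : s < 1) (ht : 0 ≤ t) (ht1 : t < 1) :
    HasSum (fun p => chaosCoeff L p s * chaosCoeff L p t)
      cov[logMean a L s, logMean a L t; P] := by
  have hns : ∀ θ, ‖circleMap 0 s θ‖ < 1 := fun θ => by rwa [norm_circleMap_of_nonneg hs]
  have hnt : ∀ θ, ‖circleMap 0 t θ‖ < 1 := fun θ => by rwa [norm_circleMap_of_nonneg ht]
  have hcov := h.covariance_logMean hs hs1 ht ht1
  obtain ⟨ρ, hρ⟩ : ∃ ρ : ℝ × ℝ → ℝ,
      ρ = fun q => sqCorr L (circleMap 0 s q.1) (circleMap 0 t q.2) := ⟨_, rfl⟩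
  have hρ0 : ∀ q, 0 ≤ ρ q := by
    intro q
    rw [hρ]
    exact sqCorr_nonneg L (hns q.1) (hnt q.2)
  have hρ1 : ∀ q, ρ q ≤ 1 := by
    intro q
    rw [hρ]
    exact sqCorr_le_one h.pos.le (hns q.1) (hnt q.2)
  have hρm : Measurable ρ := by
    rw [hρ]
    exact measurable_sqCorr_circleMap L s t
  let F : ℕ → ℝ × ℝ → ℝ := fun k q => 1 / 4 * (ρ q ^ (k + 1) / ((k : ℝ) + 1) ^ 2)
  have hF0 : ∀ k q, 0 ≤ F k q := fun k q => by have := hρ0 q; positivity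
  have hF1 : ∀ k q, F k q ≤ 1 / ((k : ℝ) + 1) ^ 2 := by
    intro k q
    have h1 : ρ q ^ (k + 1) ≤ 1 := pow_le_one₀ (hρ0 q) (hρ1 q)
    have h2 : ρ q ^ (k + 1) / ((k : ℝ) + 1) ^ 2 ≤ 1 / ((k : ℝ) + 1) ^ 2 := by gcongr
    have h3 : 0 ≤ ρ q ^ (k + 1) / ((k : ℝ) + 1) ^ 2 := by have := hρ0 q; positivity
    simp only [F]
    linarith
  have hFi : ∀ k, Integrable (F k) (angle.prod angle) := by
    intro k
    have hFm : Measurable (F k) := by fun_prop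
    refine Integrable.of_bound hFm.aestronglyMeasurable (1 / ((k : ℝ) + 1) ^ 2)
      (ae_of_all _ fun q => ?_)
    rw [Real.norm_of_nonneg (hF0 k q)]
    exact hF1 k q
  have hFn : ∀ k, ∫ q, ‖F k q‖ ∂(angle.prod angle) = ∫ q, F k q ∂(angle.prod angle) :=
    fun k => integral_congr_ae (ae_of_all _ fun q => Real.norm_of_nonneg (hF0 k q))
  have h0 : Summable fun k : ℕ => 1 / ((k : ℝ) + 1) ^ 2 := by
    have := (summable_nat_add_iff 1).2 (Real.summable_one_div_nat_pow.2 one_lt_two)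
    simpa using this
  have hFs : Summable fun k => ∫ q, ‖F k q‖ ∂(angle.prod angle) := by
    refine Summable.of_nonneg_of_le (fun k => integral_nonneg fun q => norm_nonneg _)
      (fun k => ?_) h0
    rw [hFn]
    calc ∫ q, F k q ∂(angle.prod angle) ≤ ∫ q, 1 / ((k : ℝ) + 1) ^ 2 ∂(angle.prod angle) :=
          integral_mono (hFi k) (integrable_const _) (hF1 k)
      _ = _ := by simp
  have hS := hasSum_integral_of_summable_integral_norm hFi hFs
  have hcov' : cov[logMean a L s, logMean a L t; P] = ∫ q, ∑' k, F k q ∂(angle.prod angle) := by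
    refine hcov.trans (integral_congr_ae (ae_of_all _ fun q => ?_))
    simp only [F, hρ]
    rw [tsum_mul_left]
    exact h.covariance_log (hns q.1) (hnt q.2)
  rw [hcov']
  have hk : ∀ k, HasSum (fun m => chaosCoeff L (k, m) s * chaosCoeff L (k, m) t)
      (∫ q, F k q ∂(angle.prod angle)) := by
    intro k
    have h1 := (hasSum_integral_sqCorr h.pos hs hs1 ht ht1 k).mul_left
      (1 / (4 * ((k : ℝ) + 1) ^ 2))
    have e1 : ∫ q, F k q ∂(angle.prod angle) = 1 / (4 * ((k : ℝ) + 1) ^ 2) *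
        ∫ q, ρ q ^ (k + 1) ∂(angle.prod angle) := by
      rw [← integral_const_mul]
      refine integral_congr_ae (ae_of_all _ fun q => ?_)
      simp only [F]
      field_simp
    have e2 : ∀ m, chaosCoeff L (k, m) s * chaosCoeff L (k, m) t = 1 / (4 * ((k : ℝ) + 1) ^ 2) *
        (4 * ((k : ℝ) + 1) ^ 2 * (chaosCoeff L (k, m) s * chaosCoeff L (k, m) t)) := by
      intro m
      field_simp
    rw [e1, funext e2, hρ]
    exact h1
  have hnn : ∀ p, 0 ≤ chaosCoeff L p s * chaosCoeff L p t := by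
    intro p
    have hLk : 0 < L * ((p.1 : ℝ) + 1) := mul_pos h.pos (by positivity)
    have h1 := (coeff_pos hLk p.2).le
    have h2 : 0 ≤ 1 - s ^ 2 := by nlinarith
    have h3 : 0 ≤ 1 - t ^ 2 := by nlinarith
    unfold chaosCoeff
    positivity
  have hsum : Summable fun p => chaosCoeff L p s * chaosCoeff L p t := by
    refine (summable_prod_of_nonneg hnn).2 ⟨fun k => (hk k).summable, ?_⟩
    simp_rw [(hk _).tsum_eq]
    exact hS.summable
  have := hsum.hasSum.prod_fiberwise hk
  rw [hS.unique this]
  exact hsum.hasSum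

end Regular

end

/-! ### Zeros and logarithmic means -/

lemma divisor_eq_analyticOrderNatAt {f : ℂ → ℂ} {U : Set ℂ} (hf : AnalyticOnNhd ℂ f U) {z : ℂ}
    (hz : z ∈ U) : MeromorphicOn.divisor f U z = (analyticOrderNatAt f z : ℤ) := by
  rw [MeromorphicOn.AnalyticOnNhd.divisor_apply hf hz, analyticOrderNatAt]
  cases h : analyticOrderAt f z using ENat.recTopCoe with
  | top => simp
  | coe n => simp

/-- Jensen's formula and the zero counting function in terms of a finite set of zeros. -/
lemma exists_finset_jensen {f : ℂ → ℂ} {R : ℝ} (hR : 0 < R)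
    (hf : AnalyticOnNhd ℂ f (Metric.closedBall 0 R)) (hf0 : f 0 ≠ 0) :
    ∃ Z : Finset ℂ, (∀ u ∈ Z, 0 < ‖u‖) ∧
      (∀ s, 0 < s → s ≤ R → Real.circleAverage (fun z => Real.log ‖f z‖) 0 s
        = Real.log ‖f 0‖ + ∑ u ∈ Z, (analyticOrderNatAt f u : ℝ) * max 0 (Real.log (s / ‖u‖))) ∧
      (∀ s, 0 < s → s ≤ R → (zeroCount f (Metric.ball 0 s) : ℝ)
        = ∑ u ∈ Z, if ‖u‖ < s then (analyticOrderNatAt f u : ℝ) else 0) := by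
  have hfin : (Function.support (MeromorphicOn.divisor f (Metric.closedBall (0 : ℂ) R))).Finite :=
    (MeromorphicOn.divisor f (Metric.closedBall 0 R)).finiteSupport (isCompact_closedBall 0 R)
  have hmem : ∀ u, u ∈ Metric.closedBall (0 : ℂ) R → analyticOrderNatAt f u ≠ 0 →
      u ∈ hfin.toFinset := by
    intro u hu h
    rw [Set.Finite.mem_toFinset, Function.mem_support, divisor_eq_analyticOrderNatAt hf hu]
    exact_mod_cast h
  have hpos : ∀ u ∈ hfin.toFinset, 0 < ‖u‖ := by
    intro u hu
    rw [norm_pos_iff]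
    rintro rfl
    rw [Set.Finite.mem_toFinset, Function.mem_support,
      divisor_eq_analyticOrderNatAt hf (by simp [hR.le])] at hu
    apply hu
    rw [analyticOrderNatAt, (hf 0 (by simp [hR.le])).analyticOrderAt_eq_zero.2 hf0]
    simp
  -- The zeros in the largest closed disc serve all smaller radii at once: the truncations `max 0`
  -- and `if` discard those outside the disc of radius `s`.
  refine ⟨hfin.toFinset, hpos, fun s hs hsR => ?_, fun s hs hsR => ?_⟩
  · have hfs : AnalyticOnNhd ℂ f (Metric.closedBall 0 |s|) := by
      rw [abs_of_pos hs]
      exact hf.mono (Metric.closedBall_subset_closedBall hsR)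
    rw [AnalyticOnNhd.circleAverage_log_norm hs.ne' hfs hf0, add_comm]
    congr 1
    rw [finsum_eq_sum_of_support_subset (s := hfin.toFinset)]
    · refine Finset.sum_congr rfl fun u hu => ?_
      have hu0 := hpos u hu
      rw [zero_sub, norm_neg, ← div_eq_mul_inv]
      by_cases hus : ‖u‖ ≤ s
      · rw [divisor_eq_analyticOrderNatAt hfs (by simpa [abs_of_pos hs] using hus),
          max_eq_right (Real.log_nonneg ((one_le_div hu0).2 hus))]
        simp
      · push Not at hus
        rw [Function.locallyFinsuppWithin.apply_eq_zero_of_notMem _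
          (by simpa [abs_of_pos hs] using hus),
          max_eq_left (Real.log_nonpos (by positivity) ((div_le_one hu0).2 hus.le))]
        simp
    · intro u hu
      rw [Function.mem_support] at hu
      have hd : MeromorphicOn.divisor f (Metric.closedBall (0 : ℂ) |s|) u ≠ 0 := by
        intro h; apply hu; rw [h]; simp
      have hus : u ∈ Metric.closedBall (0 : ℂ) |s| := by
        by_contra h
        exact hd (Function.locallyFinsuppWithin.apply_eq_zero_of_notMem _ h)
      rw [divisor_eq_analyticOrderNatAt hfs hus] at hd
      refine hmem u ?_ (by exact_mod_cast hd)
      rw [abs_of_pos hs] at hus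
      exact Metric.closedBall_subset_closedBall hsR hus
  · have h1 : zeroCount f (Metric.ball 0 s)
        = ∑ u ∈ hfin.toFinset, if ‖u‖ < s then analyticOrderNatAt f u else 0 := by
      rw [zeroCount, finsum_mem_def, finsum_eq_sum_of_support_subset (s := hfin.toFinset)]
      · refine Finset.sum_congr rfl fun u _ => ?_
        by_cases hus : ‖u‖ < s
        · rw [if_pos hus, Set.indicator_of_mem (by simpa using hus)]
        · rw [if_neg hus, Set.indicator_of_notMem (by simpa using hus)]
      · intro u hu
        rw [Function.mem_support, Set.indicator_apply_ne_zero] at hu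
        have hus : ‖u‖ < s := by simpa using hu.1
        exact hmem u (by simpa using hus.le.trans hsR) hu.2
    rw [h1]
    push_cast
    rfl

/-- This is the contribution of one zero of modulus `x` to the increment of the logarithmic mean.
The increment is taken inwards from `r`, so zeros on the circle itself contribute nothing, in
agreement with the open disc. -/
lemma max_log_sub_max_log {r h x : ℝ} (hr : 0 < r) (hh : 0 < h) (hx : 0 < x) :
    max 0 (Real.log (r / x)) - max 0 (Real.log (r * Real.exp (-h) / x))
      = if x < r then min h (Real.log (r / x)) else 0 := by
  have e : Real.log (r * Real.exp (-h) / x) = Real.log (r / x) - h := by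
    rw [mul_div_right_comm, Real.log_mul (by positivity) (Real.exp_pos _).ne', Real.log_exp]
    ring
  rw [e]
  split_ifs with hxr
  · have h1 : 0 < Real.log (r / x) := Real.log_pos ((one_lt_div hx).2 hxr)
    rw [max_eq_right h1.le]
    rcases le_total h (Real.log (r / x)) with h2 | h2
    · rw [min_eq_left h2, max_eq_right (by linarith)]; ring
    · rw [min_eq_right h2, max_eq_left (by linarith)]; ring
  · push Not at hxr
    have h1 : Real.log (r / x) ≤ 0 := Real.log_nonpos (by positivity) ((div_le_one hx).2 hxr)
    rw [max_eq_left h1, max_eq_left (by linarith)]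
    ring

/-- The difference quotients of the logarithmic mean count the zeros. -/
lemma difference_quotient_logMean {f : ℂ → ℂ} {r R : ℝ} (hr : 0 < r) (hrR : r < R)
    (hf : AnalyticOnNhd ℂ f (Metric.closedBall 0 R)) (hf0 : f 0 ≠ 0) {M : ℝ → ℝ}
    (hM : ∀ s, M s = Real.circleAverage (fun z => Real.log ‖f z‖) 0 s) :
    ((zeroCount f (Metric.ball 0 r) : ℝ) * Real.log (R / r) ≤ M R - Real.log ‖f 0‖) ∧
    (∀ h, 0 < h → 0 ≤ (M r - M (r * Real.exp (-h))) / h ∧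
      (M r - M (r * Real.exp (-h))) / h ≤ (zeroCount f (Metric.ball 0 r) : ℝ)) ∧
    (∀ᶠ h in 𝓝[>] (0 : ℝ), (M r - M (r * Real.exp (-h))) / h
      = (zeroCount f (Metric.ball 0 r) : ℝ)) := by
  have hR : 0 < R := hr.trans hrR
  obtain ⟨Z, hZ, hJ, hN⟩ := exists_finset_jensen hR hf hf0
  have hD : ∀ h, 0 < h → M r - M (r * Real.exp (-h))
      = ∑ u ∈ Z, (analyticOrderNatAt f u : ℝ) *
        (if ‖u‖ < r then min h (Real.log (r / ‖u‖)) else 0) := by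
    intro h hh
    have he : Real.exp (-h) ≤ 1 := Real.exp_le_one_iff.2 (by linarith)
    rw [hM, hM, hJ r hr hrR.le, hJ (r * Real.exp (-h)) (by positivity) (by nlinarith),
      add_sub_add_left_eq_sub, ← Finset.sum_sub_distrib]
    refine Finset.sum_congr rfl fun u hu => ?_
    rw [← mul_sub, max_log_sub_max_log hr hh (hZ u hu)]
  refine ⟨?_, fun h hh => ⟨?_, ?_⟩, ?_⟩
  · rw [hM, hJ R hR le_rfl, hN r hr hrR.le, add_sub_cancel_left, Finset.sum_mul]
    refine Finset.sum_le_sum fun u hu => ?_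
    have hu0 := hZ u hu
    split_ifs with hur
    · refine mul_le_mul_of_nonneg_left (le_max_of_le_right ?_) (Nat.cast_nonneg _)
      exact Real.log_le_log (by positivity) (by gcongr)
    · rw [zero_mul]
      positivity
  · rw [hD h hh]
    refine div_nonneg (Finset.sum_nonneg fun u hu => mul_nonneg (Nat.cast_nonneg _) ?_) hh.le
    split_ifs with hur
    · exact le_min hh.le (Real.log_pos ((one_lt_div (hZ u hu)).2 hur)).le
    · exact le_rfl
  · rw [hD h hh, hN r hr hrR.le, div_le_iff₀ hh, Finset.sum_mul]
    refine Finset.sum_le_sum fun u hu => ?_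
    split_ifs with hur
    · exact mul_le_mul_of_nonneg_left (min_le_left _ _) (Nat.cast_nonneg _)
    · simp
  · have hev : ∀ᶠ h in 𝓝[>] (0 : ℝ), ∀ u ∈ Z, ‖u‖ < r → h ≤ Real.log (r / ‖u‖) := by
      rw [Filter.eventually_all_finset]
      intro u hu
      by_cases hur : ‖u‖ < r
      · have h1 : 0 < Real.log (r / ‖u‖) := Real.log_pos ((one_lt_div (hZ u hu)).2 hur)
        filter_upwards [nhdsWithin_le_nhds (Iic_mem_nhds h1)] with h hh _
        exact hh
      · exact Eventually.of_forall fun h hh => absurd hh hur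
    filter_upwards [hev, self_mem_nhdsWithin] with h hh (h0 : 0 < h)
    rw [hD h h0, hN r hr hrR.le, div_eq_iff h0.ne', Finset.sum_mul]
    refine Finset.sum_congr rfl fun u hu => ?_
    split_ifs with hur
    · rw [min_eq_left (hh u hu hur)]
    · simp

lemma IsRegular.analyticOnNhd {Ω : Type*} [MeasurableSpace Ω] {P : Measure Ω} {a : ℕ → Ω → ℂ}
    {L : ℝ} (h : IsRegular P a L) {R : ℝ} (hR : R < 1) (ω : Ω) :
    AnalyticOnNhd ℂ (gaf a L ω) (Metric.closedBall 0 R) := by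
  rcases lt_or_ge R 0 with hR0 | hR0
  · rw [Metric.closedBall_eq_empty.2 hR0]
    exact fun z hz => hz.elim
  obtain ⟨S, hRS, hS⟩ := exists_between hR
  have hd : DifferentiableOn ℂ (gaf a L ω) (Metric.ball 0 S) := by
    unfold gaf
    refine Complex.differentiableOn_tsum_of_summable_norm
      (h.summable ω S (hR0.trans hRS.le) hS) (fun n => by fun_prop) Metric.isOpen_ball
      fun n z hz => ?_
    have hz' : ‖z‖ < S := by simpa using hz
    rw [norm_mul, norm_mul, norm_pow, Complex.norm_real, Real.norm_of_nonneg (Real.sqrt_nonneg _),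
      mul_assoc]
    gcongr
  exact (hd.analyticOnNhd Metric.isOpen_ball).mono (Metric.closedBall_subset_ball hRS)

/-! ### Limits in `L²` of variables with given covariances -/

/-- If `X j → Y` in `L²` and `cov[X i, X j] = ∑ k, x i k * x j k` with `x j k → y k` for every `k`,
then `Var[Y] = ∑ k, (y k)²`. -/
theorem hasSum_variance_of_tendsto {Ω ι : Type*} [MeasurableSpace Ω] {P : Measure Ω}
    [IsProbabilityMeasure P] {X : ℕ → Ω → ℝ} {Y : Ω → ℝ} (hX : ∀ j, MemLp (X j) 2 P)
    (hY : MemLp Y 2 P) (hXY : Tendsto (fun j => ∫ ω, (X j ω - Y ω) ^ 2 ∂P) atTop (𝓝 0))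
    {x : ℕ → ι → ℝ} {y : ι → ℝ}
    (hcov : ∀ i j, HasSum (fun k => x i k * x j k) cov[X i, X j; P])
    (hxy : ∀ k, Tendsto (fun j => x j k) atTop (𝓝 (y k))) :
    HasSum (fun k => y k ^ 2) Var[Y; P] := by
  have hmem : ∀ j, Memℓp (x j) 2 := by
    intro j
    refine memℓp_gen ?_
    have := (hcov j j).summable
    simpa [sq] using this
  -- The covariance hypothesis says that sending the centred `X j` to `x j` preserves inner
  -- products. Thus `L²` convergence makes `v` Cauchy in `ℓ²`, and its limit is identified
  -- coordinatewise with `y`.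
  let v : ℕ → lp (fun _ : ι => ℝ) 2 := fun j => ⟨x j, hmem j⟩
  have hnorm : ∀ w : lp (fun _ : ι => ℝ) 2, HasSum (fun k => w k ^ 2) (‖w‖ ^ 2) := by
    intro w
    have := lp.hasSum_norm (p := 2) (by simp) w
    simpa using this
  have hvar : ∀ W : Ω → ℝ, MemLp W 2 P → Var[W; P] ≤ ∫ ω, W ω ^ 2 ∂P :=
    fun W hW => variance_le_expectation_sq hW.aestronglyMeasurable
  have hsub : ∀ i j, ‖v i - v j‖ ^ 2 = Var[X i - X j; P] := by
    intro i j
    rw [variance_sub (hX i) (hX j), ← covariance_self (hX i).aestronglyMeasurable.aemeasurable,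
      ← covariance_self (hX j).aestronglyMeasurable.aemeasurable]
    have h1 := (((hcov i i).sub ((hcov i j).mul_left 2)).add (hcov j j))
    have h2 := hnorm (v i - v j)
    refine h2.unique ?_
    have e : ∀ k, (v i - v j) k ^ 2 = x i k * x i k - 2 * (x i k * x j k) + x j k * x j k := by
      intro k
      rw [lp.coeFn_sub, Pi.sub_apply]
      simp only [v]
      ring
    rw [funext e]
    exact h1
  set e : ℕ → ℝ := fun j => ∫ ω, (X j ω - Y ω) ^ 2 ∂P with he
  have hbound : ∀ i j, ‖v i - v j‖ ^ 2 ≤ 2 * (e i + e j) := by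
    intro i j
    have i1 : Integrable (fun ω => (X i ω - Y ω) ^ 2) P := ((hX i).sub hY).integrable_sq
    have i2 : Integrable (fun ω => (X j ω - Y ω) ^ 2) P := ((hX j).sub hY).integrable_sq
    rw [hsub]
    refine (hvar _ ((hX i).sub (hX j))).trans ?_
    rw [he, ← integral_add i1 i2, ← integral_const_mul]
    refine integral_mono ((hX i).sub (hX j)).integrable_sq ((i1.add i2).const_mul 2) fun ω => ?_
    simp only [Pi.sub_apply]
    nlinarith [sq_nonneg ((X i ω - Y ω) + (X j ω - Y ω))]
  have hcau : CauchySeq v := by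
    rw [Metric.cauchySeq_iff']
    intro ε hε
    have h1 := (hXY.eventually (gt_mem_nhds (show (0 : ℝ) < ε ^ 2 / 4 by positivity)))
    obtain ⟨N, hN⟩ := eventually_atTop.1 h1
    refine ⟨N, fun n hn => ?_⟩
    rw [dist_eq_norm]
    have h2 := hN n hn
    have h3 := hN N le_rfl
    have h4 := hbound n N
    refine lt_of_pow_lt_pow_left₀ 2 hε.le ?_
    simp only [he] at h4
    linarith
  obtain ⟨w, hw⟩ := cauchySeq_tendsto_of_complete hcau
  have hwy : ∀ k, w k = y k := by
    intro k
    refine tendsto_nhds_unique ?_ (hxy k)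
    rw [tendsto_iff_norm_sub_tendsto_zero] at hw ⊢
    refine squeeze_zero (fun _ => norm_nonneg _) (fun j => ?_) hw
    have := lp.norm_apply_le_norm (p := 2) (by simp) (v j - w) k
    rw [lp.coeFn_sub, Pi.sub_apply] at this
    exact this
  have hlim1 : Tendsto (fun j => ‖v j‖ ^ 2) atTop (𝓝 (‖w‖ ^ 2)) := (hw.norm).pow 2
  have hvv : ∀ j, ‖v j‖ ^ 2 = Var[X j; P] := by
    intro j
    rw [← covariance_self (hX j).aestronglyMeasurable.aemeasurable]
    refine (hnorm (v j)).unique ?_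
    have e1 : ∀ k, (v j) k ^ 2 = x j k * x j k := fun k => by simp only [v]; ring
    rw [funext e1]
    exact hcov j j
  have hlim3 : Tendsto (fun j => Var[X j; P]) atTop (𝓝 (Var[Y; P])) := by
    have hU : ∀ j, MemLp (X j - Y) 2 P := fun j => (hX j).sub hY
    have h0 : Tendsto (fun j => Var[X j - Y; P]) atTop (𝓝 0) :=
      squeeze_zero (fun j => variance_nonneg _ _) (fun j => hvar _ (hU j)) hXY
    -- Cauchy–Schwarz for covariances, from the discriminant of the nonnegative quadratic `t ↦ Var[t
    -- (X j - Y) + Y]`.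
    have hcs : ∀ j, |cov[X j - Y, Y; P]| ≤ √(Var[X j - Y; P]) * √(Var[Y; P]) := by
      intro j
      have hq : ∀ t : ℝ, 0 ≤ Var[X j - Y; P] * (t * t) + 2 * cov[X j - Y, Y; P] * t + Var[Y; P] := by
        intro t
        have h3 := variance_nonneg (t • (X j - Y) + Y) P
        rw [variance_add ((hU j).const_smul t) hY, variance_smul, covariance_smul_left] at h3
        linarith
      have h4 := discrim_le_zero hq
      rw [discrim] at h4
      rw [← Real.sqrt_mul (variance_nonneg _ _)]
      exact Real.abs_le_sqrt (by linarith)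
    have h1 : Tendsto (fun j => cov[X j - Y, Y; P]) atTop (𝓝 0) := by
      refine squeeze_zero_norm hcs ?_
      have := (((Real.continuous_sqrt.tendsto 0).comp h0).mul_const (√(Var[Y; P])))
      simpa [Function.comp_def] using this
    have h2 : ∀ j, Var[X j; P] = Var[X j - Y; P] + 2 * cov[X j - Y, Y; P] + Var[Y; P] := by
      intro j
      rw [← variance_add (hU j) hY, sub_add_cancel]
    simp_rw [h2]
    have := (h0.add (h1.const_mul 2)).add_const (Var[Y; P])
    simpa using this
  simp_rw [hvv] at hlim1
  have h5 := tendsto_nhds_unique hlim3 hlim1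
  rw [h5]
  have := hnorm w
  simpa [hwy] using this

section

/-! ### The chaos expansion of the number of zeros -/

/-- The logarithmic derivative of `chaosCoeff`. -/
def zerosCoeff (L r : ℝ) (p : ℕ × ℕ) : ℝ :=
  1 / ((p.1 : ℝ) + 1) * (coeff (L * (p.1 + 1)) p.2 * ((1 - r ^ 2) ^ (L * (p.1 + 1)) *
    r ^ (2 * p.2) * (p.2 - L * (p.1 + 1) * (r ^ 2 / (1 - r ^ 2)))))

lemma tendsto_chaosCoeff_slope {L r : ℝ} (hr : 0 < r) (hr1 : r < 1) (p : ℕ × ℕ) :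
    Tendsto (fun h => (chaosCoeff L p r - chaosCoeff L p (r * Real.exp (-h))) / h) (𝓝[>] 0)
      (𝓝 (zerosCoeff L r p)) := by
  have hε : 0 < 1 - r ^ 2 := by nlinarith
  set α : ℝ := L * (p.1 + 1) with hα
  have e1 : HasDerivAt (fun h : ℝ => 1 - r ^ 2 * Real.exp (-2 * h)) (2 * r ^ 2) 0 := by
    have h1 : HasDerivAt (fun h : ℝ => Real.exp (-2 * h)) (Real.exp (-2 * 0) * (-2 * 1)) 0 :=
      ((hasDerivAt_id (0 : ℝ)).const_mul (-2)).exp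
    refine ((h1.const_mul (r ^ 2)).const_sub 1).congr_deriv ?_
    simp
    ring
  have e2 := e1.rpow_const (p := α) (Or.inl (by simpa using hε.ne'))
  have e3 : HasDerivAt (fun h : ℝ => Real.exp (-2 * p.2 * h)) (-2 * p.2) 0 := by
    have h1 : HasDerivAt (fun h : ℝ => Real.exp (-2 * p.2 * h))
      (Real.exp (-2 * p.2 * 0) * (-2 * p.2 * 1)) 0 :=
      ((hasDerivAt_id (0 : ℝ)).const_mul (-2 * (p.2 : ℝ))).exp
    refine h1.congr_deriv ?_
    simp
  have e4 := ((e2.mul (e3.const_mul (r ^ (2 * p.2)))).const_mul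
    (1 / (2 * ((p.1 : ℝ) + 1)) * coeff (L * (p.1 + 1)) p.2))
  -- The quotient in question is minus the slope at `0` of `h ↦ chaosCoeff L p (r * exp (-h))`.
  have e5 := (e4.tendsto_slope_zero.mono_left
    (nhdsWithin_mono _ (fun x (hx : 0 < x) => hx.ne'))).neg
  have eq : ∀ h : ℝ, chaosCoeff L p (r * Real.exp (-h))
      = 1 / (2 * ((p.1 : ℝ) + 1)) * coeff (L * (p.1 + 1)) p.2 *
        ((1 - r ^ 2 * Real.exp (-2 * h)) ^ α *
          (r ^ (2 * p.2) * Real.exp (-2 * p.2 * h))) := by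
    intro h
    have h2 : Real.exp (-2 * h) = Real.exp (-h) ^ 2 := by rw [← Real.exp_nat_mul]; push_cast; ring_nf
    have h3 : Real.exp (-2 * p.2 * h) = Real.exp (-h) ^ (2 * p.2) := by
      rw [← Real.exp_nat_mul]; push_cast; ring_nf
    rw [chaosCoeff, h2, h3, mul_pow, mul_pow]
  have eq0 : chaosCoeff L p r = chaosCoeff L p (r * Real.exp (-0)) := by simp
  have hlim : zerosCoeff L r p = -(1 / (2 * ((p.1 : ℝ) + 1)) * coeff (L * (p.1 + 1)) p.2 *
      (2 * r ^ 2 * α * (1 - r ^ 2 * Real.exp (-2 * 0)) ^ (α - 1) *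
        (r ^ (2 * p.2) * Real.exp (-2 * p.2 * 0)) +
        (1 - r ^ 2 * Real.exp (-2 * 0)) ^ α * (r ^ (2 * p.2) * (-2 * p.2)))) := by
    simp only [mul_zero, Real.exp_zero, mul_one]
    rw [Real.rpow_sub_one hε.ne', zerosCoeff, ← hα]
    field_simp
    ring
  rw [hlim]
  refine e5.congr fun h => ?_
  simp only [Pi.mul_apply, zero_add, smul_eq_mul]
  rw [eq0, eq h, eq 0]
  ring

lemma logMean_eq_circleAverage {Ω : Type*} {a : ℕ → Ω → ℂ} {L : ℝ} (s : ℝ) (ω : Ω) :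
    logMean a L s ω = Real.circleAverage (fun z => Real.log ‖gaf a L ω z‖) 0 s := by
  rw [circleAverage_eq_integral_angle, logMean]

variable {Ω : Type*} [MeasurableSpace Ω] {P : Measure Ω} {a : ℕ → Ω → ℂ} {L : ℝ}

variable [IsProbabilityMeasure P]

/-- The difference quotients of the logarithmic mean converge to the number of zeros; both are
square integrable. -/
lemma IsRegular.tendsto_slope_logMean (h : IsRegular P a L) {r : ℝ} (hr : 0 < r) (hr1 : r < 1)
    {u : ℕ → ℝ} (hu : ∀ j, 0 < u j) (hu0 : Tendsto u atTop (𝓝 0)) :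
    (∀ j, MemLp ((u j)⁻¹ • (logMean a L r - logMean a L (r * Real.exp (-u j)))) 2 P) ∧
    MemLp (numZeros a L r) 2 P ∧
    Tendsto (fun j => ∫ ω, (((u j)⁻¹ • (logMean a L r - logMean a L (r * Real.exp (-u j)))) ω
      - numZeros a L r ω) ^ 2 ∂P) atTop (𝓝 0) := by
  obtain ⟨R, hrR, hR1⟩ := exists_between hr1
  have hR : 0 < R := hr.trans hrR
  have key := fun ω => difference_quotient_logMean hr hrR (h.analyticOnNhd hR1 ω)
    (by rw [h.gaf_zero]; exact h.ne_zero ω) (fun s => logMean_eq_circleAverage (a := a) (L := L) s ω)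
  set D : ℕ → Ω → ℝ := fun j => (u j)⁻¹ • (logMean a L r - logMean a L (r * Real.exp (-u j)))
    with hDdef
  have hDe : ∀ j ω, D j ω = (logMean a L r ω - logMean a L (r * Real.exp (-u j)) ω) / u j := by
    intro j ω
    simp only [hDdef, Pi.smul_apply, Pi.sub_apply, smul_eq_mul]
    rw [inv_mul_eq_div]
  have hD : ∀ j, MemLp (D j) 2 P := by
    intro j
    have he : Real.exp (-u j) ≤ 1 := Real.exp_le_one_iff.2 (by linarith [hu j])
    have he0 := Real.exp_pos (-u j)
    exact ((h.memLp_logMean hr.le hr1).sub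
      (h.memLp_logMean (by positivity) (by nlinarith))).const_smul _
  have hev : ∀ ω, ∀ᶠ j in atTop, D j ω = numZeros a L r ω := by
    intro ω
    have h1 : Tendsto u atTop (𝓝[>] 0) :=
      tendsto_nhdsWithin_iff.2 ⟨hu0, Eventually.of_forall hu⟩
    filter_upwards [h1.eventually (key ω).2.2] with j hj
    rw [hDe, hj, numZeros]
  -- Measurability of the zero count is inherited from the quotients, which are pointwise eventually
  -- equal to it.
  have hnm : AEStronglyMeasurable (numZeros a L r) P := by
    refine aestronglyMeasurable_of_tendsto_ae atTop (fun j => (hD j).aestronglyMeasurable)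
      (ae_of_all _ fun ω => ?_)
    exact tendsto_const_nhds.congr' ((hev ω).mono fun j hj => hj.symm)
  have hlog : 0 < Real.log (R / r) := Real.log_pos ((one_lt_div hr).2 hrR)
  have hn0 : ∀ ω, 0 ≤ numZeros a L r ω := fun ω => Nat.cast_nonneg _
  -- Jensen's formula on the larger circle of radius `R` dominates the zero count by this square
  -- integrable variable.
  have hB : MemLp ((Real.log (R / r))⁻¹ • (logMean a L R - fun ω => Real.log ‖gaf a L ω 0‖)) 2 P :=
    ((h.memLp_logMean hR.le hR1).sub (h.memLp_log (by simp))).const_smul _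
  have hn : MemLp (numZeros a L r) 2 P := by
    refine hB.mono hnm (ae_of_all _ fun ω => ?_)
    rw [Real.norm_of_nonneg (hn0 ω)]
    refine le_trans ?_ (le_abs_self _)
    simp only [Pi.smul_apply, Pi.sub_apply, smul_eq_mul]
    rw [inv_mul_eq_div, le_div_iff₀ hlog]
    exact (key ω).1
  refine ⟨hD, hn, ?_⟩
  -- Each quotient lies between `0` and the zero count `n`, so the squared difference is at most
  -- `n²`.
  have hdom := tendsto_integral_of_dominated_convergence (μ := P)
    (F := fun j ω => (D j ω - numZeros a L r ω) ^ 2) (f := fun _ => 0)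
    (fun ω => numZeros a L r ω ^ 2)
    (fun j => ((hD j).sub hn).integrable_sq.aestronglyMeasurable) hn.integrable_sq
    (fun j => ae_of_all _ fun ω => ?_) (ae_of_all _ fun ω => ?_)
  · rw [integral_zero] at hdom
    exact hdom
  · rw [Real.norm_of_nonneg (sq_nonneg _)]
    have h1 := (key ω).2.1 (u j) (hu j)
    rw [← hDe] at h1
    change 0 ≤ D j ω ∧ D j ω ≤ numZeros a L r ω at h1
    nlinarith [h1.1, h1.2]
  · refine tendsto_const_nhds.congr' ((hev ω).mono fun j hj => ?_)
    simp only
    rw [hj]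
    ring

theorem IsRegular.memLp_numZeros (h : IsRegular P a L) {r : ℝ} (hr : 0 < r) (hr1 : r < 1) :
    MemLp (numZeros a L r) 2 P :=
  (h.tendsto_slope_logMean hr hr1 (u := fun j => 1 / ((j : ℝ) + 1)) (fun j => by positivity)
    tendsto_one_div_add_atTop_nhds_zero_nat).2.1

theorem IsRegular.hasSum_variance_numZeros (h : IsRegular P a L) {r : ℝ} (hr : 0 < r)
    (hr1 : r < 1) : HasSum (fun p => zerosCoeff L r p ^ 2) Var[numZeros a L r; P] := by
  set u : ℕ → ℝ := fun j => 1 / ((j : ℝ) + 1) with hudef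
  have hu : ∀ j, 0 < u j := fun j => by positivity
  have hu0 : Tendsto u atTop (𝓝 0) := tendsto_one_div_add_atTop_nhds_zero_nat
  obtain ⟨hD, hn, hlim⟩ := h.tendsto_slope_logMean hr hr1 hu hu0
  have hs : ∀ j, 0 ≤ r * Real.exp (-u j) ∧ r * Real.exp (-u j) < 1 := by
    intro j
    have he : Real.exp (-u j) ≤ 1 := Real.exp_le_one_iff.2 (by linarith [hu j])
    have he0 := Real.exp_pos (-u j)
    exact ⟨by positivity, by nlinarith⟩
  refine hasSum_variance_of_tendsto hD hn hlim
    (x := fun j p => (chaosCoeff L p r - chaosCoeff L p (r * Real.exp (-u j))) / u j) ?_ ?_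
  · intro i j
    have m0 := h.memLp_logMean hr.le hr1
    have mi := h.memLp_logMean (hs i).1 (hs i).2
    have mj := h.memLp_logMean (hs j).1 (hs j).2
    have c1 := h.hasSum_covariance_logMean hr.le hr1 hr.le hr1
    have c2 := h.hasSum_covariance_logMean hr.le hr1 (hs j).1 (hs j).2
    have c3 := h.hasSum_covariance_logMean (hs i).1 (hs i).2 hr.le hr1
    have c4 := h.hasSum_covariance_logMean (hs i).1 (hs i).2 (hs j).1 (hs j).2
    have c5 := (((c1.sub c2).sub (c3.sub c4)).mul_left ((u i)⁻¹ * (u j)⁻¹))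
    rw [covariance_smul_left, covariance_smul_right, covariance_sub_left m0 mi (m0.sub mj),
      covariance_sub_right m0 m0 mj, covariance_sub_right mi m0 mj, ← mul_assoc]
    have e : ∀ p : ℕ × ℕ, (chaosCoeff L p r - chaosCoeff L p (r * Real.exp (-u i))) / u i *
        ((chaosCoeff L p r - chaosCoeff L p (r * Real.exp (-u j))) / u j)
        = (u i)⁻¹ * (u j)⁻¹ * (chaosCoeff L p r * chaosCoeff L p r
          - chaosCoeff L p r * chaosCoeff L p (r * Real.exp (-u j))
          - (chaosCoeff L p (r * Real.exp (-u i)) * chaosCoeff L p r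
          - chaosCoeff L p (r * Real.exp (-u i)) * chaosCoeff L p (r * Real.exp (-u j)))) := by
      intro p
      rw [div_eq_mul_inv, div_eq_mul_inv]
      ring
    simp_rw [e]
    exact c5
  · intro p
    have h1 : Tendsto u atTop (𝓝[>] 0) :=
      tendsto_nhdsWithin_iff.2 ⟨hu0, Eventually.of_forall hu⟩
    exact (tendsto_chaosCoeff_slope hr hr1 p).comp h1

end

/-! ### The variance as an integral -/

/-- The function `x / ((1 + x) ((1 + x) ^ L - 1))` of which the variance is an average. -/
def pairDensity (L x : ℝ) : ℝ := x / ((1 + x) * ((1 + x) ^ L - 1))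

lemma measurable_pairDensity (L : ℝ) : Measurable (pairDensity L) := by
  unfold pairDensity
  fun_prop

lemma log_mul_le_rpow_sub_one (L : ℝ) {x : ℝ} (hx : 0 ≤ x) :
    L * Real.log (1 + x) ≤ (1 + x) ^ L - 1 := by
  rw [Real.rpow_def_of_pos (by linarith), mul_comm]
  linarith [Real.add_one_le_exp (Real.log (1 + x) * L)]

lemma div_one_add_le_log {x : ℝ} (hx : 0 ≤ x) : x / (1 + x) ≤ Real.log (1 + x) := by
  have h := Real.one_sub_inv_le_log_of_pos (show 0 < 1 + x by linarith)
  have e : x / (1 + x) = 1 - (1 + x)⁻¹ := by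
    field_simp
    ring
  rwa [e]

lemma rpow_sub_one_nonneg {L x : ℝ} (hL : 0 < L) (hx : 0 ≤ x) : 0 ≤ (1 + x) ^ L - 1 :=
  sub_nonneg.2 (Real.one_le_rpow (by linarith) hL.le)

lemma rpow_sub_one_pos {L x : ℝ} (hL : 0 < L) (hx : 0 < x) : 0 < (1 + x) ^ L - 1 :=
  sub_pos.2 (Real.one_lt_rpow (by linarith) hL)

lemma pairDensity_nonneg {L x : ℝ} (hL : 0 < L) (hx : 0 ≤ x) : 0 ≤ pairDensity L x :=
  div_nonneg hx (mul_nonneg (by linarith) (rpow_sub_one_nonneg hL hx))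

/-- It combines `x / (1 + x) ≤ log (1 + x)` with `L log (1 + x) ≤ (1 + x)^L - 1`. The bound is the
limit at `x = 0`, where division by zero gives the value `0` instead. -/
lemma pairDensity_le {L x : ℝ} (hL : 0 < L) (hx : 0 ≤ x) : pairDensity L x ≤ 1 / L := by
  rcases hx.eq_or_lt with rfl | hx0
  · simp [pairDensity, hL.le]
  have h1 := rpow_sub_one_pos hL hx0
  rw [pairDensity, ← div_div, div_le_div_iff₀ h1 hL]
  have h2 := log_mul_le_rpow_sub_one L hx
  have h3 := div_one_add_le_log hx
  nlinarith

/-- A geometric series in `(1 + x)^(-L)`; its index is the order `k` of the dilogarithm expansion.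
-/
lemma hasSum_pairDensity {L x : ℝ} (hL : 0 < L) (hx : 0 ≤ x) :
    HasSum (fun k : ℕ => x / (1 + x) * ((1 + x) ^ (-L)) ^ (k + 1)) (pairDensity L x) := by
  rcases hx.eq_or_lt with rfl | hx0
  · simp [pairDensity]
  have h1 := rpow_sub_one_pos hL hx0
  have hpos : 0 < (1 + x) ^ L := by positivity
  have h2 : (1 + x) ^ (-L) < 1 := by
    rw [Real.rpow_neg (by linarith)]
    exact inv_lt_one_of_one_lt₀ (by linarith)
  have h3 := (hasSum_geometric_of_lt_one (by positivity) h2).mul_left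
    (x / (1 + x) * (1 + x) ^ (-L))
  have e : x / (1 + x) * (1 + x) ^ (-L) * (1 - (1 + x) ^ (-L))⁻¹ = pairDensity L x := by
    rw [pairDensity, Real.rpow_neg (by linarith)]
    have h4 : 1 - ((1 + x) ^ L)⁻¹ = ((1 + x) ^ L - 1) / (1 + x) ^ L := by
      field_simp
    rw [h4]
    field_simp
  rw [← e]
  simp_rw [pow_succ']
  simpa only [mul_assoc] using h3

/-- The hyperbolic distance parameter of two points of the circle of radius `r` at angle `θ`. -/
def chord (r θ : ℝ) : ℝ := 2 * r ^ 2 * (1 - Real.cos θ) / (1 - r ^ 2) ^ 2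

lemma chord_nonneg (r θ : ℝ) : 0 ≤ chord r θ := by
  have := Real.cos_le_one θ
  unfold chord
  have : 0 ≤ 1 - Real.cos θ := by linarith
  positivity

lemma normSq_sub_exp (s t θ : ℝ) :
    ‖(t : ℂ) - s * Complex.exp (θ * Complex.I)‖ ^ 2 = t ^ 2 - 2 * s * t * Real.cos θ + s ^ 2 := by
  rw [Complex.exp_mul_I, ← Complex.ofReal_cos, ← Complex.ofReal_sin, ← Complex.normSq_eq_norm_sq,
    Complex.normSq_apply]
  simp [-Complex.ofReal_cos, -Complex.ofReal_sin]
  linear_combination s ^ 2 * Real.sin_sq_add_cos_sq θ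

/-- With `α = L (k + 1)` and `u = r² exp (iθ)`, the coefficients for fixed `k` are those of a
multiple of `(u / (1 - u) - q) (1 - u)^(-α)`. Parseval gives the mean of its squared modulus, and
both `‖1 - u‖` and `‖r² - u‖` are functions of `chord r θ`. -/
lemma tsum_zerosCoeff_sq {L r : ℝ} (hL : 0 < L) (hr : 0 < r) (hr1 : r < 1) (k : ℕ) :
    ∑' m, zerosCoeff L r (k, m) ^ 2 = ∫ θ, L ^ 2 * (r ^ 2 / (1 - r ^ 2) ^ 2) *
      (chord r θ / (1 + chord r θ) * ((1 + chord r θ) ^ (-L)) ^ (k + 1)) ∂angle := by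
  have hε : 0 < 1 - r ^ 2 := by nlinarith
  set α : ℝ := L * (k + 1) with hα
  have hα0 : 0 < α := by positivity
  set q : ℝ := r ^ 2 / (1 - r ^ 2) with hq
  set A : ℝ := 1 / ((k : ℝ) + 1) * (1 - r ^ 2) ^ α with hA
  set d : ℕ → ℂ := fun m => ((A * (coeff α m * (m - α * q) * (r ^ 2) ^ m) : ℝ) : ℂ) with hd
  have hu : ∀ θ : ℝ, ‖((r ^ 2 : ℝ) : ℂ) * Complex.exp (θ * Complex.I)‖ < 1 := by
    intro θ
    rw [norm_mul, norm_exp_mul_I, mul_one, Complex.norm_real, Real.norm_of_nonneg (by positivity)]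
    linarith
  have hsum : ∀ θ : ℝ, HasSum (fun m => d m * Complex.exp (θ * Complex.I) ^ m)
      ((A * α : ℝ) * ((((r ^ 2 : ℝ) : ℂ) * Complex.exp (θ * Complex.I)) /
        (1 - ((r ^ 2 : ℝ) : ℂ) * Complex.exp (θ * Complex.I)) - q) *
        (1 / (1 - ((r ^ 2 : ℝ) : ℂ) * Complex.exp (θ * Complex.I)) ^ (α : ℂ))) := by
    intro θ
    have h1 := ((hasSum_mul_coeff hα0 (hu θ)).sub
      ((hasSum_coeff hα0 (hu θ)).mul_left ((α * q : ℝ) : ℂ))).mul_left (A : ℂ)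
    have e : ∀ m, d m * Complex.exp (θ * Complex.I) ^ m
        = (A : ℂ) * ((m : ℂ) * coeff α m * (((r ^ 2 : ℝ) : ℂ) * Complex.exp (θ * Complex.I)) ^ m
          - ((α * q : ℝ) : ℂ) * (coeff α m *
            (((r ^ 2 : ℝ) : ℂ) * Complex.exp (θ * Complex.I)) ^ m)) := by
      intro m
      simp only [hd]
      push_cast
      rw [mul_pow]
      ring
    rw [funext e]
    convert! h1 using 1
    push_cast
    ring
  have hdn : Summable fun m => ‖d m‖ := by
    have h0 := (hsum 0).summable.norm
    simpa using h0
  have hpars := integral_angle_norm_sq_tsum hdn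
  have e1 : ∀ m, ‖d m‖ ^ 2 = zerosCoeff L r (k, m) ^ 2 := by
    intro m
    simp only [hd]
    rw [Complex.norm_real, Real.norm_eq_abs, sq_abs, hA, zerosCoeff]
    simp only [← hα, ← hq]
    rw [pow_mul]
    ring
  simp_rw [e1] at hpars
  rw [← hpars]
  refine integral_congr_ae (ae_of_all _ fun θ => ?_)
  simp only
  rw [(hsum θ).tsum_eq, norm_mul, norm_mul, norm_one_div_cpow (hu θ), Complex.norm_real]
  set x := chord r θ with hx
  have hx0 : 0 ≤ x := chord_nonneg r θ
  set u : ℂ := ((r ^ 2 : ℝ) : ℂ) * Complex.exp (θ * Complex.I) with hudef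
  have n1 : ‖1 - u‖ ^ 2 = (1 - r ^ 2) ^ 2 * (1 + x) := by
    have := normSq_sub_exp (r ^ 2) 1 θ
    rw [Complex.ofReal_one] at this
    rw [hudef, this, hx, chord]
    field_simp
    ring
  have n2 : ‖((r ^ 2 : ℝ) : ℂ) - u‖ ^ 2 = r ^ 2 * (1 - r ^ 2) ^ 2 * x := by
    rw [hudef, normSq_sub_exp, hx, chord]
    field_simp
    ring
  have hu1 : 1 - u ≠ 0 := norm_pos_iff.1 (norm_one_sub_pos (hu θ))
  have hεc : (1 : ℂ) - r ^ 2 ≠ 0 := by exact_mod_cast hε.ne'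
  have n3 : ‖u / (1 - u) - q‖ ^ 2 = r ^ 2 / (1 - r ^ 2) ^ 2 * (x / (1 + x)) := by
    have e2 : u / (1 - u) - q = -(((r ^ 2 : ℝ) : ℂ) - u) / ((1 - u) * ((1 - r ^ 2 : ℝ) : ℂ)) := by
      rw [hq]
      push_cast
      field_simp
      ring
    rw [e2, norm_div, norm_neg, norm_mul, div_pow, mul_pow, n1, n2, Complex.norm_real,
      Real.norm_eq_abs, sq_abs]
    have : (1 + x) ≠ 0 := by positivity
    field_simp
  have n4 : (‖1 - u‖ ^ (-α)) ^ 2 = (1 - r ^ 2) ^ (-(2 * α)) * ((1 + x) ^ (-L)) ^ (k + 1) := by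
    rw [← Real.rpow_natCast _ 2, ← Real.rpow_mul (norm_nonneg _),
      show -α * ((2 : ℕ) : ℝ) = ((2 : ℕ) : ℝ) * -α by ring, Real.rpow_mul (norm_nonneg _),
      Real.rpow_natCast, n1, Real.mul_rpow (by positivity) (by positivity),
      ← Real.rpow_natCast (1 - r ^ 2) 2, ← Real.rpow_mul hε.le, ← Real.rpow_natCast _ (k + 1),
      ← Real.rpow_mul (by positivity)]
    congr 2
    · push_cast; ring
    · rw [hα]; push_cast; ring
  rw [mul_pow, mul_pow, n3, n4, Real.norm_eq_abs, sq_abs, hA, hα]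
  have n5 : ((1 - r ^ 2) ^ (L * ((k : ℝ) + 1))) ^ 2 * (1 - r ^ 2) ^ (-(2 * (L * ((k : ℝ) + 1)))) = 1 := by
    rw [← Real.rpow_natCast _ 2, ← Real.rpow_mul hε.le, ← Real.rpow_add hε]
    convert Real.rpow_zero _ using 2
    push_cast
    ring
  have hk : (k : ℝ) + 1 ≠ 0 := by positivity
  calc _ = (1 / ((k : ℝ) + 1) * (L * (k + 1))) ^ 2 * (((1 - r ^ 2) ^ (L * ((k : ℝ) + 1))) ^ 2 *
        (1 - r ^ 2) ^ (-(2 * (L * ((k : ℝ) + 1))))) * (r ^ 2 / (1 - r ^ 2) ^ 2) *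
        (x / (1 + x) * ((1 + x) ^ (-L)) ^ (k + 1)) := by ring
    _ = _ := by
      rw [n5]
      field_simp

lemma integrable_bounded_angle {g : ℝ → ℝ} (hg : Measurable g) {C : ℝ} (hC : ∀ θ, ‖g θ‖ ≤ C) :
    Integrable g angle := by
  have := hg.aestronglyMeasurable (μ := angle)
  exact Integrable.of_bound this C (ae_of_all _ hC)

lemma measurable_chord (r : ℝ) : Measurable (chord r) := by
  unfold chord
  fun_prop

lemma hasSum_zerosCoeff_sq_eq {L r V : ℝ} (hL : 0 < L) (hr : 0 < r) (hr1 : r < 1)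
    (hV : HasSum (fun p => zerosCoeff L r p ^ 2) V) :
    V = L ^ 2 * (r ^ 2 / (1 - r ^ 2) ^ 2) * ∫ θ, pairDensity L (chord r θ) ∂angle := by
  set g : ℕ → ℝ → ℝ := fun k θ => L ^ 2 * (r ^ 2 / (1 - r ^ 2) ^ 2) *
      (chord r θ / (1 + chord r θ) * ((1 + chord r θ) ^ (-L)) ^ (k + 1)) with hg
  have hg0 : ∀ k θ, 0 ≤ g k θ := by
    intro k θ
    have := chord_nonneg r θ
    positivity
  have hgs : ∀ θ, HasSum (fun k => g k θ)
      (L ^ 2 * (r ^ 2 / (1 - r ^ 2) ^ 2) * pairDensity L (chord r θ)) := fun θ =>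
    (hasSum_pairDensity hL (chord_nonneg r θ)).mul_left _
  have hgi : ∀ k, Integrable (g k) angle := by
    intro k
    have := measurable_chord r
    refine integrable_bounded_angle (C := L ^ 2 * (r ^ 2 / (1 - r ^ 2) ^ 2) * (1 / L))
      (by simp only [hg]; fun_prop) fun θ => ?_
    rw [Real.norm_of_nonneg (hg0 k θ)]
    refine ((hgs θ).summable.le_tsum k (fun j _ => hg0 j θ)).trans ?_
    rw [(hgs θ).tsum_eq]
    exact mul_le_mul_of_nonneg_left (pairDensity_le hL (chord_nonneg r θ)) (by positivity)
  have h1 : HasSum (fun k => ∫ θ, g k θ ∂angle) V := by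
    refine hV.prod_fiberwise fun k => ?_
    have := (hV.summable.prod_factor k).hasSum
    rwa [tsum_zerosCoeff_sq hL hr hr1 k] at this
  have h2 := hasSum_integral_of_summable_integral_norm hgi (by
    have e : ∀ k, ∫ θ, ‖g k θ‖ ∂angle = ∫ θ, g k θ ∂angle := fun k =>
      integral_congr_ae (ae_of_all _ fun θ => Real.norm_of_nonneg (hg0 k θ))
    simp_rw [e]
    exact h1.summable)
  rw [h1.unique h2, ← integral_const_mul]
  exact integral_congr_ae (ae_of_all _ fun θ => (hgs θ).tsum_eq)

/-- Since `1 - cos θ = 2 sin² (θ/2)`, `chord r θ` is `b² sin² (θ/2)`; symmetry about `π/2` halves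
the range. -/
lemma integral_angle_pairDensity {L r : ℝ} (hL : 0 < L) (hr1 : r ^ 2 < 1) :
    ∫ θ, pairDensity L (chord r θ) ∂angle = 2 / Real.pi *
      ∫ ψ in (0 : ℝ)..Real.pi / 2, pairDensity L ((2 * r / (1 - r ^ 2)) ^ 2 * Real.sin ψ ^ 2) := by
  have hε : 1 - r ^ 2 ≠ 0 := by linarith
  set G : ℝ → ℝ := fun ψ => pairDensity L ((2 * r / (1 - r ^ 2)) ^ 2 * Real.sin ψ ^ 2) with hG
  have e : ∀ θ, pairDensity L (chord r θ) = G (θ / 2) := by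
    intro θ
    simp only [hG]
    rw [chord]
    have h1 : Real.cos θ = 1 - 2 * Real.sin (θ / 2) ^ 2 := by
      have h2 := Real.cos_sq' (θ / 2)
      have h3 := Real.cos_two_mul (θ / 2)
      rw [show 2 * (θ / 2) = θ by ring] at h3
      rw [h3, h2]
      ring
    rw [h1]
    congr 1
    field_simp
    ring
  have hGm : Measurable G := (measurable_pairDensity L).comp (by fun_prop)
  have hGi : ∀ a b, IntervalIntegrable G volume a b := by
    intro a b
    refine (intervalIntegrable_const (c := 1 / L)).mono_fun hGm.aestronglyMeasurable
      (ae_of_all _ fun ψ => ?_)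
    simp only [hG]
    rw [Real.norm_of_nonneg (pairDensity_nonneg hL (by positivity)),
      Real.norm_of_nonneg (by positivity)]
    exact pairDensity_le hL (by positivity)
  have hsymm : ∫ ψ in (Real.pi / 2)..Real.pi, G ψ = ∫ ψ in (0 : ℝ)..Real.pi / 2, G ψ := by
    have h1 := intervalIntegral.integral_comp_sub_left (a := 0) (b := Real.pi / 2) G Real.pi
    rw [sub_zero, sub_half] at h1
    rw [← h1]
    simp only [hG, Real.sin_pi_sub]
  rw [integral_angle]
  simp_rw [e]
  rw [intervalIntegral.integral_comp_div _ two_ne_zero, zero_div,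
    mul_div_cancel_left₀ _ (two_ne_zero), ← intervalIntegral.integral_add_adjacent_intervals
      (hGi 0 (Real.pi / 2)) (hGi (Real.pi / 2) Real.pi), hsymm]
  have := Real.pi_ne_zero
  simp only [smul_eq_mul]
  field_simp
  ring

/-- The integral expressing the variance of the number of zeros, with `b = 2r / (1 - r²)`. -/
def varianceIntegral (L b : ℝ) : ℝ :=
  L ^ 2 * b ^ 2 / (2 * Real.pi) *
    ∫ ψ in (0 : ℝ)..Real.pi / 2, pairDensity L (b ^ 2 * Real.sin ψ ^ 2)

theorem IsRegular.variance_numZeros {Ω : Type*} [MeasurableSpace Ω] {P : Measure Ω}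
    [IsProbabilityMeasure P] {a : ℕ → Ω → ℂ} {L : ℝ} (h : IsRegular P a L) {r : ℝ} (hr : 0 < r)
    (hr1 : r < 1) : Var[numZeros a L r; P] = varianceIntegral L (2 * r / (1 - r ^ 2)) := by
  rw [hasSum_zerosCoeff_sq_eq h.pos hr hr1 (h.hasSum_variance_numZeros hr hr1),
    integral_angle_pairDensity h.pos (by nlinarith), varianceIntegral]
  have : 1 - r ^ 2 ≠ 0 := by nlinarith
  have := Real.pi_ne_zero
  field_simp

/-! ### Existence of a regular version -/

/-- The first absolute moments are finite and equal, so the expected sum is finite. -/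
lemma ae_summable_norm_mul {Ω : Type*} [MeasurableSpace Ω] {P : Measure Ω} {b : ℕ → Ω → ℂ}
    (hb : ∀ n, HasLaw (b n) stdComplexNormal P) {w : ℕ → ℝ} (hw : ∀ n, 0 ≤ w n)
    (hs : Summable w) : ∀ᵐ ω ∂P, Summable fun n => ‖b n ω‖ * w n := by
  have hE : ∀ n, ∫⁻ ω, ‖b n ω‖ₑ * ENNReal.ofReal (w n) ∂P
      = (∫⁻ ζ, ‖ζ‖ₑ ∂stdComplexNormal) * ENNReal.ofReal (w n) := by
    intro n
    rw [lintegral_mul_const' _ _ ENNReal.ofReal_ne_top]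
    congr 1
    exact (hb n).lintegral_comp (f := fun ζ : ℂ => ‖ζ‖ₑ) (by fun_prop)
  have hmeas : ∀ n, AEMeasurable (fun ω => ‖b n ω‖ₑ * ENNReal.ofReal (w n)) P := fun n =>
    (hb n).aemeasurable.enorm.mul_const _
  have hC : ∫⁻ ζ, ‖ζ‖ₑ ∂stdComplexNormal ≠ ⊤ := by
    have := integrable_norm_stdComplexNormal.hasFiniteIntegral
    rw [hasFiniteIntegral_iff_enorm] at this
    simpa using this.ne
  have hfin : ∫⁻ ω, ∑' n, ‖b n ω‖ₑ * ENNReal.ofReal (w n) ∂P ≠ ⊤ := by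
    rw [lintegral_tsum hmeas]
    simp_rw [hE]
    rw [ENNReal.tsum_mul_left]
    exact ENNReal.mul_ne_top hC hs.tsum_ofReal_ne_top
  filter_upwards [ae_lt_top' (AEMeasurable.tsum hmeas) hfin] with ω hω
  refine (ENNReal.summable_toReal hω.ne).congr fun n => ?_
  rw [ENNReal.toReal_mul, ENNReal.toReal_ofReal (hw n), toReal_enorm]

/-- The coefficients of a hyperbolic Gaussian analytic function can be changed on a null set so
that the function becomes regular. -/
theorem exists_isRegular {Ω : Type*} [MeasurableSpace Ω] {P : Measure Ω} {a : ℕ → Ω → ℂ}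
    (hlaw : ∀ n, HasLaw (a n) stdComplexNormal P) (hindep : iIndepFun a P) {L : ℝ} (hL : 0 < L) :
    ∃ a' : ℕ → Ω → ℂ, IsRegular P a' L ∧ ∀ᵐ ω ∂P, ∀ n, a' n ω = a n ω := by
  set b : ℕ → Ω → ℂ := fun n => (hlaw n).aemeasurable.mk (a n) with hb
  have hbm : ∀ n, Measurable (b n) := fun n => (hlaw n).aemeasurable.measurable_mk
  have hba : ∀ n, b n =ᵐ[P] a n := fun n => (hlaw n).aemeasurable.ae_eq_mk.symm
  have hblaw : ∀ n, HasLaw (b n) stdComplexNormal P := fun n => (hlaw n).congr (hba n)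
  -- Countably many radii increasing to `1` suffice: summability at `x k` implies it at every
  -- smaller radius.
  set x : ℕ → ℝ := fun k => 1 - 1 / ((k : ℝ) + 1) with hx
  have hx0 : ∀ k, 0 ≤ x k := by
    intro k
    have : 1 / ((k : ℝ) + 1) ≤ 1 := by
      rw [div_le_one (by positivity)]
      linarith [Nat.cast_nonneg (α := ℝ) k]
    simp only [hx]
    linarith
  have hx1 : ∀ k, x k < 1 := by
    intro k
    have : 0 < 1 / ((k : ℝ) + 1) := by positivity
    simp only [hx]
    linarith
  have hgood : ∀ᵐ ω ∂P, (∀ k, Summable fun n => ‖b n ω‖ * (√(coeff L n) * x k ^ n)) ∧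
      b 0 ω ≠ 0 := by
    refine (ae_all_iff.2 fun k => ae_summable_norm_mul hblaw
      (fun n => mul_nonneg (Real.sqrt_nonneg _) (pow_nonneg (hx0 k) n))
      (summable_sqrt_coeff hL (hx0 k) (hx1 k))).and ?_
    rw [ae_iff]
    have := (hblaw 0).measure_eq (p := fun ζ => ζ = 0) (measurableSet_singleton 0)
    simp only [not_not]
    exact this.trans stdComplexNormal_singleton_zero
  obtain ⟨t, hts, htm, ht0⟩ := exists_measurable_superset_of_null (ae_iff.1 hgood)
  classical
  -- On the exceptional null set the function is replaced by the constant `1`.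
  set a' : ℕ → Ω → ℂ := fun n ω => if ω ∈ t then (if n = 0 then 1 else 0) else b n ω with ha'
  have hta : ∀ᵐ ω ∂P, ω ∉ t := measure_eq_zero_iff_ae_notMem.1 ht0
  have haa : ∀ᵐ ω ∂P, ∀ n, a' n ω = a n ω := by
    filter_upwards [hta, ae_all_iff.2 hba] with ω h1 h2 n
    simp only [ha']
    rw [if_neg h1, h2 n]
  have haa' : ∀ n, a' n =ᵐ[P] a n := fun n => haa.mono fun ω h => h n
  refine ⟨a', ⟨hL, fun n => Measurable.ite htm measurable_const (hbm n),
    fun n => (hlaw n).congr (haa' n), hindep.congr fun n => (haa' n).symm, fun ω y hy0 hy1 => ?_,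
    fun ω => ?_⟩, haa⟩
  · by_cases hω : ω ∈ t
    · refine summable_of_ne_finset_zero (s := {0}) fun n hn => ?_
      simp only [ha']
      rw [if_pos hω, if_neg (by simpa using hn), norm_zero, zero_mul]
    · have hg := (not_not.1 fun h => hω (hts h)).1
      obtain ⟨k, hk⟩ := exists_nat_one_div_lt (sub_pos.2 hy1)
      have hyx : y ≤ x k := by
        simp only [hx]
        linarith
      refine (hg k).of_nonneg_of_le (fun n => by positivity) fun n => ?_
      simp only [ha']
      rw [if_neg hω]
      gcongr
  · simp only [ha']
    by_cases hω : ω ∈ t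
    · simp [hω]
    · rw [if_neg hω]
      exact (not_not.1 fun h => hω (hts h)).2

/-- The number of zeros of the hyperbolic Gaussian analytic function is square integrable, and its
variance is given by `varianceIntegral`. -/
theorem memLp_and_variance_numZeros {Ω : Type*} [MeasurableSpace Ω] {P : Measure Ω}
    [IsProbabilityMeasure P] {a : ℕ → Ω → ℂ} (hlaw : ∀ n, HasLaw (a n) stdComplexNormal P)
    (hindep : iIndepFun a P) {L r : ℝ} (hL : 0 < L) (hr : 0 < r) (hr1 : r < 1) :
    MemLp (numZeros a L r) 2 P ∧
      Var[numZeros a L r; P] = varianceIntegral L (2 * r / (1 - r ^ 2)) := by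
  obtain ⟨a', h, haa⟩ := exists_isRegular hlaw hindep hL
  have hn : numZeros a' L r =ᵐ[P] numZeros a L r := by
    filter_upwards [haa] with ω hω
    have : gaf a' L ω = gaf a L ω := by
      funext z
      simp only [gaf, hω]
    rw [numZeros, numZeros, this]
  exact ⟨(memLp_congr_ae hn).1 (h.memLp_numZeros hr hr1),
    (variance_congr hn).symm.trans (h.variance_numZeros hr hr1)⟩

/-! ### Large intensity -/

/-- The integral in the definition of `varianceIntegral`. -/
def pairIntegral (L b : ℝ) : ℝ :=
  ∫ ψ in (0 : ℝ)..Real.pi / 2, pairDensity L (b ^ 2 * Real.sin ψ ^ 2)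

lemma varianceIntegral_eq (L b : ℝ) :
    varianceIntegral L b = L ^ 2 * b ^ 2 / (2 * Real.pi) * pairIntegral L b := rfl

lemma hasSum_zeta_three_halves :
    HasSum (fun k : ℕ => 1 / ((k : ℝ) + 1) ^ (3 / 2 : ℝ)) (riemannZeta (3 / 2)).re := by
  have hre : (1 : ℝ) < (3 / 2 : ℂ).re := by norm_num
  have hs : Summable fun k : ℕ => 1 / ((k : ℂ) + 1) ^ (3 / 2 : ℂ) := by
    have := (summable_nat_add_iff 1).2 (Complex.summable_one_div_nat_cpow.2 hre)
    simpa using this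
  have h := Complex.hasSum_re hs.hasSum
  rw [← zeta_eq_tsum_one_div_nat_add_one_cpow hre] at h
  have e : ∀ k : ℕ, (1 / ((k : ℂ) + 1) ^ (3 / 2 : ℂ)).re = 1 / ((k : ℝ) + 1) ^ (3 / 2 : ℝ) := by
    intro k
    rw [← Complex.ofReal_re (1 / ((k : ℝ) + 1) ^ (3 / 2 : ℝ))]
    congr 1
    rw [Complex.ofReal_div, Complex.ofReal_cpow (by positivity)]
    simp
  simpa only [e] using h

lemma zeta_three_halves_re_pos : 0 < (riemannZeta (3 / 2)).re := by
  have h := le_hasSum hasSum_zeta_three_halves 0 fun k _ => by positivity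
  have h1 : (0 : ℝ) < 1 / (((0 : ℕ) : ℝ) + 1) ^ (3 / 2 : ℝ) := by positivity
  exact h1.trans_le h

/-- Expand `1 / (exp (s²) - 1)` geometrically; each Gaussian integral equals `√π / 4 · (k +
1)^(-3/2)`. -/
lemma integral_sq_div_exp_sq_sub_one :
    ∫ s in Set.Ioi (0 : ℝ), s ^ 2 / (Real.exp (s ^ 2) - 1)
      = √Real.pi / 4 * (riemannZeta (3 / 2)).re := by
  set F : ℕ → ℝ → ℝ := fun k s => s ^ 2 * Real.exp (-((k : ℝ) + 1) * s ^ 2) with hF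
  have hF0 : ∀ k s, 0 ≤ F k s := fun k s => by positivity
  have hFI : ∀ k, ∫ s in Set.Ioi (0 : ℝ), F k s = √Real.pi / 4 * (1 / ((k : ℝ) + 1) ^ (3 / 2 : ℝ)) := by
    intro k
    have h := integral_rpow_mul_exp_neg_mul_rpow (p := 2) (q := 2) (b := (k : ℝ) + 1) (by norm_num)
      (by norm_num) (by positivity)
    have hG : Real.Gamma (3 / 2) = √Real.pi / 2 := by
      rw [show (3 / 2 : ℝ) = 1 / 2 + 1 by norm_num, Real.Gamma_add_one (by norm_num),
        Real.Gamma_one_half_eq]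
      ring
    rw [show (2 + 1 : ℝ) / 2 = 3 / 2 by norm_num, show -(2 + 1 : ℝ) / 2 = -(3 / 2) by norm_num, hG,
      Real.rpow_neg (by positivity)] at h
    simp only [Real.rpow_two] at h
    simp only [hF]
    rw [h]
    ring
  have hFi : ∀ k, Integrable (F k) (volume.restrict (Set.Ioi 0)) := by
    intro k
    have h := integrableOn_rpow_mul_exp_neg_mul_rpow (p := 2) (s := 2) (b := (k : ℝ) + 1)
      (by norm_num) (by norm_num) (by positivity)
    simp only [Real.rpow_two] at h
    exact h
  have hz := hasSum_zeta_three_halves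
  have hn : ∀ k, ∫ s in Set.Ioi (0 : ℝ), ‖F k s‖ = ∫ s in Set.Ioi (0 : ℝ), F k s := fun k =>
    integral_congr_ae (ae_of_all _ fun s => Real.norm_of_nonneg (hF0 k s))
  have h1 := hasSum_integral_of_summable_integral_norm hFi (by
    simp_rw [hn, hFI]
    exact (hz.mul_left _).summable)
  simp_rw [hFI] at h1
  rw [← h1.unique (hz.mul_left _)]
  refine setIntegral_congr_fun measurableSet_Ioi fun s (hs : 0 < s) => ?_
  simp only [hF]
  rw [tsum_mul_left]
  have hq : Real.exp (-s ^ 2) < 1 := Real.exp_lt_one_iff.2 (neg_lt_zero.2 (pow_pos hs 2))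
  have e : ∀ k : ℕ, Real.exp (-((k : ℝ) + 1) * s ^ 2)
      = Real.exp (-s ^ 2) * Real.exp (-s ^ 2) ^ k := by
    intro k
    rw [← Real.exp_nat_mul, ← Real.exp_add]
    congr 1
    ring
  simp_rw [e]
  rw [tsum_mul_left, tsum_geometric_of_lt_one (Real.exp_pos _).le hq, Real.exp_neg, div_eq_mul_inv]
  congr 1
  have h2 : 1 < Real.exp (s ^ 2) := Real.one_lt_exp_iff.2 (by positivity)
  have h3 : 1 - (Real.exp (s ^ 2))⁻¹ = (Real.exp (s ^ 2) - 1) / Real.exp (s ^ 2) := by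
    field_simp
  rw [h3]
  field_simp

/-- Bernoulli's inequality for the exponent `L / 2 ≥ 1`, then squared, keeps the term `(Lx)² / 4`.
With `Lx` of order `s²` this yields a majorant integrable in `s`. -/
lemma mul_pairDensity_le {L x : ℝ} (hL : 2 ≤ L) (hx : 0 ≤ x) :
    L * pairDensity L x ≤ 1 / (1 + L * x / 4) := by
  have hL0 : 0 < L := by linarith
  rcases hx.eq_or_lt with rfl | hx0
  · simp [pairDensity]
  have h1 : 1 + L / 2 * x ≤ (1 + x) ^ (L / 2) :=
    one_add_mul_self_le_rpow_one_add (by linarith) (by linarith)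
  have h2 : (1 + x) ^ L = ((1 + x) ^ (L / 2)) ^ 2 := by
    rw [← Real.rpow_natCast _ 2, ← Real.rpow_mul (by linarith)]
    congr 1
    push_cast
    ring
  have hLx : 0 < L * x := by positivity
  have h3 : L * x + (L * x) ^ 2 / 4 ≤ (1 + x) ^ L - 1 := by
    rw [h2]
    nlinarith
  have h4 : L * x + (L * x) ^ 2 / 4 ≤ (1 + x) * ((1 + x) ^ L - 1) := by nlinarith
  calc L * pairDensity L x = L * x / ((1 + x) * ((1 + x) ^ L - 1)) := by
        rw [pairDensity]; ring
    _ ≤ L * x / (L * x + (L * x) ^ 2 / 4) := by gcongr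
    _ = 1 / (1 + L * x / 4) := by field_simp

/-- If `L → ∞` and `L x → t` then `L * pairDensity L x → t / (exp t - 1)`. -/
lemma tendsto_mul_pairDensity {ι : Type*} {l : Filter ι} {L x : ι → ℝ} {t : ℝ} (ht : t ≠ 0)
    (hL : Tendsto L l atTop) (hx : ∀ i, 0 ≤ x i) (hLx : Tendsto (fun i => L i * x i) l (𝓝 t)) :
    Tendsto (fun i => L i * pairDensity (L i) (x i)) l (𝓝 (t / (Real.exp t - 1))) := by
  have hL0 : ∀ᶠ i in l, 0 < L i := hL.eventually_gt_atTop 0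
  have hx0 : Tendsto x l (𝓝 0) := by
    have h := hLx.mul (tendsto_inv_atTop_zero.comp hL)
    rw [mul_zero] at h
    refine h.congr' ?_
    filter_upwards [hL0] with i hi
    simp only [Function.comp_apply]
    field_simp
  have h1x : Tendsto (fun i => 1 + x i) l (𝓝 1) := by simpa using hx0.const_add 1
  have hlog : Tendsto (fun i => L i * Real.log (1 + x i)) l (𝓝 t) := by
    have hlow : Tendsto (fun i => L i * x i / (1 + x i)) l (𝓝 t) := by
      have h := hLx.div h1x one_ne_zero
      rw [div_one] at h
      exact h
    refine tendsto_of_tendsto_of_tendsto_of_le_of_le' hlow hLx ?_ ?_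
    · filter_upwards [hL0] with i hi
      rw [mul_div_assoc]
      exact mul_le_mul_of_nonneg_left (div_one_add_le_log (hx i)) hi.le
    · filter_upwards [hL0] with i hi
      refine mul_le_mul_of_nonneg_left ?_ hi.le
      linarith [Real.log_le_sub_one_of_pos (show 0 < 1 + x i by linarith [hx i])]
  have hpow : Tendsto (fun i => (1 + x i) ^ L i) l (𝓝 (Real.exp t)) := by
    refine ((Real.continuous_exp.tendsto t).comp hlog).congr fun i => ?_
    rw [Function.comp_apply, Real.rpow_def_of_pos (by linarith [hx i]), mul_comm]
  have hne : Real.exp t - 1 ≠ 0 := by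
    rw [sub_ne_zero]
    simpa using ht
  have h := hLx.div (h1x.mul (hpow.sub_const 1)) (by simpa using hne)
  rw [one_mul] at h
  refine h.congr fun i => ?_
  rw [Pi.div_apply, pairDensity, mul_div_assoc]

lemma tendsto_mul_sin_div {ι : Type*} {l : Filter ι} {c : ι → ℝ} (hc : Tendsto c l atTop) (s : ℝ) :
    Tendsto (fun i => c i * Real.sin (s / c i)) l (𝓝 s) := by
  have h1 : HasDerivAt (fun y : ℝ => Real.sin (s * y)) s 0 := by
    have := ((hasDerivAt_id (0 : ℝ)).const_mul s).sin
    refine this.congr_deriv ?_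
    simp
  have h2 := h1.tendsto_slope_zero
  have h3 : Tendsto (fun i => (c i)⁻¹) l (𝓝[≠] 0) :=
    tendsto_nhdsWithin_iff.2 ⟨tendsto_inv_atTop_zero.comp hc, by
      filter_upwards [hc.eventually_gt_atTop 0] with i hi
      exact inv_ne_zero hi.ne'⟩
  refine (h2.comp h3).congr fun i => ?_
  simp [div_eq_mul_inv]

/-- The substitution is `ψ = s / (b √L)`. The indicator fixes the domain as the half-line, so that
dominated convergence applies. -/
lemma scaled_pairIntegral {L b : ℝ} (hL : 0 < L) (hb : 0 < b) :
    L * (b * √L) * pairIntegral L b = ∫ s in Set.Ioi (0 : ℝ),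
      (Set.Ioc 0 (b * √L * (Real.pi / 2))).indicator
        (fun s => L * pairDensity L (b ^ 2 * Real.sin (s / (b * √L)) ^ 2)) s := by
  have hpi := Real.pi_pos
  have hc : 0 < b * √L := by positivity
  rw [setIntegral_indicator measurableSet_Ioc,
    Set.inter_eq_right.2 Set.Ioc_subset_Ioi_self,
    ← intervalIntegral.integral_of_le (by positivity), intervalIntegral.integral_const_mul,
    intervalIntegral.integral_comp_div (fun ψ => pairDensity L (b ^ 2 * Real.sin ψ ^ 2)) hc.ne',
    zero_div, mul_div_cancel_left₀ _ hc.ne', smul_eq_mul, pairIntegral]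
  ring

/-- Asymptotics of `pairIntegral` for large intensity. -/
theorem tendsto_pairIntegral_atTop :
    Tendsto (fun p : ℝ × ℝ => p.1 * (p.2 * √p.1) * pairIntegral p.1 p.2) (atTop ×ˢ atTop)
      (𝓝 (√Real.pi / 4 * (riemannZeta (3 / 2)).re)) := by
  have hpi := Real.pi_pos
  have hL : Tendsto (fun p : ℝ × ℝ => p.1) (atTop ×ˢ atTop) atTop := tendsto_fst
  have hb : Tendsto (fun p : ℝ × ℝ => p.2) (atTop ×ˢ atTop : Filter (ℝ × ℝ)) atTop := tendsto_snd
  have hc : Tendsto (fun p : ℝ × ℝ => p.2 * √p.1) (atTop ×ˢ atTop) atTop :=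
    hb.atTop_mul_atTop₀ (Real.tendsto_sqrt_atTop.comp hL)
  rw [← integral_sq_div_exp_sq_sub_one]
  have hev : ∀ᶠ p : ℝ × ℝ in atTop ×ˢ atTop, 2 ≤ p.1 ∧ 1 ≤ p.2 :=
    (hL.eventually_ge_atTop 2).and (hb.eventually_ge_atTop 1)
  have hint : Integrable (fun s : ℝ => 1 / (1 + (s / Real.pi) ^ 2)) (volume.restrict (Set.Ioi 0)) := by
    have := (integrable_inv_one_add_sq.comp_div hpi.ne').integrableOn (s := Set.Ioi 0)
    simpa [IntegrableOn] using this
  have key := tendsto_integral_filter_of_dominated_convergence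
    (μ := volume.restrict (Set.Ioi (0 : ℝ))) (l := (atTop ×ˢ atTop : Filter (ℝ × ℝ)))
    (F := fun p s => (Set.Ioc 0 (p.2 * √p.1 * (Real.pi / 2))).indicator
        (fun s => p.1 * pairDensity p.1 (p.2 ^ 2 * Real.sin (s / (p.2 * √p.1)) ^ 2)) s)
    (f := fun s => s ^ 2 / (Real.exp (s ^ 2) - 1)) (fun s => 1 / (1 + (s / Real.pi) ^ 2))
    (Eventually.of_forall fun p => ?_) ?_ hint ?_
  · refine key.congr' ?_
    filter_upwards [hev] with p hp
    rw [scaled_pairIntegral (by linarith [hp.1]) (by linarith [hp.2])]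
  · exact (((measurable_pairDensity p.1).comp (by fun_prop)).const_mul p.1).aestronglyMeasurable.indicator
      measurableSet_Ioc
  · filter_upwards [hev] with p hp
    refine ae_of_all _ fun s => ?_
    have hL0 : 0 < p.1 := by linarith [hp.1]
    have hc0 : 0 < p.2 * √p.1 := mul_pos (by linarith [hp.2]) (Real.sqrt_pos.2 hL0)
    by_cases hs : s ∈ Set.Ioc 0 (p.2 * √p.1 * (Real.pi / 2))
    · rw [Set.indicator_of_mem hs, Real.norm_of_nonneg
        (mul_nonneg hL0.le (pairDensity_nonneg hL0 (by positivity)))]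
      refine (mul_pairDensity_le hp.1 (by positivity)).trans ?_
      have h0 : 0 ≤ s / (p.2 * √p.1) := div_nonneg hs.1.le hc0.le
      -- Jordan's inequality gives `L x ≥ (2s / π)²`, whence the majorant `1 / (1 + (s / π)²)`.
      have h1 := Real.mul_le_sin h0 (by rw [div_le_iff₀ hc0, mul_comm]; exact hs.2)
      have h2 : p.1 * (p.2 ^ 2 * Real.sin (s / (p.2 * √p.1)) ^ 2)
          = (p.2 * √p.1 * Real.sin (s / (p.2 * √p.1))) ^ 2 := by
        rw [mul_pow, mul_pow, Real.sq_sqrt hL0.le]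
        ring
      have h3 : 2 / Real.pi * s ≤ p.2 * √p.1 * Real.sin (s / (p.2 * √p.1)) := by
        have := mul_le_mul_of_nonneg_left h1 hc0.le
        refine le_trans (le_of_eq ?_) this
        rw [← mul_div_assoc, mul_div_cancel₀ _ hc0.ne']
      have h4 : (2 / Real.pi * s) ^ 2 ≤ (p.2 * √p.1 * Real.sin (s / (p.2 * √p.1))) ^ 2 :=
        pow_le_pow_left₀ (mul_nonneg (by positivity) hs.1.le) h3 2
      rw [h2]
      refine one_div_le_one_div_of_le (by positivity) ?_
      have h5 : (s / Real.pi) ^ 2 = (2 / Real.pi * s) ^ 2 / 4 := by ring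
      rw [h5]
      linarith
    · rw [Set.indicator_of_notMem hs, norm_zero]
      positivity
  · refine (ae_restrict_iff' measurableSet_Ioi).2 (ae_of_all _ fun s (hs : 0 < s) => ?_)
    have h1 := (tendsto_mul_sin_div hc s).pow 2
    have h2 : Tendsto (fun p : ℝ × ℝ => p.1 * (p.2 ^ 2 * Real.sin (s / (p.2 * √p.1)) ^ 2))
        (atTop ×ˢ atTop) (𝓝 (s ^ 2)) := by
      refine h1.congr' ?_
      filter_upwards [hev] with p hp
      rw [mul_pow, mul_pow, Real.sq_sqrt (by linarith [hp.1])]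
      ring
    refine (tendsto_mul_pairDensity (by positivity) hL (fun p => by positivity) h2).congr' ?_
    filter_upwards [hc.eventually_ge_atTop (s / (Real.pi / 2))] with p hp
    rw [Set.indicator_of_mem]
    exact ⟨hs, by rwa [div_le_iff₀ (by positivity)] at hp⟩

/-! ### Intensity close to one half -/

/-- After clearing denominators this is `(1 + x)^L ≤ 1 + x`, where `L ≤ 1` enters. -/
lemma rpow_neg_le_pairDensity {L x : ℝ} (hL : 0 < L) (hL1 : L ≤ 1) (hx : 0 < x) :
    (1 + x) ^ (-L) ≤ pairDensity L x := by
  have h1 := rpow_sub_one_pos hL hx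
  have h2 : (1 + x) ^ L ≤ 1 + x := by
    simpa using Real.rpow_le_rpow_of_exponent_le (show 1 ≤ 1 + x by linarith) hL1
  rw [Real.rpow_neg (by linarith), pairDensity, inv_eq_one_div,
    div_le_div_iff₀ (by positivity) (by positivity)]
  nlinarith

/-- With `A = (1 + x)^L` the claim becomes `0 ≤ (1 + x)(A - 2) + A²`. Only `A < 2` needs care: there
`1 + x ≤ A³`, which is the role of `L ≥ 1/3`, reduces it to `A² (A - 1)² ≥ 0`. -/
lemma pairDensity_le_rpow_neg_add {L x : ℝ} (hL : 1 / 3 ≤ L) (hx : 0 ≤ x) :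
    pairDensity L x ≤ (1 + x) ^ (-L) + 2 * (1 + x) ^ (-(2 * L)) := by
  rcases hx.eq_or_lt with rfl | hx0
  · simp [pairDensity]
    norm_num
  have hL0 : 0 < L := by linarith
  have h1 := rpow_sub_one_pos hL0 hx0
  set A := (1 + x) ^ L with hA
  have hA3 : 1 + x ≤ A ^ 3 := by
    rw [hA, ← Real.rpow_natCast _ 3, ← Real.rpow_mul (by linarith)]
    have := Real.rpow_le_rpow_of_exponent_le (show 1 ≤ 1 + x by linarith)
      (show 1 ≤ L * ((3 : ℕ) : ℝ) by push_cast; linarith)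
    rwa [Real.rpow_one] at this
  have hA2 : (1 + x) ^ (2 * L) = A ^ 2 := by
    rw [hA, ← Real.rpow_natCast _ 2, ← Real.rpow_mul (by linarith)]
    congr 1
    push_cast
    ring
  have hA0 : 0 < A := by positivity
  rw [Real.rpow_neg (by linarith), Real.rpow_neg (by linarith), hA2, ← hA, pairDensity, ← hA]
  have key : 0 ≤ (1 + x) * (A - 2) + A ^ 2 := by
    rcases le_total 2 A with h | h
    · nlinarith
    · have h3 : (1 + x) * (2 - A) ≤ A ^ 3 * (2 - A) :=
        mul_le_mul_of_nonneg_right hA3 (by linarith)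
      nlinarith [mul_nonneg (sq_nonneg A) (sq_nonneg (A - 1))]
  have e : A⁻¹ + 2 * (A ^ 2)⁻¹ = (A + 2) / A ^ 2 := by
    field_simp
  rw [e, div_le_div_iff₀ (by positivity) (by positivity)]
  nlinarith

lemma continuous_rpow_sin (b c : ℝ) :
    Continuous fun ψ : ℝ => (1 + b ^ 2 * Real.sin ψ ^ 2) ^ c := by
  refine Continuous.rpow_const (by fun_prop) fun ψ => Or.inl ?_
  positivity

lemma intervalIntegrable_pairDensity {L : ℝ} (hL : 0 < L) (b u v : ℝ) :
    IntervalIntegrable (fun ψ => pairDensity L (b ^ 2 * Real.sin ψ ^ 2)) volume u v := by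
  refine (intervalIntegrable_const (c := 1 / L)).mono_fun
    ((measurable_pairDensity L).comp (by fun_prop)).aestronglyMeasurable (ae_of_all _ fun ψ => ?_)
  simp only
  rw [Real.norm_of_nonneg (pairDensity_nonneg hL (by positivity)),
    Real.norm_of_nonneg (by positivity)]
  exact pairDensity_le hL (by positivity)

lemma rpow_intervalIntegrable_of_one_le {c R S : ℝ} (hR : 1 ≤ R) (hS : 1 ≤ S) :
    IntervalIntegrable (fun t : ℝ => t ^ c) volume R S := by
  refine ContinuousOn.intervalIntegrable fun t ht => ?_
  have : 1 ≤ t := (le_min hR hS).trans ht.1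
  exact (Real.continuousAt_rpow_const t c (Or.inl (by linarith))).continuousWithinAt

/-- From `sin ψ ≤ ψ` and `1 + b²ψ² ≤ (1 + bψ)²`, followed by the substitution `t = 1 + bψ`. -/
lemma integral_rpow_le_pairIntegral {L b : ℝ} (hL : 0 < L) (hL1 : L ≤ 1) (hb : 0 < b) :
    ∫ t in (1 : ℝ)..1 + b * (Real.pi / 2), t ^ (-(2 * L)) ≤ b * pairIntegral L b := by
  have hpi := Real.pi_pos
  have h1 : ∫ t in (1 : ℝ)..1 + b * (Real.pi / 2), t ^ (-(2 * L))
      = b * ∫ ψ in (0 : ℝ)..Real.pi / 2, (1 + b * ψ) ^ (-(2 * L)) := by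
    have := intervalIntegral.smul_integral_comp_add_mul (a := 0) (b := Real.pi / 2)
      (fun t : ℝ => t ^ (-(2 * L))) b 1
    rw [smul_eq_mul, mul_zero, add_zero] at this
    exact this.symm
  rw [h1]
  refine mul_le_mul_of_nonneg_left ?_ hb.le
  have hc : ContinuousOn (fun ψ : ℝ => (1 + b * ψ) ^ (-(2 * L))) (Set.uIcc 0 (Real.pi / 2)) := by
    refine ContinuousOn.rpow_const (by fun_prop) fun ψ hψ => Or.inl ?_
    rw [Set.uIcc_of_le (by positivity)] at hψ
    have := hψ.1
    positivity
  refine intervalIntegral.integral_mono_on_of_le_Ioo (by positivity) hc.intervalIntegrable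
    (intervalIntegrable_pairDensity hL b _ _) fun ψ hψ => ?_
  have hψ0 := hψ.1
  have hs0 : 0 < Real.sin ψ := Real.sin_pos_of_pos_of_lt_pi hψ0 (by linarith [hψ.2])
  have hs1 : Real.sin ψ ≤ ψ := Real.sin_le hψ0.le
  refine le_trans ?_ (rpow_neg_le_pairDensity hL hL1 (by positivity))
  have h2 : (1 + b * ψ) ^ (-(2 * L)) = ((1 + b * ψ) ^ 2) ^ (-L) := by
    rw [← Real.rpow_natCast _ 2, ← Real.rpow_mul (by positivity)]
    congr 1
    push_cast
    ring
  rw [h2]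
  refine Real.rpow_le_rpow_of_nonpos (by positivity) ?_ (by linarith)
  have h3 : b ^ 2 * Real.sin ψ ^ 2 ≤ (b * ψ) ^ 2 := by
    rw [← mul_pow]
    exact pow_le_pow_left₀ (by positivity) (by gcongr) 2
  nlinarith [mul_pos hb hψ0]

lemma integral_one_add_sq_rpow_le {c b : ℝ} (hc : 0 ≤ c) (hb : 1 ≤ b) :
    ∫ u in (0 : ℝ)..b, (1 + u ^ 2) ^ (-c) ≤ 1 + ∫ t in (1 : ℝ)..b, t ^ (-(2 * c)) := by
  have hcont : Continuous fun u : ℝ => (1 + u ^ 2) ^ (-c) :=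
    Continuous.rpow_const (by fun_prop) fun u => Or.inl (by positivity)
  rw [← intervalIntegral.integral_add_adjacent_intervals (hcont.intervalIntegrable 0 1)
    (hcont.intervalIntegrable 1 b)]
  refine add_le_add ?_ ?_
  · have := intervalIntegral.integral_mono_on (zero_le_one (α := ℝ)) (hcont.intervalIntegrable 0 1)
      (intervalIntegrable_const (c := (1 : ℝ)) (μ := volume)) fun u _ =>
      Real.rpow_le_one_of_one_le_of_nonpos (show 1 ≤ 1 + u ^ 2 by nlinarith [sq_nonneg u]) (show -c ≤ 0 by linarith)
    simpa using this
  · refine intervalIntegral.integral_mono_on hb (hcont.intervalIntegrable 1 b)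
      (rpow_intervalIntegrable_of_one_le le_rfl hb) fun u hu => ?_
    have hu0 : 0 < u := by linarith [hu.1]
    have h2 : u ^ (-(2 * c)) = (u ^ 2) ^ (-c) := by
      rw [← Real.rpow_natCast _ 2, ← Real.rpow_mul hu0.le]
      congr 1
      push_cast
      ring
    rw [h2]
    exact Real.rpow_le_rpow_of_nonpos (by positivity) (by linarith) (by linarith)

/-- The substitution `u = b sin ψ` requires the factor `cos ψ`. Inserting it costs `1 - cos ψ ≤ sin²
ψ`, which absorbs the singularity `sin^(-2c) ψ` as `c ≤ 1` and leaves the term in `b^(1 - 2c)`. -/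
lemma integral_rpow_sin_le {c b : ℝ} (hc : 0 ≤ c) (hc1 : c ≤ 1) (hb : 1 ≤ b) :
    b * ∫ ψ in (0 : ℝ)..Real.pi / 2, (1 + b ^ 2 * Real.sin ψ ^ 2) ^ (-c)
      ≤ 1 + (∫ t in (1 : ℝ)..b, t ^ (-(2 * c))) + Real.pi / 2 * b ^ (1 - 2 * c) := by
  have hpi := Real.pi_pos
  have hb0 : 0 < b := by linarith
  have hcont : Continuous fun u : ℝ => (1 + u ^ 2) ^ (-c) :=
    Continuous.rpow_const (by fun_prop) fun u => Or.inl (by positivity)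
  have h1 : ∫ u in (0 : ℝ)..b, (1 + u ^ 2) ^ (-c)
      = ∫ ψ in (0 : ℝ)..Real.pi / 2, (1 + b ^ 2 * Real.sin ψ ^ 2) ^ (-c) * (b * Real.cos ψ) := by
    have h := intervalIntegral.integral_comp_mul_deriv (a := 0) (b := Real.pi / 2)
      (f := fun ψ => b * Real.sin ψ) (f' := fun ψ => b * Real.cos ψ)
      (g := fun u : ℝ => (1 + u ^ 2) ^ (-c))
      (fun ψ _ => (Real.hasDerivAt_sin ψ).const_mul b) (by fun_prop) hcont
    simp only [Function.comp_def, mul_pow, Real.sin_zero, mul_zero, Real.sin_pi_div_two,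
      mul_one] at h
    exact h.symm
  have h2 : b * ∫ ψ in (0 : ℝ)..Real.pi / 2, (1 + b ^ 2 * Real.sin ψ ^ 2) ^ (-c)
      ≤ ∫ ψ in (0 : ℝ)..Real.pi / 2, ((1 + b ^ 2 * Real.sin ψ ^ 2) ^ (-c) * (b * Real.cos ψ)
        + b ^ (1 - 2 * c)) := by
    rw [← intervalIntegral.integral_const_mul]
    have hcs := continuous_rpow_sin b (-c)
    refine intervalIntegral.integral_mono_on_of_le_Ioo (by positivity)
      (Continuous.intervalIntegrable (by fun_prop) _ _)
      (Continuous.intervalIntegrable (by fun_prop) _ _) fun ψ hψ => ?_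
    have hs0 : 0 < Real.sin ψ := Real.sin_pos_of_pos_of_lt_pi hψ.1 (by linarith [hψ.2])
    have hs1 := Real.sin_le_one ψ
    have hc0 : 0 ≤ Real.cos ψ := Real.cos_nonneg_of_neg_pi_div_two_le_of_le (by linarith [hψ.1])
      hψ.2.le
    have h3 : 1 - Real.cos ψ ≤ Real.sin ψ ^ 2 := by
      nlinarith [Real.sin_sq_add_cos_sq ψ, Real.cos_le_one ψ]
    have h4 : (1 + b ^ 2 * Real.sin ψ ^ 2) ^ (-c) ≤ b ^ (-(2 * c)) * Real.sin ψ ^ (-(2 * c)) := by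
      rw [← Real.mul_rpow hb0.le hs0.le,
        show -(2 * c) = ((2 : ℕ) : ℝ) * -c by push_cast; ring, Real.rpow_mul (by positivity),
        Real.rpow_natCast]
      refine Real.rpow_le_rpow_of_nonpos (by positivity) ?_ (by linarith)
      nlinarith
    have h5 : Real.sin ψ ^ (-(2 * c)) * Real.sin ψ ^ 2 ≤ 1 := by
      rw [← Real.rpow_natCast _ 2, ← Real.rpow_add hs0]
      exact Real.rpow_le_one hs0.le hs1 (by push_cast; linarith)
    have h6 : b ^ (1 - 2 * c) = b * b ^ (-(2 * c)) := by
      rw [sub_eq_add_neg, Real.rpow_add hb0, Real.rpow_one]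
    have h7 : (1 + b ^ 2 * Real.sin ψ ^ 2) ^ (-c) * (1 - Real.cos ψ) ≤ b ^ (-(2 * c)) :=
      calc _ ≤ b ^ (-(2 * c)) * Real.sin ψ ^ (-(2 * c)) * Real.sin ψ ^ 2 := by
            gcongr
            linarith [Real.cos_le_one ψ]
        _ = b ^ (-(2 * c)) * (Real.sin ψ ^ (-(2 * c)) * Real.sin ψ ^ 2) := by ring
        _ ≤ b ^ (-(2 * c)) * 1 := by gcongr
        _ = _ := mul_one _
    rw [h6]
    nlinarith
  refine h2.trans ?_
  have hcs := continuous_rpow_sin b (-c)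
  rw [intervalIntegral.integral_add (Continuous.intervalIntegrable (by fun_prop) _ _)
    intervalIntegrable_const, ← h1]
  have := integral_one_add_sq_rpow_le hc hb
  simp only [intervalIntegral.integral_const, smul_eq_mul, sub_zero]
  linarith

lemma integral_one_rpow {c R : ℝ} (hc : c ≠ -1) (hR : 0 < R) :
    ∫ t in (1 : ℝ)..R, t ^ c = (R ^ (c + 1) - 1) / (c + 1) := by
  rw [integral_rpow (Or.inr ⟨hc, fun h => ?_⟩), Real.one_rpow]
  have : 0 < min 1 R := lt_min one_pos hR
  rw [Set.uIcc, Set.mem_Icc] at h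
  exact absurd h.1 (not_le.2 this)

/-- For `L ≥ 3/8` the second-order term is at most `2 (1 + x)^(-3/4)`. Its contribution is bounded
because `t^(-3/2)` is integrable at infinity; `20` is a generous total. -/
lemma pairIntegral_le_integral_rpow {L b : ℝ} (hL : 3 / 8 ≤ L) (hL1 : L ≤ 1) (hb : 1 ≤ b) :
    b * pairIntegral L b ≤ (∫ t in (1 : ℝ)..b, t ^ (-(2 * L))) + (20 + 2 * b ^ (1 - 2 * L)) := by
  have hpi := Real.pi_pos
  have hpi4 : Real.pi / 2 ≤ 2 := by linarith [Real.pi_le_four]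
  have hb0 : 0 < b := by linarith
  have hc1 := continuous_rpow_sin b (-L)
  have hc2 := continuous_rpow_sin b (-(3 / 4))
  have h1 : pairIntegral L b ≤ ∫ ψ in (0 : ℝ)..Real.pi / 2, ((1 + b ^ 2 * Real.sin ψ ^ 2) ^ (-L)
      + 2 * (1 + b ^ 2 * Real.sin ψ ^ 2) ^ (-(3 / 4 : ℝ))) := by
    refine intervalIntegral.integral_mono_on (by positivity)
      (intervalIntegrable_pairDensity (by linarith) b _ _)
      (Continuous.intervalIntegrable (by fun_prop) _ _) fun ψ _ => ?_
    have hx : 0 ≤ b ^ 2 * Real.sin ψ ^ 2 := by positivity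
    refine (pairDensity_le_rpow_neg_add (by linarith) hx).trans ?_
    gcongr
    · linarith
    · linarith
  have h2 := integral_rpow_sin_le (c := L) (by linarith) hL1 hb
  have h3 := integral_rpow_sin_le (c := 3 / 4) (by norm_num) (by norm_num) hb
  rw [integral_one_rpow (by norm_num) hb0] at h3
  have h4 : b ^ (1 - 2 * (3 / 4 : ℝ)) ≤ 1 := Real.rpow_le_one_of_one_le_of_nonpos hb (by norm_num)
  have h5 : 0 ≤ b ^ (-(2 * (3 / 4 : ℝ)) + 1) := by positivity
  have h6 : 0 ≤ b ^ (1 - 2 * L) := by positivity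
  have h7 : b * pairIntegral L b ≤ b * ∫ ψ in (0 : ℝ)..Real.pi / 2,
      ((1 + b ^ 2 * Real.sin ψ ^ 2) ^ (-L)
      + 2 * (1 + b ^ 2 * Real.sin ψ ^ 2) ^ (-(3 / 4 : ℝ))) := by gcongr
  rw [intervalIntegral.integral_add (Continuous.intervalIntegrable (by fun_prop) _ _)
    (Continuous.intervalIntegrable (by fun_prop) _ _), intervalIntegral.integral_const_mul] at h7
  have h8 : (b ^ (-(2 * (3 / 4 : ℝ)) + 1) - 1) / (-(2 * (3 / 4 : ℝ)) + 1) ≤ 2 := by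
    rw [div_le_iff_of_neg (by norm_num)]
    linarith
  nlinarith

/-- The integral `∫ t in 1..R, t ^ (δ - 1)` dominates `1 + R ^ δ` when `δ` is small and `R` is
large. -/
lemma one_add_rpow_le {δ R : ℝ} (hδ : δ ≠ 0) (hR : 1 < R) :
    1 + R ^ δ ≤ 2 * (1 / Real.log R + |δ|) * ((R ^ δ - 1) / δ) := by
  have hl : 0 < Real.log R := Real.log_pos hR
  have hRδ : R ^ δ = Real.exp (δ * Real.log R) := by
    rw [Real.rpow_def_of_pos (by linarith), mul_comm]
  set E := R ^ δ with hE
  have hE0 : 0 < E := by positivity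
  set ℓ := Real.log R
  -- The inequality `exp y ≥ 1 + y` is used at both `δ ℓ` and `-δ ℓ`, which covers both signs of
  -- `δ`.
  have h1 : δ * ℓ + 1 ≤ E := hRδ ▸ Real.add_one_le_exp _
  have h2 : -(δ * ℓ) + 1 ≤ E⁻¹ := by
    rw [hRδ, ← Real.exp_neg]
    exact Real.add_one_le_exp _
  have h2' : (1 - δ * ℓ) * E ≤ 1 := by
    have := mul_le_mul_of_nonneg_right h2 hE0.le
    rw [inv_mul_cancel₀ hE0.ne'] at this
    linarith
  have e : 2 * (1 / ℓ + |δ|) * ((E - 1) / δ) = 2 * ((1 + |δ| * ℓ) * (E - 1)) / (δ * ℓ) := by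
    field_simp
  rw [e]
  rcases lt_or_gt_of_ne hδ with h | h
  · have hy : δ * ℓ < 0 := mul_neg_of_neg_of_pos h hl
    rw [abs_of_neg h, le_div_iff_of_neg hy]
    nlinarith
  · have hy : 0 < δ * ℓ := mul_pos h hl
    rw [abs_of_pos h, le_div_iff₀ hy]
    nlinarith

/-- Asymptotics of `pairIntegral` for intensity close to one half. -/
theorem tendsto_pairIntegral_half {ι : Type*} {l : Filter ι} {L b R : ι → ℝ}
    (hL : Tendsto L l (𝓝 (1 / 2))) (hL2 : ∀ᶠ p in l, L p ≠ 1 / 2)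
    (hb : Tendsto b l atTop)
    (hbR : ∀ᶠ p in l, b p ≤ R p ∧ R p ≤ 1 + b p * (Real.pi / 2)) :
    Tendsto (fun p => b p * pairIntegral (L p) (b p) / ((R p ^ (1 - 2 * L p) - 1) / (1 - 2 * L p))) l
      (𝓝 1) := by
  have hRt : Tendsto R l atTop := tendsto_atTop_mono' l (hbR.mono fun p h => h.1) hb
  have hδ : Tendsto (fun p => |1 - 2 * L p|) l (𝓝 0) := by
    have := ((hL.const_mul 2).const_sub 1).abs
    simpa using this
  have hlog : Tendsto (fun p => 1 / Real.log (R p)) l (𝓝 0) := by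
    simp_rw [one_div]
    exact tendsto_inv_atTop_zero.comp (Real.tendsto_log_atTop.comp hRt)
  -- The error `20 + 2 b^δ` is at most `22 (1 + R^δ)`, and `one_add_rpow_le` makes this negligible
  -- against `(R^δ - 1) / δ` uniformly in `δ`.
  have hup : Tendsto (fun p => 1 + 22 * (2 * (1 / Real.log (R p) + |1 - 2 * L p|))) l
      (𝓝 1) := by
    simpa using (((hlog.add hδ).const_mul 2).const_mul 22).const_add 1
  refine tendsto_of_tendsto_of_tendsto_of_le_of_le' tendsto_const_nhds hup ?_ ?_
  all_goals
    filter_upwards [hL2, hbR, hb.eventually_ge_atTop 2,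
      hL.eventually (Icc_mem_nhds (show (3 / 8 : ℝ) < 1 / 2 by norm_num) one_half_lt_one)]
      with p hp1 hp2 hp3 hp4
    have hR1 : 1 < R p := by linarith [hp2.1]
    have hδ0 : 1 - 2 * L p ≠ 0 := fun h => hp1 (by linarith)
    have hint : ∀ S : ℝ, 0 < S → ∫ t in (1 : ℝ)..S, t ^ (-(2 * L p))
        = (S ^ (1 - 2 * L p) - 1) / (1 - 2 * L p) := by
      intro S hS
      rw [integral_one_rpow (fun h => hp1 (by linarith)) hS, neg_add_eq_sub]
    have hmono : ∀ S S' : ℝ, 1 ≤ S → S ≤ S' → ∫ t in (1 : ℝ)..S, t ^ (-(2 * L p))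
        ≤ ∫ t in (1 : ℝ)..S', t ^ (-(2 * L p)) := by
      intro S S' hS hSS
      rw [← sub_nonneg, intervalIntegral.integral_interval_sub_left
        (rpow_intervalIntegrable_of_one_le le_rfl (hS.trans hSS))
        (rpow_intervalIntegrable_of_one_le le_rfl hS)]
      exact intervalIntegral.integral_nonneg hSS fun t ht =>
        Real.rpow_nonneg (by linarith [ht.1]) _
    have hT := one_add_rpow_le hδ0 hR1
    have hT0 : 0 < (R p ^ (1 - 2 * L p) - 1) / (1 - 2 * L p) := by
      have h1 : 0 < R p ^ (1 - 2 * L p) := by positivity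
      have h2 : 0 < 1 / Real.log (R p) := one_div_pos.2 (Real.log_pos hR1)
      have h3 := abs_nonneg (1 - 2 * L p)
      by_contra h
      push Not at h
      nlinarith
  · rw [le_div_iff₀ hT0, one_mul]
    have h1 := integral_rpow_le_pairIntegral (L := L p) (b := b p) (by linarith [hp4.1]) hp4.2
      (by linarith)
    refine le_trans ?_ h1
    rw [← hint _ (by linarith)]
    exact hmono _ _ hR1.le hp2.2
  · rw [div_le_iff₀ hT0]
    have h1 := pairIntegral_le_integral_rpow (L := L p) (b := b p) hp4.1 hp4.2 (by linarith)
    have h2 := hmono (b p) (R p) (by linarith) hp2.1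
    rw [hint (R p) (by linarith)] at h2
    have h3 : b p ^ (1 - 2 * L p) ≤ 1 + R p ^ (1 - 2 * L p) := by
      rcases le_total 0 (1 - 2 * L p) with h | h
      · have := Real.rpow_le_rpow (by linarith) hp2.1 h
        linarith
      · have := Real.rpow_le_one_of_one_le_of_nonpos (show 1 ≤ b p by linarith) h
        have h4 : 0 ≤ R p ^ (1 - 2 * L p) := by positivity
        linarith
    have h4 : 0 ≤ R p ^ (1 - 2 * L p) := by positivity
    nlinarith

/-! ### Small intensity -/

/-- With `y = L log B` and `z = L (log A - log B)`, the left side is `exp y / (exp y - 1) · |exp z -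
1|`, at most `(1 + 1/y) · 2LK`. The factor `L` cancels against `1/y`, so the bound is small without
any relation between `L` and `B`. -/
lemma abs_rpow_sub_one_div_sub_one_le {L A B K : ℝ} (hL : 0 < L) (hA : 0 < A) (hB : 1 < B)
    (hK : |Real.log A - Real.log B| ≤ K) (hLK : L * K ≤ 1) :
    |(A ^ L - 1) / (B ^ L - 1) - 1| ≤ 2 * K * (L + 1 / Real.log B) := by
  have hl : 0 < Real.log B := Real.log_pos hB
  have hK0 : 0 ≤ K := (abs_nonneg _).trans hK
  set y := L * Real.log B with hy
  set z := L * (Real.log A - Real.log B) with hz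
  have hy0 : 0 < y := by positivity
  have hz1 : |z| ≤ L * K := by
    rw [hz, abs_mul, abs_of_pos hL]
    exact mul_le_mul_of_nonneg_left hK hL.le
  have eB : B ^ L = Real.exp y := by
    rw [Real.rpow_def_of_pos (by linarith), mul_comm]
  have eA : A ^ L = Real.exp y * Real.exp z := by
    rw [Real.rpow_def_of_pos hA, ← Real.exp_add]
    congr 1
    rw [hy, hz]
    ring
  have hE : 0 < Real.exp y - 1 := by linarith [Real.add_one_le_exp y]
  have e1 : (A ^ L - 1) / (B ^ L - 1) - 1
      = Real.exp y / (Real.exp y - 1) * (Real.exp z - 1) := by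
    rw [eA, eB]
    field_simp
    ring
  have h1 : Real.exp y / (Real.exp y - 1) ≤ 1 + 1 / y := by
    rw [div_le_iff₀ hE]
    have e2 : (1 + 1 / y) * (Real.exp y - 1) - Real.exp y = (Real.exp y - 1 - y) / y := by
      field_simp
      ring
    have h2 : 0 ≤ (Real.exp y - 1 - y) / y :=
      div_nonneg (by linarith [Real.add_one_le_exp y]) hy0.le
    linarith
  have h3 := Real.abs_exp_sub_one_le (hz1.trans hLK)
  rw [e1, abs_mul, abs_of_nonneg (by positivity)]
  calc Real.exp y / (Real.exp y - 1) * |Real.exp z - 1| ≤ (1 + 1 / y) * (2 * (L * K)) := by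
        gcongr
        linarith
    _ = 2 * K * (L + 1 / Real.log B) := by
        rw [hy]
        field_simp

lemma tendsto_rpow_sub_one_div_sub_one {ι : Type*} {l : Filter ι} {L A B : ι → ℝ} {K : ℝ}
    (hL : Tendsto L l (𝓝[>] 0)) (hA : ∀ᶠ i in l, 0 < A i) (hB : Tendsto B l atTop)
    (hK : ∀ᶠ i in l, |Real.log (A i) - Real.log (B i)| ≤ K) :
    Tendsto (fun i => (A i ^ L i - 1) / (B i ^ L i - 1)) l (𝓝 1) := by
  have hL' : Tendsto L l (𝓝 0) := hL.mono_right nhdsWithin_le_nhds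
  have hL0 : ∀ᶠ i in l, 0 < L i := hL.eventually self_mem_nhdsWithin
  have hlog : Tendsto (fun i => 1 / Real.log (B i)) l (𝓝 0) := by
    simp_rw [one_div]
    exact tendsto_inv_atTop_zero.comp (Real.tendsto_log_atTop.comp hB)
  have hLK : ∀ᶠ i in l, L i * K ≤ 1 := by
    have h : Tendsto (fun i => L i * K) l (𝓝 0) := by simpa using hL'.mul_const K
    exact (h.eventually (gt_mem_nhds one_pos)).mono fun i hi => hi.le
  rw [tendsto_iff_norm_sub_tendsto_zero]
  have hlim : Tendsto (fun i => 2 * K * (L i + 1 / Real.log (B i))) l (𝓝 0) := by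
    simpa using (hL'.add hlog).const_mul (2 * K)
  refine squeeze_zero' (Eventually.of_forall fun _ => norm_nonneg _) ?_ hlim
  filter_upwards [hL0, hA, hB.eventually_gt_atTop 1, hK, hLK] with i h1 h2 h3 h4 h5
  exact abs_rpow_sub_one_div_sub_one_le h1 h2 h3 h4 h5

/-- A majorant independent of `L` and `b`. Since `b² ≤ (1 + x) s^(-2)`, with `U = s^(-2L)` the
prefactor is at most `U ((1 + x)^L - 1) + (U - 1)`. The first summand cancels the denominator of the
density; for the second, `U - 1 ≤ 2 L U |log s|` compensates the bound `1 / L`. -/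
lemma mul_pairDensity_le_rpow {L b s : ℝ} (hL : 0 < L) (hL1 : L ≤ 1 / 8) (hb : 0 < b)
    (hs : 0 < s) (hs1 : s ≤ 1) :
    ((b ^ 2) ^ L - 1) * pairDensity L (b ^ 2 * s ^ 2) ≤ 9 * s ^ (-(1 / 2) : ℝ) := by
  set x := b ^ 2 * s ^ 2 with hx
  have hx0 : 0 < x := by positivity
  have hA := rpow_sub_one_pos hL hx0
  set U := s ^ (-(2 * L)) with hU
  have hU1 : 1 ≤ U := Real.one_le_rpow_of_pos_of_le_one_of_nonpos hs hs1 (by linarith)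
  have h1 : (b ^ 2) ^ L ≤ (1 + x) ^ L * U := by
    have e : U = ((s ^ 2)⁻¹) ^ L := by
      rw [hU, ← Real.rpow_natCast _ 2, ← Real.rpow_neg hs.le, ← Real.rpow_mul hs.le]
      congr 1
      push_cast
      ring
    rw [e, ← Real.mul_rpow (by positivity) (by positivity)]
    refine Real.rpow_le_rpow (by positivity) ?_ hL.le
    rw [← div_eq_mul_inv, le_div_iff₀ (by positivity)]
    linarith
  have h2 : ((1 + x) ^ L - 1) * pairDensity L x ≤ 1 := by
    have e : ((1 + x) ^ L - 1) * pairDensity L x = x / (1 + x) := by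
      rw [pairDensity]
      field_simp
    rw [e, div_le_one (by positivity)]
    linarith
  have h3 := pairDensity_le hL hx0.le
  have h0 := pairDensity_nonneg hL hx0.le
  set v := s ^ (-(1 / 4) : ℝ) with hv
  have hv1 : 1 ≤ v := Real.one_le_rpow_of_pos_of_le_one_of_nonpos hs hs1 (by norm_num)
  have hUv : U ≤ v := Real.rpow_le_rpow_of_exponent_ge hs hs1 (by linarith)
  have hlogv : -Real.log s ≤ 4 * v := by
    have := Real.log_le_rpow_div (inv_nonneg.2 hs.le) (show (0 : ℝ) < 1 / 4 by norm_num)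
    rw [Real.log_inv, Real.inv_rpow hs.le, ← Real.rpow_neg hs.le, ← hv] at this
    linarith
  have hUlog : U - 1 ≤ U * (L * (-2 * Real.log s)) := by
    have e : U = Real.exp (L * (-2 * Real.log s)) := by
      rw [hU, Real.rpow_def_of_pos hs]
      congr 1
      ring
    have h4 := Real.add_one_le_exp (-(L * (-2 * Real.log s)))
    have h5 : Real.exp (L * (-2 * Real.log s)) * Real.exp (-(L * (-2 * Real.log s))) = 1 := by
      rw [← Real.exp_add, add_neg_cancel, Real.exp_zero]
    have h6 := mul_le_mul_of_nonneg_left h4 (Real.exp_pos (L * (-2 * Real.log s))).le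
    rw [h5, ← e] at h6
    linarith
  have hvv : v * v = s ^ (-(1 / 2) : ℝ) := by
    rw [hv, ← Real.rpow_add hs]
    norm_num
  have h7 : (U - 1) * pairDensity L x ≤ v * (8 * v) := by
    calc (U - 1) * pairDensity L x ≤ U * (L * (-2 * Real.log s)) * (1 / L) := by
          refine mul_le_mul hUlog h3 h0 (le_trans ?_ hUlog)
          linarith
      _ = U * (-2 * Real.log s) := by field_simp
      _ ≤ v * (8 * v) := by
          refine mul_le_mul hUv (by linarith) ?_ (by linarith)
          linarith [Real.log_nonpos hs.le hs1]
  have h8 : U * (((1 + x) ^ L - 1) * pairDensity L x) ≤ v * 1 :=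
    mul_le_mul hUv h2 (by positivity) (by linarith)
  calc ((b ^ 2) ^ L - 1) * pairDensity L x ≤ ((1 + x) ^ L * U - 1) * pairDensity L x := by gcongr
    _ = U * (((1 + x) ^ L - 1) * pairDensity L x) + (U - 1) * pairDensity L x := by ring
    _ ≤ v * 1 + v * (8 * v) := by linarith
    _ ≤ 9 * (v * v) := by nlinarith
    _ = _ := by rw [hvv]

/-- For fixed `s`, the logarithms of `b²` and `1 + b² s²` differ by a bounded amount, so `(b²)^L -
1` and `(1 + x)^L - 1` are asymptotically equal. -/
lemma tendsto_mul_pairDensity_sin {ι : Type*} {l : Filter ι} {L b : ι → ℝ}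
    (hL : Tendsto L l (𝓝[>] 0)) (hb : Tendsto b l atTop) {s : ℝ}
    (hs : 0 < s) (hs1 : s ≤ 1) :
    Tendsto (fun p => ((b p ^ 2) ^ L p - 1) * pairDensity (L p) (b p ^ 2 * s ^ 2)) l (𝓝 1) := by
  have hx : Tendsto (fun p => b p ^ 2 * s ^ 2) l atTop :=
    ((tendsto_pow_atTop two_ne_zero).comp hb).atTop_mul_const (by positivity)
  have h1x : Tendsto (fun p => 1 + b p ^ 2 * s ^ 2) l atTop :=
    tendsto_atTop_add_const_left _ _ hx
  have h1 : Tendsto (fun p => 1 - (1 + b p ^ 2 * s ^ 2)⁻¹) l (𝓝 1) := by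
    simpa using (tendsto_inv_atTop_zero.comp h1x).const_sub 1
  have h2 := tendsto_rpow_sub_one_div_sub_one (A := fun p => b p ^ 2)
    (B := fun p => 1 + b p ^ 2 * s ^ 2) (K := Real.log 2 + |Real.log (s ^ 2)|) hL
    ((hb.eventually_gt_atTop 0).mono fun p hp => by positivity) h1x (by
      filter_upwards [hb.eventually_ge_atTop 1] with p hp
      have hp0 : 0 < b p := by linarith
      have hs2 : s ^ 2 ≤ 1 := pow_le_one₀ hs.le hs1
      have hp2 : 1 ≤ b p ^ 2 := one_le_pow₀ hp
      have e1 : Real.log (b p ^ 2 * s ^ 2) ≤ Real.log (1 + b p ^ 2 * s ^ 2) :=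
        Real.log_le_log (by positivity) (by linarith)
      have e2 : Real.log (1 + b p ^ 2 * s ^ 2) ≤ Real.log (2 * b p ^ 2) :=
        Real.log_le_log (by positivity) (by nlinarith)
      rw [Real.log_mul (by positivity) (by positivity)] at e1 e2
      have e3 := neg_abs_le (Real.log (s ^ 2))
      have e4 := abs_nonneg (Real.log (s ^ 2))
      have e5 := Real.log_pos one_lt_two
      rw [abs_le]
      constructor <;> linarith)
  have h3 := h1.mul h2
  rw [one_mul] at h3
  refine h3.congr fun p => ?_
  have hx0 : 0 < 1 + b p ^ 2 * s ^ 2 := by positivity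
  have e : 1 - (1 + b p ^ 2 * s ^ 2)⁻¹ = b p ^ 2 * s ^ 2 / (1 + b p ^ 2 * s ^ 2) := by
    field_simp
    ring
  rw [e, pairDensity, div_mul_div_comm, ← mul_div_assoc]
  congr 1
  ring

/-- Asymptotics of `pairIntegral` for small intensity. -/
theorem tendsto_pairIntegral_zero {ι : Type*} {l : Filter ι} [l.IsCountablyGenerated]
    {L b R : ι → ℝ}
    (hL : Tendsto L l (𝓝[>] 0)) (hb : Tendsto b l atTop)
    (hbR : ∀ᶠ p in l, b p ≤ R p ∧ R p ≤ 2 * b p) :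
    Tendsto (fun p => (R p ^ (2 * L p) - 1) * pairIntegral (L p) (b p)) l (𝓝 (Real.pi / 2)) := by
  have hpi := Real.pi_pos
  have hL0 : ∀ᶠ p in l, 0 < L p := hL.eventually self_mem_nhdsWithin
  have hL1 : ∀ᶠ p in l, L p ≤ 1 / 8 := by
    have h : Tendsto L l (𝓝 0) := hL.mono_right nhdsWithin_le_nhds
    exact (h.eventually (gt_mem_nhds (by norm_num : (0 : ℝ) < 1 / 8))).mono fun p hp => hp.le
  have hint : IntervalIntegrable (fun ψ : ℝ => 9 * (2 / Real.pi * ψ) ^ (-(1 / 2) : ℝ)) volume 0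
      (Real.pi / 2) := by
    have h1 : IntervalIntegrable (fun ψ : ℝ => ψ ^ (-(1 / 2) : ℝ)) volume 0 (Real.pi / 2) :=
      intervalIntegral.intervalIntegrable_rpow' (by norm_num)
    refine (h1.const_mul (9 * (2 / Real.pi) ^ (-(1 / 2) : ℝ))).congr fun ψ hψ => ?_
    rw [Set.uIoc_of_le (by positivity)] at hψ
    rw [Real.mul_rpow (by positivity) hψ.1.le, mul_assoc]
  have hmain : Tendsto (fun p => ((b p ^ 2) ^ L p - 1) * pairIntegral (L p) (b p)) l
      (𝓝 (Real.pi / 2)) := by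
    -- The integrand tends to `1`; Jordan's inequality converts the majorant `9 (sin ψ)^(-1/2)` into
    -- an integrable power of `ψ`.
    have key := intervalIntegral.tendsto_integral_filter_of_dominated_convergence (a := 0)
      (b := Real.pi / 2) (μ := volume) (l := l)
      (F := fun p ψ =>
        ((b p ^ 2) ^ L p - 1) * pairDensity (L p) (b p ^ 2 * Real.sin ψ ^ 2))
      (f := fun _ => (1 : ℝ)) (fun ψ : ℝ => 9 * (2 / Real.pi * ψ) ^ (-(1 / 2) : ℝ))
      (Eventually.of_forall fun p => (((measurable_pairDensity (L p)).comp
        (by fun_prop)).const_mul _).aestronglyMeasurable) ?_ hint ?_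
    · simp only [intervalIntegral.integral_const_mul, intervalIntegral.integral_const, sub_zero,
        smul_eq_mul, mul_one] at key
      exact key
    · filter_upwards [hL0, hL1, hb.eventually_ge_atTop 1] with p h1 h2 h3
      refine ae_of_all _ fun ψ hψ => ?_
      rw [Set.uIoc_of_le (by positivity)] at hψ
      have hp2 : 1 ≤ (b p ^ 2) ^ L p := Real.one_le_rpow (one_le_pow₀ h3) h1.le
      have hs0 : 0 < Real.sin ψ := Real.sin_pos_of_pos_of_lt_pi hψ.1 (by linarith [hψ.2])
      rw [Real.norm_of_nonneg (mul_nonneg (by linarith) (pairDensity_nonneg h1 (by positivity)))]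
      refine (mul_pairDensity_le_rpow h1 h2 (by linarith) hs0 (Real.sin_le_one ψ)).trans ?_
      have h4 := Real.mul_le_sin hψ.1.le hψ.2
      have h5 : 0 < 2 / Real.pi * ψ := mul_pos (by positivity) hψ.1
      exact mul_le_mul_of_nonneg_left (Real.rpow_le_rpow_of_nonpos h5 h4 (by norm_num))
        (by norm_num)
    · refine ae_of_all _ fun ψ hψ => ?_
      rw [Set.uIoc_of_le (by positivity)] at hψ
      have hs0 : 0 < Real.sin ψ := Real.sin_pos_of_pos_of_lt_pi hψ.1 (by linarith [hψ.2])
      exact tendsto_mul_pairDensity_sin hL hb hs0 (Real.sin_le_one ψ)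
  -- Replacing `b` by `R` changes the logarithm of the square by at most `2 log 2`.
  have hratio := tendsto_rpow_sub_one_div_sub_one (A := fun p => R p ^ 2)
    (B := fun p => b p ^ 2) (K := 2 * Real.log 2) hL
    (by
      filter_upwards [hbR, hb.eventually_gt_atTop 0] with p h1 h2
      have : 0 < R p := h2.trans_le h1.1
      positivity)
    ((tendsto_pow_atTop two_ne_zero).comp hb) (by
      filter_upwards [hbR, hb.eventually_gt_atTop 0] with p h1 h2
      have hR : 0 < R p := h2.trans_le h1.1
      rw [Real.log_pow, Real.log_pow]
      have e1 := Real.log_le_log h2 h1.1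
      have e2 := Real.log_le_log hR h1.2
      rw [Real.log_mul two_ne_zero h2.ne'] at e2
      have e3 := Real.log_pos one_lt_two
      push_cast
      rw [abs_le]
      constructor <;> linarith)
  have h := hratio.mul hmain
  rw [one_mul] at h
  refine h.congr' ?_
  filter_upwards [hbR, hL0, hb.eventually_gt_atTop 1] with p h1 h2 h3
  have h4 : (1 : ℝ) < (b p ^ 2) ^ L p :=
    Real.one_lt_rpow (one_lt_pow₀ h3 two_ne_zero) h2
  have hR : 0 ≤ R p := by linarith [h1.1]
  have e : R p ^ (2 * L p) = (R p ^ 2) ^ L p := by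
    rw [← Real.rpow_natCast _ 2, ← Real.rpow_mul hR]
    norm_num
  have h5 : (b p ^ 2) ^ L p - 1 ≠ 0 := by linarith
  rw [e]
  field_simp

section

/-! ### Asymptotics of the variance -/

/-- The parameter of `varianceIntegral` in terms of the radius. -/
def scale (r : ℝ) : ℝ := 2 * r / (1 - r ^ 2)

lemma scale_eq {r : ℝ} (hr : 0 < r) (hr1 : r < 1) : scale r = 2 * r / (1 + r) * (1 / (1 - r)) := by
  have h1 : 1 - r ≠ 0 := by linarith
  have h2 : 1 + r ≠ 0 := by linarith
  have h3 : 1 - r ^ 2 ≠ 0 := by nlinarith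
  rw [scale]
  field_simp
  ring

/-- These are the comparisons that `tendsto_pairIntegral_half` and `tendsto_pairIntegral_zero`
require of `R = 1 / (1 - r)`. The last one uses `1 + r ≤ π`. -/
lemma scale_bounds {r : ℝ} (hr : 1 / 2 < r) (hr1 : r < 1) :
    scale r ≤ 1 / (1 - r) ∧ 1 / (1 - r) ≤ 2 * scale r ∧
      1 / (1 - r) ≤ 1 + scale r * (Real.pi / 2) := by
  have hpi := Real.pi_gt_three
  have h1 : 0 < 1 - r := by linarith
  have h2 : 0 < 1 + r := by linarith
  rw [scale_eq (by linarith) hr1]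
  refine ⟨?_, ?_, ?_⟩
  · have : 2 * r / (1 + r) ≤ 1 := by
      rw [div_le_one h2]
      linarith
    exact mul_le_of_le_one_left (by positivity) this
  · have : 1 ≤ 2 * (2 * r / (1 + r)) := by
      rw [← mul_div_assoc, le_div_iff₀ h2]
      linarith
    rw [← mul_assoc]
    exact le_mul_of_one_le_left (by positivity) this
  · have e : 1 + 2 * r / (1 + r) * (1 / (1 - r)) * (Real.pi / 2)
        = ((1 - r) * (1 + r) + r * Real.pi) / ((1 + r) * (1 - r)) := by
      field_simp
    rw [e, div_le_div_iff₀ h1 (by positivity)]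
    nlinarith [mul_nonneg h1.le (mul_nonneg (show 0 ≤ r by linarith)
      (show 0 ≤ Real.pi - 1 - r by linarith))]

lemma tendsto_scale_mul : Tendsto (fun r => scale r * (1 - r)) (𝓝[<] 1) (𝓝 1) := by
  have h : Tendsto (fun r : ℝ => 2 * r / (1 + r)) (𝓝[<] 1) (𝓝 1) := by
    have : ContinuousAt (fun r : ℝ => 2 * r / (1 + r)) 1 := by
      refine ContinuousAt.div (by fun_prop) (by fun_prop) (by norm_num)
    have h1 := this.tendsto
    norm_num at h1
    exact h1.mono_left nhdsWithin_le_nhds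
  refine h.congr' ?_
  filter_upwards [Ioo_mem_nhdsLT (show (1 / 2 : ℝ) < 1 by norm_num)] with r hr
  have h1 : 1 - r ≠ 0 := by linarith [hr.2]
  rw [scale_eq (by linarith [hr.1]) hr.2, mul_assoc, one_div_mul_cancel h1, mul_one]

lemma tendsto_scale_atTop : Tendsto scale (𝓝[<] 1) atTop := by
  have h1 : Tendsto (fun r : ℝ => 1 - r) (𝓝[<] 1) (𝓝[>] 0) := by
    refine tendsto_nhdsWithin_iff.2 ⟨?_, ?_⟩
    · have : Tendsto (fun r : ℝ => 1 - r) (𝓝 1) (𝓝 (1 - 1)) := by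
        exact (continuous_const.sub continuous_id).tendsto 1
      rw [sub_self] at this
      exact this.mono_left nhdsWithin_le_nhds
    · filter_upwards [self_mem_nhdsWithin] with r (hr : r < 1)
      exact sub_pos.2 hr
  have h2 := tendsto_inv_nhdsGT_zero.comp h1
  refine (h2.atTop_mul_pos one_pos tendsto_scale_mul).congr' ?_
  filter_upwards [self_mem_nhdsWithin] with r (hr : r < 1)
  have h3 : 1 - r ≠ 0 := by linarith
  simp only [Function.comp_apply]
  field_simp

lemma isEquivalent_of_div {ι : Type*} {l : Filter ι} {u v : ι → ℝ} {f : ι → ℝ}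
    (hf : Tendsto f l (𝓝 1)) (h : ∀ᶠ i in l, u i = f i * v i) : u ~[l] v := by
  rw [isEquivalent_iff_exists_eq_mul]
  exact ⟨f, hf, h⟩

section

variable {l : Filter ℝ}

lemma eventually_snd_mem : ∀ᶠ p : ℝ × ℝ in l ×ˢ 𝓝[<] (1 : ℝ), 1 / 2 < p.2 ∧ p.2 < 1 :=
  tendsto_snd.eventually (Ioo_mem_nhdsLT (show (1 / 2 : ℝ) < 1 by norm_num))

lemma tendsto_scale_snd : Tendsto (fun p : ℝ × ℝ => scale p.2) (l ×ˢ 𝓝[<] (1 : ℝ)) atTop :=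
  tendsto_scale_atTop.comp tendsto_snd

lemma tendsto_scale_mul_snd :
    Tendsto (fun p : ℝ × ℝ => scale p.2 * (1 - p.2)) (l ×ˢ 𝓝[<] (1 : ℝ)) (𝓝 1) :=
  tendsto_scale_mul.comp tendsto_snd

end

theorem tendsto_varianceIntegral_atTop :
    Tendsto (fun p : ℝ × ℝ => (1 - p.2) / √p.1 * varianceIntegral p.1 (scale p.2))
      (atTop ×ˢ 𝓝[<] (1 : ℝ)) (𝓝 ((riemannZeta (3 / 2)).re / (8 * √Real.pi))) := by
  have hpi := Real.pi_pos
  have h1 : Tendsto (fun p : ℝ × ℝ => (p.1, scale p.2)) (atTop ×ˢ 𝓝[<] (1 : ℝ))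
      (atTop ×ˢ atTop) := tendsto_fst.prodMk tendsto_scale_snd
  have h2 := ((tendsto_pairIntegral_atTop.comp h1).mul tendsto_scale_mul_snd).mul_const
    (1 / (2 * Real.pi))
  have e : √Real.pi / 4 * (riemannZeta (3 / 2)).re * 1 * (1 / (2 * Real.pi))
      = (riemannZeta (3 / 2)).re / (8 * √Real.pi) := by
    have h3 : Real.pi = √Real.pi * √Real.pi := (Real.mul_self_sqrt hpi.le).symm
    have h4 : √Real.pi ≠ 0 := by positivity
    rw [show (1 / (2 * Real.pi) : ℝ) = 1 / (2 * (√Real.pi * √Real.pi)) by rw [← h3]]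
    field_simp
    ring
  rw [e] at h2
  refine h2.congr' ?_
  filter_upwards [tendsto_fst.eventually (eventually_gt_atTop 0)] with p hp
  have h3 : √p.1 ≠ 0 := (Real.sqrt_pos.2 hp).ne'
  have h4 : p.1 = √p.1 * √p.1 := (Real.mul_self_sqrt hp.le).symm
  simp only [Function.comp_apply]
  rw [varianceIntegral_eq]
  obtain ⟨q, hq⟩ : ∃ q, q = pairIntegral p.1 (scale p.2) := ⟨_, rfl⟩
  rw [← hq, show p.1 ^ 2 = p.1 * (√p.1 * √p.1) by rw [← h4]; ring]
  field_simp

theorem isEquivalent_varianceIntegral_atTop :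
    (fun p : ℝ × ℝ => varianceIntegral p.1 (scale p.2)) ~[atTop ×ˢ 𝓝[<] (1 : ℝ)]
      (fun p : ℝ × ℝ => (riemannZeta (3 / 2)).re / (8 * √Real.pi) * (√p.1 / (1 - p.2))) := by
  have hc : (riemannZeta (3 / 2)).re / (8 * √Real.pi) ≠ 0 :=
    (div_pos zeta_three_halves_re_pos (by have := Real.pi_pos; positivity)).ne'
  have h := tendsto_varianceIntegral_atTop.mul_const
    ((riemannZeta (3 / 2)).re / (8 * √Real.pi))⁻¹
  rw [mul_inv_cancel₀ hc] at h
  refine isEquivalent_of_div h ?_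
  filter_upwards [eventually_snd_mem, tendsto_fst.eventually (eventually_gt_atTop 0)] with p hp hp0
  have h3 : √p.1 ≠ 0 := (Real.sqrt_pos.2 hp0).ne'
  have h4 : 1 - p.2 ≠ 0 := by linarith [hp.2]
  obtain ⟨c, hc'⟩ : ∃ c, c = (riemannZeta (3 / 2)).re / (8 * √Real.pi) := ⟨_, rfl⟩
  rw [← hc'] at hc ⊢
  field_simp

/-- In the form `(R^δ - 1) / δ` with `δ = 1 - 2L` the main term is the same on both sides of `1/2`;
the two one-sided statements differ from it only by algebra. -/
theorem isEquivalent_varianceIntegral_half {l : Filter ℝ} (hl : l ≤ 𝓝 (1 / 2))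
    (hl2 : ∀ᶠ L in l, L ≠ 1 / 2) :
    (fun p : ℝ × ℝ => varianceIntegral p.1 (scale p.2)) ~[l ×ˢ 𝓝[<] (1 : ℝ)]
      (fun p : ℝ × ℝ => 1 / (8 * Real.pi) * ((1 / (1 - p.2)) *
        (((1 / (1 - p.2)) ^ (1 - 2 * p.1) - 1) / (1 - 2 * p.1)))) := by
  have hpi := Real.pi_pos
  have hL : Tendsto (fun p : ℝ × ℝ => p.1) (l ×ˢ 𝓝[<] (1 : ℝ)) (𝓝 (1 / 2)) := tendsto_fst.mono_right hl
  have h1 := tendsto_pairIntegral_half (b := fun p : ℝ × ℝ => scale p.2)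
    (R := fun p : ℝ × ℝ => 1 / (1 - p.2)) hL (tendsto_fst.eventually hl2) tendsto_scale_snd
    (eventually_snd_mem.mono fun p hp =>
      ⟨(scale_bounds hp.1 hp.2).1, (scale_bounds hp.1 hp.2).2.2⟩)
  have h2 := (((hL.pow 2).const_mul 4).mul (tendsto_scale_mul_snd (l := l))).mul h1
  norm_num at h2
  refine isEquivalent_of_div h2 ?_
  filter_upwards [eventually_snd_mem, tendsto_fst.eventually hl2] with p hp hp1
  have h3 : 1 - p.2 ≠ 0 := by linarith [hp.2]
  have h4 : 0 < 1 - 2 * p.1 ∨ 1 - 2 * p.1 < 0 := by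
    rcases lt_or_gt_of_ne hp1 with h | h
    · left; linarith
    · right; linarith
  have hR : 1 < 1 / (1 - p.2) := by
    rw [lt_div_iff₀ (by linarith [hp.2])]
    linarith [hp.1]
  have h5 : (1 / (1 - p.2)) ^ (1 - 2 * p.1) - 1 ≠ 0 := by
    rw [sub_ne_zero]
    rcases h4 with h | h
    · exact (Real.one_lt_rpow hR h).ne'
    · exact (Real.rpow_lt_one_of_one_lt_of_neg hR h).ne
  have h6 : 1 - 2 * p.1 ≠ 0 := by rcases h4 with h | h <;> linarith
  rw [varianceIntegral_eq]
  obtain ⟨q, hq⟩ : ∃ q, q = (1 / (1 - p.2)) ^ (1 - 2 * p.1) - 1 := ⟨_, rfl⟩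
  simp only [one_div] at hq h5 ⊢
  rw [← hq] at h5 ⊢
  obtain ⟨δ, hδ⟩ : ∃ δ, δ = 1 - 2 * p.1 := ⟨_, rfl⟩
  rw [← hδ] at h6 ⊢
  field_simp
  ring

theorem isEquivalent_varianceIntegral_zero :
    (fun p : ℝ × ℝ => varianceIntegral p.1 (scale p.2)) ~[𝓝[>] (0 : ℝ) ×ˢ 𝓝[<] (1 : ℝ)]
      (fun p : ℝ × ℝ => p.1 ^ 2 / 4 *
        ((1 / (1 - p.2)) ^ 2 / ((1 / (1 - p.2)) ^ (2 * p.1) - 1))) := by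
  have hpi := Real.pi_pos
  have h1 := tendsto_pairIntegral_zero (l := 𝓝[>] (0 : ℝ) ×ˢ 𝓝[<] (1 : ℝ))
    (b := fun p : ℝ × ℝ => scale p.2) (R := fun p : ℝ × ℝ => 1 / (1 - p.2)) tendsto_fst
    tendsto_scale_snd
    (eventually_snd_mem.mono fun p hp =>
      ⟨(scale_bounds hp.1 hp.2).1, (scale_bounds hp.1 hp.2).2.1⟩)
  have h2 := ((tendsto_scale_mul_snd (l := 𝓝[>] (0 : ℝ))).pow 2).mul (h1.const_mul (2 / Real.pi))
  rw [show (1 : ℝ) ^ 2 * (2 / Real.pi * (Real.pi / 2)) = 1 by field_simp] at h2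
  refine isEquivalent_of_div h2 ?_
  filter_upwards [eventually_snd_mem, tendsto_fst.eventually self_mem_nhdsWithin]
    with p hp (hp1 : 0 < p.1)
  have h3 : 1 - p.2 ≠ 0 := by linarith [hp.2]
  have hR : 1 < 1 / (1 - p.2) := by
    rw [lt_div_iff₀ (by linarith [hp.2])]
    linarith [hp.1]
  have h5 : (1 / (1 - p.2)) ^ (2 * p.1) - 1 ≠ 0 := by
    rw [sub_ne_zero]
    exact (Real.one_lt_rpow hR (by linarith)).ne'
  rw [varianceIntegral_eq]
  obtain ⟨q, hq⟩ : ∃ q, q = (1 / (1 - p.2)) ^ (2 * p.1) - 1 := ⟨_, rfl⟩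
  rw [← hq] at h5 ⊢
  field_simp
  ring

lemma scaled_eq_above {L ε : ℝ} (hε : 0 < ε) :
    (1 - ε ^ (2 * L - 1)) / (8 * Real.pi * (2 * L - 1) * ε)
      = 1 / (8 * Real.pi) * ((1 / ε) * (((1 / ε) ^ (1 - 2 * L) - 1) / (1 - 2 * L))) := by
  rw [one_div ε, Real.inv_rpow hε.le, ← Real.rpow_neg hε.le, neg_sub]
  rw [← neg_sub (ε ^ (2 * L - 1)) 1, ← neg_sub 1 (2 * L)]
  simp only [div_eq_mul_inv, mul_inv, mul_neg, neg_mul, inv_neg]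
  ring

lemma scaled_eq_below {L ε : ℝ} (hε : 0 < ε) :
    (1 - ε ^ (1 - 2 * L)) / (8 * Real.pi * (1 - 2 * L) * ε ^ (2 - 2 * L))
      = 1 / (8 * Real.pi) * ((1 / ε) * (((1 / ε) ^ (1 - 2 * L) - 1) / (1 - 2 * L))) := by
  have h1 : ε ^ (2 - 2 * L) = ε * ε ^ (1 - 2 * L) := by
    rw [show 2 - 2 * L = 1 + (1 - 2 * L) by ring, Real.rpow_add hε, Real.rpow_one]
  have h2 : 0 < ε ^ (1 - 2 * L) := by positivity
  rw [h1, one_div ε, Real.inv_rpow hε.le]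
  have h3 : (ε ^ (1 - 2 * L))⁻¹ - 1 = (1 - ε ^ (1 - 2 * L)) / ε ^ (1 - 2 * L) := by
    field_simp
  rw [h3]
  simp only [div_eq_mul_inv, mul_inv]
  ring

lemma scaled_eq_zero {L ε : ℝ} (hε : 0 < ε) :
    ε ^ (2 * L - 2) / (1 - ε ^ (2 * L)) = (1 / ε) ^ 2 / ((1 / ε) ^ (2 * L) - 1) := by
  have h1 : ε ^ (2 * L - 2) = ε ^ (2 * L) / ε ^ 2 := by
    rw [Real.rpow_sub hε, Real.rpow_two]
  have h2 : 0 < ε ^ (2 * L) := by positivity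
  rw [h1, one_div ε, Real.inv_rpow hε.le]
  have h3 : (ε ^ (2 * L))⁻¹ - 1 = (1 - ε ^ (2 * L)) / ε ^ (2 * L) := by
    field_simp
  rw [h3, div_div_eq_mul_div, inv_pow]
  ring

end

end HyperbolicGAF

end

/-! ### Transfer of the asymptotics from the integral to the variance -/

theorem theorem1p2 {Ω : Type*} [MeasurableSpace Ω] (P : Measure Ω) [IsProbabilityMeasure P]
    (a : ℕ → Ω → ℂ) (hlaw : ∀ n, HasLaw (a n) HyperbolicGAF.stdComplexNormal P)
    (hindep : iIndepFun a P) :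
    -- the variances are those of square integrable random variables
    (∀ L : ℝ, 0 < L → ∀ r : ℝ, 0 < r → r < 1 → MemLp (HyperbolicGAF.numZeros a L r) 2 P) ∧
    -- large intensity, as an asymptotic equivalence and as a limit
    ((fun p : ℝ × ℝ => Var[HyperbolicGAF.numZeros a p.1 p.2; P])
      ~[atTop ×ˢ 𝓝[<] (1 : ℝ)]
      (fun p : ℝ × ℝ => (riemannZeta (3 / 2)).re / (8 * √Real.pi) * (√p.1 / (1 - p.2)))) ∧
    Tendsto (fun p : ℝ × ℝ => (1 - p.2) / √p.1 * Var[HyperbolicGAF.numZeros a p.1 p.2; P])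
      (atTop ×ˢ 𝓝[<] (1 : ℝ)) (𝓝 ((riemannZeta (3 / 2)).re / (8 * √Real.pi))) ∧
    -- intensity tending to 1 / 2 from above
    ((fun p : ℝ × ℝ => Var[HyperbolicGAF.numZeros a p.1 p.2; P])
      ~[𝓝[>] (1 / 2 : ℝ) ×ˢ 𝓝[<] (1 : ℝ)]
      (fun p : ℝ × ℝ => (1 - (1 - p.2) ^ (2 * p.1 - 1)) /
        (8 * Real.pi * (2 * p.1 - 1) * (1 - p.2)))) ∧
    -- intensity tending to 1 / 2 from below
    ((fun p : ℝ × ℝ => Var[HyperbolicGAF.numZeros a p.1 p.2; P])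
      ~[𝓝[<] (1 / 2 : ℝ) ×ˢ 𝓝[<] (1 : ℝ)]
      (fun p : ℝ × ℝ => (1 - (1 - p.2) ^ (1 - 2 * p.1)) /
        (8 * Real.pi * (1 - 2 * p.1) * (1 - p.2) ^ (2 - 2 * p.1)))) ∧
    -- intensity tending to 0, with L / (1 - r) tending to infinity
    ((fun p : ℝ × ℝ => Var[HyperbolicGAF.numZeros a p.1 p.2; P])
      ~[(𝓝[>] (0 : ℝ) ×ˢ 𝓝[<] (1 : ℝ)) ⊓
          comap (fun p : ℝ × ℝ => p.1 / (1 - p.2)) atTop]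
      (fun p : ℝ × ℝ => p.1 ^ 2 / 4 *
        ((1 - p.2) ^ (2 * p.1 - 2) / (1 - (1 - p.2) ^ (2 * p.1))))) := by
  -- The integral formula requires `L > 0` and `0 < r < 1`, which hold eventually along each of the
  -- filters.
  have hvar : ∀ l : Filter ℝ, (∀ᶠ L in l, 0 < L) → ∀ᶠ p : ℝ × ℝ in l ×ˢ 𝓝[<] (1 : ℝ),
      HyperbolicGAF.varianceIntegral p.1 (HyperbolicGAF.scale p.2)
        = Var[HyperbolicGAF.numZeros a p.1 p.2; P] := by
    intro l hl
    filter_upwards [tendsto_fst.eventually hl, HyperbolicGAF.eventually_snd_mem] with p h1 h2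
    exact (HyperbolicGAF.memLp_and_variance_numZeros hlaw hindep h1 (by linarith [h2.1])
      h2.2).2.symm
  have hpos : ∀ l : Filter ℝ, ∀ᶠ p : ℝ × ℝ in l ×ˢ 𝓝[<] (1 : ℝ), 0 < 1 - p.2 := fun l =>
    HyperbolicGAF.eventually_snd_mem.mono fun p hp => by linarith [hp.2]
  have hhalf : ∀ᶠ L : ℝ in 𝓝 (1 / 2), 0 < L := lt_mem_nhds (by norm_num)
  refine ⟨fun L hL r hr hr1 =>
    (HyperbolicGAF.memLp_and_variance_numZeros hlaw hindep hL hr hr1).1, ?_, ?_, ?_, ?_, ?_⟩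
  · exact HyperbolicGAF.isEquivalent_varianceIntegral_atTop.congr_left
      (hvar _ (eventually_gt_atTop 0))
  · refine HyperbolicGAF.tendsto_varianceIntegral_atTop.congr' ?_
    filter_upwards [hvar _ (eventually_gt_atTop 0)] with p hp
    rw [hp]
  · refine ((HyperbolicGAF.isEquivalent_varianceIntegral_half nhdsWithin_le_nhds
      (eventually_mem_nhdsWithin.mono fun L (hL : 1 / 2 < L) => hL.ne')).congr_left
      (hvar _ (nhdsWithin_le_nhds hhalf))).congr_right ?_
    filter_upwards [hpos _] with p hp
    exact (HyperbolicGAF.scaled_eq_above hp).symm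
  · refine ((HyperbolicGAF.isEquivalent_varianceIntegral_half nhdsWithin_le_nhds
      (eventually_mem_nhdsWithin.mono fun L (hL : L < 1 / 2) => hL.ne)).congr_left
      (hvar _ (nhdsWithin_le_nhds hhalf))).congr_right ?_
    filter_upwards [hpos _] with p hp
    exact (HyperbolicGAF.scaled_eq_below hp).symm
  · refine ((HyperbolicGAF.isEquivalent_varianceIntegral_zero.congr_left
      (hvar _ self_mem_nhdsWithin)).congr_right ?_).mono inf_le_left
    filter_upwards [hpos _] with p hp
    rw [HyperbolicGAF.scaled_eq_zero hp]
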